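/- Let $M$ be a compact $n$-dimensional manifold without boundary of class $C^3$, let $\tau>0$, $k\in\mathbb N$, $k\ge 1$, $T=k\tau$ and $S_T=\mathbb R/T\mathbb Z$. Let $L:\mathbb R\times TM\to\mathbb R$ be of class $C^2$, $\tau$-periodic in $t$, with positive definite second derivatives along the fibres of $TM$. Let $\gamma_0\in C^1(S_T,M)$ be a critical point of $\mathcal L_T(\gamma)=\int_0^{T}L(t,\gamma,\dot\gamma)\,dt$ on $C^1(S_T,M)$. Let $B_\rho^n(0)$ be the ball of radius $\rho>0$ in $\mathbb R^n$ and let $\phi:\mathbb R\times B^n_\rho(0)\to M$ be coordinates along $\gamma_0$: $\phi(t+T,q)=\phi(t,q)$, $\phi(t,0)=\gamma_0(t)$, each $\phi(t,\cdot)$ is an injective immersion, and, in local coordinates of $M$, $\phi$ is $C^3$ in $q$, differentiable in $t$, and $\partial_t\phi$ is $C^2$ in $q$, all these derivatives being continuous in $(t,q)$ (for example $\phi(t,q)=\exp_{\gamma_0(t)}\bigl(\sum_i q_ie_i(t)\bigr)$ for a $T$-periodic $C^2$ frame $(e_i)$ along $\gamma_0\in C^2$ and a smooth Riemannian metric). Put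 $$\tilde L(t,q,v)=L\bigl(t,\phi(t,q),\partial_t\phi(t,q)+D_q\phi(t,q)v\bigr),\qquad \tilde{\mathcal L}_T(\xi)=\int_0^{T}\tilde L(t,\xi(t),\dot\xi(t))\,dt$$ for $\xi\in C^1(S_T,B^n_\rho(0))$, an open neighbourhood of $0$ in the Banach space $C^1(S_T,\mathbb R^n)$. Equip $W^{1,2}(S_T,\mathbb R^n)$ with the inner product $(\xi,\eta)_{W^{1,2}}=\int_0^T(\xi\cdot\eta+\dot\xi\cdot\dot\eta)\,dt$. Then $\tilde{\mathcal L}_T$ is differentiable near $0$ and twice Fréchet differentiable at $0$, there is exactly one bounded linear operator $B=B_{T}(0)$ on $W^{1,2}(S_T,\mathbb R^n)$ with $$d^2\tilde{\mathcal L}_T(0)(\xi,\eta)=(B\xi,\eta)_{W^{1,2}}\qquad\text{for all }\xi,\eta\in C^1(S_T,\mathbb R^n),$$ and $B$ is self-adjoint. Moreover: (CP1) $0$ is a critical point of $\tilde{\mathcal L}_T$, and either $0\notin\sigma(B)$ or $0$ is an isolated point of $\sigma(B)$. (CP2) If $\xi\in W^{1,2}(S_T,\mathbb R^n)$ and $B\xi\in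 C^1(S_T,\mathbb R^n)$, then $\xi\in C^1(S_T,\mathbb R^n)$. Finally, there is exactly one closed $B$-invariant subspace $H^-$ of $W^{1,2}(S_T,\mathbb R^n)$ such that $(B\xi,\xi)_{W^{1,2}}<0$ for $0\ne\xi\in H^-$ and $(B\xi,\xi)_{W^{1,2}}\ge 0$ for $\xi\perp H^-$ (the spectral subspace of $B$ for $(-\infty,0)$). It is finite-dimensional and contained in $C^1(S_T,\mathbb R^n)$, and every linear subspace of $W^{1,2}(S_T,\mathbb R^n)$ on which $\xi\mapsto(B\xi,\xi)_{W^{1,2}}$ is negative definite has dimension at most $\dim H^-$. -/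

import Mathlib

open Set Filter Topology MeasureTheory Function
open scoped Manifold ContDiff BoundedContinuousFunction

noncomputable section

namespace Loop

/-- `ℝⁿ` with its Euclidean inner product. -/
abbrev Eu (n : ℕ) : Type := EuclideanSpace ℝ (Fin n)

/-! ### The Banach space `C¹(S_T, ℝⁿ)` -/

/-- `C¹(S_T, ℝⁿ)`, `S_T = ℝ / Tℤ`: pairs `(ξ, ξ')` of bounded continuous functions on the line with
`ξ` of period `T` and `ξ'` the derivative of `ξ`. It carries the norm
`max (sup ‖ξ‖) (sup ‖ξ'‖)`. -/
def C1 (T : ℝ) (n : ℕ) : Submodule ℝ ((ℝ →ᵇ Eu n) × (ℝ →ᵇ Eu n)) where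
  carrier := {p | Periodic p.1 T ∧ ∀ t, HasDerivAt p.1 (p.2 t) t}
  zero_mem' := ⟨fun _ => rfl, fun t => hasDerivAt_const t (0 : Eu n)⟩
  add_mem' {a b} ha hb :=
    ⟨fun t => by simp [ha.1 t, hb.1 t], fun t => (ha.2 t).add (hb.2 t)⟩
  smul_mem' c a ha :=
    ⟨fun t => by simp [ha.1 t], fun t => (ha.2 t).const_smul c⟩

instance (T : ℝ) (n : ℕ) : NormedAddCommGroup (C1 T n) := Submodule.normedAddCommGroup _

instance (T : ℝ) (n : ℕ) : NormedSpace ℝ (C1 T n) := Submodule.normedSpace _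

/-! ### The Hilbert space `W^{1,2}(S_T, ℝⁿ)` -/

/-- Lebesgue measure on a period `(0, T]`. -/
abbrev perMeas (T : ℝ) : Measure ℝ := volume.restrict (Ioc 0 T)

/-- `L²(S_T, ℝⁿ)`. -/
abbrev L2 (T : ℝ) (n : ℕ) : Type := Lp (Eu n) 2 (perMeas T)

theorem memLp_of_continuous {T : ℝ} {n : ℕ} {f : ℝ → Eu n} (hf : Continuous f) :
    MemLp f 2 (perMeas T) := by
  obtain ⟨C, hC⟩ := (isCompact_Icc (a := (0 : ℝ)) (b := T)).exists_bound_of_continuousOn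
    hf.continuousOn
  refine MemLp.of_bound hf.aestronglyMeasurable C ?_
  filter_upwards [ae_restrict_mem measurableSet_Ioc] with t ht
  exact hC t (Ioc_subset_Icc_self ht)

theorem inner_toLp {T : ℝ} {n : ℕ} (u : L2 T n) {f : ℝ → Eu n} (hf : Continuous f) :
    inner ℝ u (memLp_of_continuous (T := T) hf).toLp = ∫ t, inner ℝ (u t) (f t) ∂(perMeas T) := by
  rw [MeasureTheory.L2.inner_def]
  refine integral_congr_ae ?_
  filter_upwards [(memLp_of_continuous (T := T) hf).coeFn_toLp] with t ht
  rw [ht]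

/-- `w` is the weak derivative of `u` on the circle `S_T`, tested against the smooth functions
of period `T`. -/
def IsWeakDeriv {T : ℝ} {n : ℕ} (u w : L2 T n) : Prop :=
  ∀ ψ : ℝ → Eu n, ContDiff ℝ ∞ ψ → Periodic ψ T →
    ∫ t, inner ℝ (u t) (deriv ψ t) ∂(perMeas T) = -∫ t, inner ℝ (w t) (ψ t) ∂(perMeas T)

theorem isWeakDeriv_iff {T : ℝ} {n : ℕ} (u w : L2 T n) :
    IsWeakDeriv u w ↔ ∀ (ψ : ℝ → Eu n) (h : ContDiff ℝ ∞ ψ), Periodic ψ T →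
      inner ℝ u (memLp_of_continuous (T := T) (h.continuous_deriv (by simp))).toLp
        + inner ℝ w (memLp_of_continuous (T := T) h.continuous).toLp = 0 := by
  unfold IsWeakDeriv
  refine forall_congr' fun ψ => forall_congr' fun h => forall_congr' fun _ => ?_
  rw [inner_toLp u (h.continuous_deriv (by simp)), inner_toLp w h.continuous,
    ← eq_neg_iff_add_eq_zero]

/-- `W^{1,2}(S_T, ℝⁿ)`: pairs `(ξ, ξ')` in `L²` with `ξ'` the weak derivative of `ξ`. The inner
product is `∫₀ᵀ (ξ · η + ξ' · η') dt`. -/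
def W12 (T : ℝ) (n : ℕ) : Submodule ℝ (WithLp 2 (L2 T n × L2 T n)) where
  carrier := {p | IsWeakDeriv p.fst p.snd}
  zero_mem' := by
    simp only [mem_ofPred_eq, isWeakDeriv_iff]
    intros
    simp
  add_mem' {a b} ha hb := by
    simp only [mem_ofPred_eq, isWeakDeriv_iff] at *
    intro ψ h hp
    have h1 := ha ψ h hp
    have h2 := hb ψ h hp
    simp only [WithLp.add_fst, WithLp.add_snd, inner_add_left]
    linarith
  smul_mem' c a ha := by
    simp only [mem_ofPred_eq, isWeakDeriv_iff] at *
    intro ψ h hp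
    have h1 := ha ψ h hp
    simp only [WithLp.smul_fst, WithLp.smul_snd, real_inner_smul_left]
    rw [← mul_add, h1, mul_zero]

theorem isClosed_W12 (T : ℝ) (n : ℕ) : IsClosed (W12 T n : Set (WithLp 2 (L2 T n × L2 T n))) := by
  have : (W12 T n : Set (WithLp 2 (L2 T n × L2 T n))) =
      {p | ∀ (ψ : ℝ → Eu n) (h : ContDiff ℝ ∞ ψ), Periodic ψ T →
      inner ℝ p.fst (memLp_of_continuous (T := T) (h.continuous_deriv (by simp))).toLp
        + inner ℝ p.snd (memLp_of_continuous (T := T) h.continuous).toLp = 0} := by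
    ext p
    exact isWeakDeriv_iff p.fst p.snd
  rw [this]
  simp only [ofPred_forall]
  refine isClosed_iInter fun ψ => isClosed_iInter fun h => isClosed_iInter fun _ => ?_
  refine isClosed_eq ?_ continuous_const
  have h1 : Continuous fun p : WithLp 2 (L2 T n × L2 T n) => p.fst :=
    continuous_fst.comp (WithLp.prod_continuous_ofLp 2 _ _)
  have h2 : Continuous fun p : WithLp 2 (L2 T n × L2 T n) => p.snd :=
    continuous_snd.comp (WithLp.prod_continuous_ofLp 2 _ _)
  exact (h1.inner continuous_const).add (h2.inner continuous_const)

instance (T : ℝ) (n : ℕ) : CompleteSpace (W12 T n) :=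
  (isClosed_W12 T n).completeSpace_coe

theorem isWeakDeriv_of_mem_C1 {T : ℝ} {n : ℕ} (p : C1 T n) :
    IsWeakDeriv (T := T) (n := n) (memLp_of_continuous (T := T) p.1.1.continuous).toLp
      (memLp_of_continuous (T := T) p.1.2.continuous).toLp := by
  intro ψ hψ hp
  have e1 : ∫ t, inner ℝ (((memLp_of_continuous (T := T) p.1.1.continuous).toLp : L2 T n) t) (deriv ψ t)
      ∂(perMeas T) = ∫ t, inner ℝ (p.1.1 t) (deriv ψ t) ∂(perMeas T) := by
    refine integral_congr_ae ?_
    filter_upwards [(memLp_of_continuous (T := T) p.1.1.continuous).coeFn_toLp] with t ht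
    rw [ht]
  have e2 : ∫ t, inner ℝ (((memLp_of_continuous (T := T) p.1.2.continuous).toLp : L2 T n) t) (ψ t)
      ∂(perMeas T) = ∫ t, inner ℝ (p.1.2 t) (ψ t) ∂(perMeas T) := by
    refine integral_congr_ae ?_
    filter_upwards [(memLp_of_continuous (T := T) p.1.2.continuous).coeFn_toLp] with t ht
    rw [ht]
  rw [e1, e2]
  rcases le_or_gt T 0 with hT | hT
  · simp [perMeas, Ioc_eq_empty (not_lt.mpr hT)]
  have c1 : Continuous fun t => inner ℝ (p.1.1 t) (deriv ψ t) :=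
    p.1.1.continuous.inner (hψ.continuous_deriv (by simp))
  have c2 : Continuous fun t => inner ℝ (p.1.2 t) (ψ t) :=
    p.1.2.continuous.inner hψ.continuous
  have hd : ∀ t, HasDerivAt (fun t => inner ℝ (p.1.1 t) (ψ t))
      (inner ℝ (p.1.1 t) (deriv ψ t) + inner ℝ (p.1.2 t) (ψ t)) t := fun t =>
    (p.2.2 t).inner ℝ ((hψ.differentiable (by simp)) t).hasDerivAt
  have key := intervalIntegral.integral_eq_sub_of_hasDerivAt (a := 0) (b := T)
    (fun t _ => hd t) ((c1.add c2).intervalIntegrable _ _)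
  have q1 : p.1.1 T = p.1.1 0 := by simpa using p.2.1 0
  have q2 : ψ T = ψ 0 := by simpa using hp 0
  rw [q1, q2, sub_self, intervalIntegral.integral_add (c1.intervalIntegrable _ _)
    (c2.intervalIntegrable _ _), intervalIntegral.integral_of_le hT.le,
    intervalIntegral.integral_of_le hT.le] at key
  linarith

/-- The inclusion `C¹(S_T, ℝⁿ) ⊆ W^{1,2}(S_T, ℝⁿ)`. -/
def incl (T : ℝ) (n : ℕ) : C1 T n →ₗ[ℝ] W12 T n where
  toFun p := ⟨WithLp.toLp 2 ((memLp_of_continuous (T := T) p.1.1.continuous).toLp,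
    (memLp_of_continuous (T := T) p.1.2.continuous).toLp), isWeakDeriv_of_mem_C1 p⟩
  map_add' _ _ := rfl
  map_smul' _ _ := rfl

/-! ### Families of maps into a manifold -/

section Families

variable {E F : Type*} [NormedAddCommGroup E] [NormedSpace ℝ E]
  [NormedAddCommGroup F] [NormedSpace ℝ F]

/-- Near `p`, the maps `h t` are of class `C^r`, and their derivatives of order `≤ r` are continuous
jointly in `t` and the point. -/
def ContDiffSndAt (r : ℕ) (h : ℝ → E → F) (p : ℝ × E) : Prop :=
  ∀ᶠ z in 𝓝 p, ContDiffAt ℝ r (h z.1) z.2 ∧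
    ∀ j ≤ r, ContinuousAt (fun w : ℝ × E => iteratedFDeriv ℝ j (h w.1) w.2) z

variable (n : ℕ) {M : Type*} [TopologicalSpace M] [ChartedSpace (Eu n) M]

/-- `f`, read in the preferred chart of `M` at `f t₀ q₀`. -/
def localRep (f : ℝ → E → M) (t₀ : ℝ) (q₀ : E) : ℝ → E → Eu n :=
  fun t q => extChartAt (𝓡 n) (f t₀ q₀) (f t q)

/-- In local coordinates of `M`, `f t q` (for `q ∈ U`) is of class `C^r` in `q`, it is differentiable
in `t`, and `∂f/∂t` is of class `C^s` in `q`, where all the derivatives in question are continuous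
in `(t, q)`. -/
structure IsFamily (r s : ℕ) (f : ℝ → E → M) (U : Set E) : Prop where
  cont : ContinuousOn (uncurry f) (univ ×ˢ U)
  space : ∀ t, ∀ q ∈ U, ContDiffSndAt r (localRep n f t q) (t, q)
  diff : ∀ t, ∀ q ∈ U, ∀ᶠ z in 𝓝 (t, q),
    DifferentiableAt ℝ (fun t' => localRep n f t q t' z.2) z.1
  time : ∀ t, ∀ q ∈ U,
    ContDiffSndAt s (fun t' x => deriv (fun t'' => localRep n f t q t'' x) t') (t, q)

end Families

/-! ### Lagrangians, critical loops, and the pull-back -/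

section Lagrangian

variable {n : ℕ} {M : Type*} [TopologicalSpace M] [ChartedSpace (Eu n) M] [IsManifold (𝓡 n) 1 M]

/-- `∫₀ᵀ L(t, γ(t), γ'(t)) dt`. -/
def action (T : ℝ) (L : ℝ × TangentBundle (𝓡 n) M → ℝ) (γ : ℝ → M) : ℝ :=
  ∫ t in (0 : ℝ)..T, L (t, ⟨γ t, mfderiv 𝓘(ℝ, ℝ) (𝓡 n) γ t (1 : ℝ)⟩)

/-- `L` has positive definite second derivatives along the fibres of `TM`. -/
def FibrewiseConvex (L : ℝ × TangentBundle (𝓡 n) M → ℝ) : Prop :=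
  ∀ (t : ℝ) (x : M) (v u : TangentSpace (𝓡 n) x), u ≠ 0 →
    0 < iteratedDeriv 2 (fun s : ℝ => L (t, ⟨x, v + s • u⟩)) 0

/-- The loop `γ` of period `T` is a critical point of the action on `C¹(S_T, M)`: the derivative
of the action vanishes along every `C¹` path `s ↦ Γ(·, s)`, `|s| < ε`, of `C¹` loops of period `T`
that passes through `γ` at `s = 0`. -/
def IsCriticalLoop (T : ℝ) (L : ℝ × TangentBundle (𝓡 n) M → ℝ) (γ : ℝ → M) : Prop :=
  Periodic γ T ∧ ContMDiff 𝓘(ℝ, ℝ) (𝓡 n) 1 γ ∧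
    ∀ (ε : ℝ) (Γ : ℝ → ℝ → M), 0 < ε → IsFamily n 1 1 Γ (Metric.ball 0 ε) →
      (∀ t, ∀ s ∈ Metric.ball (0 : ℝ) ε, Γ (t + T) s = Γ t s) → (∀ t, Γ t 0 = γ t) →
      HasDerivAt (fun s => action T L (fun t => Γ t s)) 0 0

/-- `φ`, defined on `ℝ × B_ρ(0)`, is a family of coordinates along the loop `γ`: it has period `T`
in `t`, it maps `(t, 0)` to `γ t`, and each `φ t` is an injective immersion of the ball (a local
parametrization of `M`). The induced map `ξ ↦ (t ↦ φ t (ξ t))` is a chart at `γ` of the manifold of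
loops. The regularity is that of `φ t q = exp_{γ t} (∑ qᵢ eᵢ(t))` for a periodic frame `e`
of class `C²` along a loop `γ` of class `C²`. -/
structure IsLoopChart (T ρ : ℝ) (γ : ℝ → M) (φ : ℝ → Eu n → M) : Prop where
  regular : IsFamily n 3 2 φ (Metric.ball 0 ρ)
  periodic : ∀ t, ∀ q ∈ Metric.ball (0 : Eu n) ρ, φ (t + T) q = φ t q
  center : ∀ t, φ t 0 = γ t
  injOn : ∀ t, InjOn (φ t) (Metric.ball 0 ρ)
  immersion : ∀ t, ∀ q ∈ Metric.ball (0 : Eu n) ρ,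
    Injective (mfderiv 𝓘(ℝ, Eu n) (𝓡 n) (φ t) q)

/-- The pull-back `L̃(t, q, v) = L(t, φ(t, q), ∂ₜφ(t, q) + D_qφ(t, q) v)`. -/
def pullback (L : ℝ × TangentBundle (𝓡 n) M → ℝ) (φ : ℝ → Eu n → M) (t : ℝ) (q v : Eu n) : ℝ :=
  L (t, ⟨φ t q, mfderiv 𝓘(ℝ, ℝ × Eu n) (𝓡 n) (uncurry φ) (t, q) ((1, v) : ℝ × Eu n)⟩)

/-- The pulled-back functional `ξ ↦ ∫₀ᵀ L̃(t, ξ(t), ξ'(t)) dt`; it is meaningful on the open set of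
those `ξ` that take values in `B_ρ(0)`, a neighbourhood of `0`. -/
def pulledAction (T : ℝ) (L : ℝ × TangentBundle (𝓡 n) M → ℝ) (φ : ℝ → Eu n → M)
    (ξ : C1 T n) : ℝ :=
  ∫ t in (0 : ℝ)..T, pullback L φ t (ξ.1.1 t) (ξ.1.2 t)

end Lagrangian

/-! ### The operator of the second variation -/

/-- The functional `f` on `C¹(S_T, ℝⁿ)` is twice (Fréchet) differentiable at `0`, and
`d²f(0)(ξ, η) = (Bξ, η)` in `W^{1,2}`. -/
def RepresentsHessian {T : ℝ} {n : ℕ} (f : C1 T n → ℝ) (B : W12 T n →L[ℝ] W12 T n) : Prop :=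
  (∀ᶠ ξ in 𝓝 (0 : C1 T n), DifferentiableAt ℝ f ξ) ∧
    ∃ D : C1 T n →L[ℝ] C1 T n →L[ℝ] ℝ, HasFDerivAt (fderiv ℝ f) D 0 ∧
      ∀ ξ η : C1 T n, D ξ η = inner ℝ (B (incl T n ξ)) (incl T n η)

/-- `V` is the negative space of `B`: a closed `B`-invariant subspace such that `B` is negative
definite on `V` and nonnegative on the orthogonal complement of `V`. For self-adjoint `B` this is
the spectral subspace of `B` that belongs to `(-∞, 0)`. -/
structure IsNegativeSpace {H : Type*} [NormedAddCommGroup H] [InnerProductSpace ℝ H]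
    (B : H →L[ℝ] H) (V : Submodule ℝ H) : Prop where
  closed : IsClosed (V : Set H)
  invariant : ∀ v ∈ V, B v ∈ V
  neg : ∀ v ∈ V, v ≠ 0 → inner ℝ (B v) v < 0
  nonneg : ∀ w ∈ Vᗮ, 0 ≤ inner ℝ (B w) w

end Loop

end

noncomputable section

namespace Loop

/-! ### Self-adjoint operators that are coercive on a subspace of finite codimension -/

section Abstract

variable {H : Type*} [NormedAddCommGroup H] [InnerProductSpace ℝ H]

/-! In the coordinates `φ` the action is `∫ L̃(t, ξ, ξ') dt`, with `L̃` of class `C²` in `(q, v)`.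
Its Hessian at `0` is `∫ (P ξ' · η' + Q ξ · η' + Q' ξ' · η + R ξ · η) dt` with continuous periodic
coefficients, where `P`, `R` are symmetric and `Q'` is the transpose of `Q`. The leading coefficient
`P = ∂²L̃/∂v²` is positive definite, because `L` is convex along the fibres and `φ t` is an
immersion. The form is bounded in the `W^{1,2}` norm, hence given by a bounded self-adjoint operator
`B`; density of `C¹` in `W^{1,2}` makes `B` unique.

The spectral statements rest on a Gårding inequality (`exists_coercive_subspace`): on loops whose
means over many short intervals all vanish, Poincaré's inequality makes the terms with `Q`, `Q'`,
`R` small against `P`, so `B` is coercive on a subspace of finite codimension. Compactness in the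
remaining finitely many directions shows that `B` is bounded below on `(ker B)ᗮ`
(`exists_bounded_below`), so `0` is at most an isolated point of the spectrum. Coercivity also
bounds the dimension of every negative subspace; a negative infimum of the Rayleigh quotient is
attained at an eigenvector, and a maximal negative invariant subspace is therefore the negative
space (`exists_isNegativeSpace`).

Regularity is du Bois-Reymond's argument (`mem_range_incl_of_formOp`). If `B ξ = μ ξ + g` with `g`
in `C¹`, the momentum `(P - μ) ξ' + Q ξ - g'` has a weak derivative in `L²`, hence a continuous
representative; for `μ ≤ 0` the factor `P - μ` is invertible and `ξ'` is continuous. The case `μ =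
0` is (CP2), and `g = 0` puts the eigenvectors that span the negative space into `C¹`. -/

theorem exists_norm_le_of_coercive {A : H →L[ℝ] H} {N : Submodule ℝ H} [N.HasOrthogonalProjection]
    {c : ℝ} (hc : 0 < c) (hN : ∀ x ∈ N, c * ‖x‖ ^ 2 ≤ inner ℝ (A x) x) :
    ∃ C, 0 ≤ C ∧ ∀ x, ‖x‖ ≤ C * (‖A x‖ + ‖Nᗮ.starProjection x‖) := by
  -- Split `x = a + b` along `N` and `Nᗮ`. Coercivity at `a` gives `c ‖a‖ ≤ ‖A x‖ + ‖A‖ ‖b‖`; adding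
  -- `‖b‖` to the resulting bound for `‖a‖` yields this constant.
  refine ⟨1 + (1 + ‖A‖) / c, by positivity, fun x => ?_⟩
  set a := N.starProjection x
  set b := Nᗮ.starProjection x
  have hab : x = a + b := (N.starProjection_add_starProjection_orthogonal x).symm
  have h1 := hN a (N.starProjection_apply_mem x)
  have h2 : A a = A x - A b := by rw [hab]; simp
  have h3 : inner ℝ (A a) a ≤ (‖A x‖ + ‖A‖ * ‖b‖) * ‖a‖ := by
    refine (real_inner_le_norm _ _).trans ?_
    gcongr
    rw [h2]
    refine (norm_sub_le _ _).trans ?_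
    gcongr
    exact A.le_opNorm b
  have h4 : c * ‖a‖ ≤ ‖A x‖ + ‖A‖ * ‖b‖ := by
    rcases (norm_nonneg a).eq_or_lt with h | h
    · rw [← h]; simp only [mul_zero]; positivity
    · refine le_of_mul_le_mul_right ?_ h
      nlinarith
  have h5 : ‖a‖ ≤ (‖A x‖ + ‖A‖ * ‖b‖) / c := by rw [le_div_iff₀ hc]; linarith
  have h6 : ‖x‖ ≤ ‖a‖ + ‖b‖ := by rw [hab]; exact norm_add_le _ _
  have h7 : (‖A x‖ + ‖A‖ * ‖b‖) / c ≤ (1 + ‖A‖) / c * (‖A x‖ + ‖b‖) := by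
    rw [div_mul_eq_mul_div]
    gcongr
    nlinarith [norm_nonneg (A x), norm_nonneg b, norm_nonneg A,
      mul_nonneg (norm_nonneg A) (norm_nonneg (A x))]
  nlinarith [norm_nonneg (A x)]

/-- The orthogonal projection `S → V` is injective: a vector of its kernel lies in `S ∩ Vᗮ`, where
the form is both negative and nonnegative. -/
theorem finrank_le_of_neg_of_nonneg {B : H →L[ℝ] H} {V S : Submodule ℝ H}
    [FiniteDimensional ℝ V] (hV : ∀ w ∈ Vᗮ, 0 ≤ inner ℝ (B w) w)
    (hS : ∀ v ∈ S, v ≠ 0 → inner ℝ (B v) v < 0) :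
    FiniteDimensional ℝ S ∧ Module.finrank ℝ S ≤ Module.finrank ℝ V := by
  let f : S →ₗ[ℝ] V := V.orthogonalProjectionOnto.toLinearMap ∘ₗ S.subtype
  have hf : Injective f := by
    rw [← LinearMap.ker_eq_bot, eq_bot_iff]
    intro x hx
    have h1 : (x : H) ∈ Vᗮ := V.orthogonalProjectionOnto_eq_zero_iff.mp hx
    by_contra hne
    have h2 := hS x x.2 (by simpa using hne)
    linarith [hV x h1]
  exact ⟨FiniteDimensional.of_injective f hf, LinearMap.finrank_le_finrank_of_injective hf⟩

variable [CompleteSpace H]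

/-- An operator that is coercive on a subspace of finite codimension is bounded below on every
closed subspace that contains no vector of its kernel. -/
theorem exists_bounded_below {A : H →L[ℝ] H} {N : Submodule ℝ H} [N.HasOrthogonalProjection]
    [FiniteDimensional ℝ Nᗮ] {c : ℝ} (hc : 0 < c)
    (hN : ∀ x ∈ N, c * ‖x‖ ^ 2 ≤ inner ℝ (A x) x) {W : Submodule ℝ H}
    (hW : IsClosed (W : Set H)) (hker : ∀ x ∈ W, A x = 0 → x = 0) :
    ∃ δ > 0, ∀ x ∈ W, δ * ‖x‖ ≤ ‖A x‖ := by
  obtain ⟨C, hC0, hC⟩ := exists_norm_le_of_coercive hc hN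
  by_contra! hcon
  have hu : ∀ k : ℕ, ∃ x ∈ W, ‖x‖ = 1 ∧ ‖A x‖ < 1 / (k + 1) := by
    intro k
    obtain ⟨x, hx, hlt⟩ := hcon (1 / ((k : ℝ) + 1)) (by positivity)
    have hx0 : 0 < ‖x‖ := by
      rcases (norm_nonneg x).eq_or_lt with h | h
      · rw [← h, mul_zero] at hlt; exact absurd hlt (not_lt.mpr (norm_nonneg _))
      · exact h
    refine ⟨‖x‖⁻¹ • x, W.smul_mem _ hx, ?_, ?_⟩
    · rw [norm_smul, norm_inv, norm_norm, inv_mul_cancel₀ hx0.ne']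
    · rw [map_smul, norm_smul, norm_inv, norm_norm, inv_mul_lt_iff₀ hx0, mul_comm]
      exact hlt
  choose x hxW hx1 hxA using hu
  have hAx : Tendsto (fun k => A (x k)) atTop (𝓝 0) :=
    squeeze_zero_norm (fun k => (hxA k).le) tendsto_one_div_add_atTop_nhds_zero_nat
  have hbd : ∀ k, (Nᗮ.orthogonalProjectionOnto (x k) : Nᗮ) ∈ Metric.closedBall (0 : Nᗮ) 1 := by
    intro k
    rw [mem_closedBall_zero_iff, ← hx1 k]
    exact Nᗮ.norm_orthogonalProjectionOnto_apply_le (x k)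
  obtain ⟨p, -, s, hs, hp⟩ := (isCompact_closedBall (0 : Nᗮ) 1).tendsto_subseq hbd
  have hp' : CauchySeq fun k => Nᗮ.starProjection (x (s k)) :=
    ((Nᗮ.subtypeL.continuous.tendsto p).comp hp).cauchySeq
  have hA' : CauchySeq fun k => A (x (s k)) := (hAx.comp hs.tendsto_atTop).cauchySeq
  -- The images under `A` and the projections to `Nᗮ` both converge along the subsequence, so the
  -- estimate `hC`, applied to differences, transfers the Cauchy property to the vectors. Their
  -- limit would be a unit vector of `W` in the kernel of `A`.
  have hcau : CauchySeq fun k => x (s k) := by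
    rw [Metric.cauchySeq_iff] at hp' hA' ⊢
    intro ε hε
    obtain ⟨N1, h1⟩ := hp' (ε / (2 * (C + 1))) (by positivity)
    obtain ⟨N2, h2⟩ := hA' (ε / (2 * (C + 1))) (by positivity)
    refine ⟨max N1 N2, fun m hm k hk => ?_⟩
    have e1 := h1 m (le_of_max_le_left hm) k (le_of_max_le_left hk)
    have e2 := h2 m (le_of_max_le_right hm) k (le_of_max_le_right hk)
    have e3 := hC (x (s m) - x (s k))
    rw [dist_eq_norm, ← map_sub] at e1 e2
    rw [dist_eq_norm]
    have e4 : ε / (2 * (C + 1)) + ε / (2 * (C + 1)) = ε / (C + 1) := by field_simp; norm_num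
    have e5 : C * (ε / (C + 1)) < ε := by
      rw [mul_div_assoc', div_lt_iff₀ (by positivity)]; nlinarith
    refine e3.trans_lt (lt_of_le_of_lt ?_ e5)
    gcongr
    linarith
  obtain ⟨y, hy⟩ := cauchySeq_tendsto_of_complete hcau
  have hyW : y ∈ W := hW.mem_of_tendsto hy (Eventually.of_forall fun k => hxW (s k))
  have hy1 : ‖y‖ = 1 := tendsto_nhds_unique hy.norm (by simp [hx1])
  have hyA : A y = 0 :=
    tendsto_nhds_unique ((A.continuous.tendsto y).comp hy) (hAx.comp hs.tendsto_atTop)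
  rw [hker y hyW hyA, norm_zero] at hy1
  exact zero_ne_one hy1

/-- A self-adjoint operator that is bounded below is invertible. -/
theorem isUnit_of_bounded_below {A : H →L[ℝ] H} (hA : IsSelfAdjoint A) {δ : ℝ} (hδ : 0 < δ)
    (h : ∀ x, δ * ‖x‖ ≤ ‖A x‖) : IsUnit A := by
  have hanti : AntilipschitzWith (Real.toNNReal δ⁻¹) A := by
    refine A.antilipschitz_of_bound fun x => ?_
    rw [Real.coe_toNNReal _ (by positivity), inv_mul_eq_div, le_div_iff₀ hδ, mul_comm]
    exact h x
  have hinj : LinearMap.ker A.toLinearMap = ⊥ := LinearMap.ker_eq_bot.mpr hanti.injective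
  have hclosed : IsClosed (LinearMap.range A.toLinearMap : Set H) := by
    exact hanti.isClosed_range A.uniformContinuous
  -- The range is closed, and a vector `y` orthogonal to it satisfies `‖A y‖² = ⟨A (A y), y⟩ = 0`.
  have hrange : LinearMap.range A.toLinearMap = ⊤ := by
    rw [← hclosed.submodule_topologicalClosure_eq,
      Submodule.topologicalClosure_eq_top_iff, eq_bot_iff]
    intro y hy
    rw [Submodule.mem_orthogonal] at hy
    have : A y = 0 := by
      rw [← inner_self_eq_zero (𝕜 := ℝ)]
      have h1 := hy (A (A y)) ⟨A y, rfl⟩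
      rwa [← ContinuousLinearMap.adjoint_inner_right, hA.adjoint_eq] at h1
    have h2 : y ∈ LinearMap.ker A.toLinearMap := this
    rwa [hinj] at h2
  exact ContinuousLinearMap.isUnit_iff_bijective.mpr
    ⟨LinearMap.ker_eq_bot.mp hinj, LinearMap.range_eq_top.mp hrange⟩

/-- Let `δ` be a lower bound of `B` on `(ker B)ᗮ`. For `0 < |μ| < δ`, `μ - B` is multiplication by
`μ` on `ker B` and is bounded below by `δ - |μ|` on the invariant complement. By Pythagoras it is
bounded below on `H`, hence invertible. -/
theorem zero_notMem_spectrum_or_isolated {B : H →L[ℝ] H} (hB : IsSelfAdjoint B)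
    {N : Submodule ℝ H} [N.HasOrthogonalProjection]
    [FiniteDimensional ℝ Nᗮ] {c : ℝ} (hc : 0 < c)
    (hN : ∀ x ∈ N, c * ‖x‖ ^ 2 ≤ inner ℝ (B x) x) :
    (0 : ℝ) ∉ spectrum ℝ B ∨ ∃ ε > 0, spectrum ℝ B ∩ Metric.ball 0 ε = {0} := by
  rw [or_iff_not_imp_left, not_not]
  intro h0
  have hsym : ∀ x y, inner ℝ (B x) y = inner ℝ x (B y) := fun x y => by
    conv_lhs => rw [← hB.adjoint_eq]
    exact ContinuousLinearMap.adjoint_inner_left _ _ _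
  set K : Submodule ℝ H := LinearMap.ker B.toLinearMap
  have hKc : IsClosed (K : Set H) := B.isClosed_ker
  have : CompleteSpace K := hKc.completeSpace_coe
  obtain ⟨δ, hδ, hbb⟩ := exists_bounded_below hc hN (W := Kᗮ) K.isClosed_orthogonal
    (fun x hx hxk => by
      have h1 : x ∈ K := hxk
      exact inner_self_eq_zero.mp (hx x h1))
  refine ⟨δ, hδ, Subset.antisymm ?_ (by simpa using ⟨h0, hδ⟩)⟩
  rintro μ ⟨hμ, hμδ⟩
  by_contra hne
  rw [mem_singleton_iff] at hne
  rw [mem_ball_zero_iff, Real.norm_eq_abs] at hμδ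
  rw [spectrum.mem_iff] at hμ
  refine hμ (isUnit_of_bounded_below (δ := min |μ| (δ - |μ|)) ?_ ?_ ?_)
  · exact (IsSelfAdjoint.algebraMap _ (IsSelfAdjoint.all μ)).sub hB
  · exact lt_min (abs_pos.mpr hne) (by linarith)
  · intro x
    set m := min |μ| (δ - |μ|)
    have hm : 0 ≤ m := le_min (abs_nonneg _) (by linarith)
    set a := K.starProjection x
    set b := Kᗮ.starProjection x
    have hab : x = a + b := (K.starProjection_add_starProjection_orthogonal x).symm
    have haK : a ∈ K := K.starProjection_apply_mem x
    have hbK : b ∈ Kᗮ := Kᗮ.starProjection_apply_mem x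
    have hBa : B a = 0 := haK
    have hBb : B b ∈ Kᗮ := fun y hy => by
      rw [← hsym, show B y = 0 from hy, inner_zero_left]
    have hval : (algebraMap ℝ (H →L[ℝ] H) μ - B) x = μ • a + (μ • b - B b) := by
      rw [hab]
      simp only [sub_apply, Algebra.algebraMap_eq_smul_one,
        smul_apply, one_apply_eq_self, map_add, hBa]
      module
    have ho : inner ℝ (μ • a) (μ • b - B b) = (0 : ℝ) :=
      (Kᗮ.sub_mem (Kᗮ.smul_mem μ hbK) hBb) _ (K.smul_mem μ haK)
    have ho' : inner ℝ a b = (0 : ℝ) := hbK a haK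
    have n1 : ‖μ • a + (μ • b - B b)‖ ^ 2 = ‖μ • a‖ ^ 2 + ‖μ • b - B b‖ ^ 2 := by
      rw [norm_add_sq_real, ho]; ring
    have n2 : ‖x‖ ^ 2 = ‖a‖ ^ 2 + ‖b‖ ^ 2 := by
      rw [hab, norm_add_sq_real, ho']; ring
    have n3 : m * ‖a‖ ≤ ‖μ • a‖ := by
      rw [norm_smul, Real.norm_eq_abs]; gcongr; exact min_le_left _ _
    have n4 : m * ‖b‖ ≤ ‖μ • b - B b‖ := by
      have e1 := hbb b hbK
      have e2 : ‖B b‖ - ‖μ • b‖ ≤ ‖μ • b - B b‖ := by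
        rw [norm_sub_rev]; exact norm_sub_norm_le _ _
      rw [norm_smul, Real.norm_eq_abs] at e2
      have e3 : m ≤ δ - |μ| := min_le_right _ _
      nlinarith [norm_nonneg b]
    rw [hval]
    refine (sq_le_sq₀ (by positivity) (norm_nonneg _)).mp ?_
    rw [n1, mul_pow, n2]
    nlinarith [pow_le_pow_left₀ (by positivity) n3 2, pow_le_pow_left₀ (by positivity) n4 2]

/-- A finite-dimensional invariant subspace of a symmetric operator is spanned by eigenvectors. -/
theorem le_of_forall_eigenvector_mem {B : H →L[ℝ] H} (hB : IsSelfAdjoint B)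
    {V S : Submodule ℝ H} [FiniteDimensional ℝ V] (hinv : ∀ v ∈ V, B v ∈ V)
    (hS : ∀ (μ : ℝ), ∀ v ∈ V, B v = μ • v → v ∈ S) : V ≤ S := by
  have hsym : B.toLinearMap.IsSymmetric := hB.isSymmetric
  let R : V →ₗ[ℝ] V := B.toLinearMap.restrict hinv
  have hR : R.IsSymmetric := hsym.restrict_invariant hinv
  have htop : (⨆ μ : ℝ, Module.End.eigenspace R μ) = ⊤ := by
    rw [← Submodule.orthogonal_eq_bot_iff]
    exact hR.orthogonalComplement_iSup_eigenspaces_eq_bot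
  have hle : (⨆ μ : ℝ, Module.End.eigenspace R μ) ≤ S.comap V.subtype := by
    refine iSup_le fun μ v hv => ?_
    rw [Module.End.mem_eigenspace_iff] at hv
    exact hS μ v v.2 (congrArg Subtype.val hv)
  intro v hv
  rw [htop] at hle
  exact hle (x := ⟨v, hv⟩) trivial

/-- It suffices to treat an eigenvector `v` in `V'`, whose eigenvalue `μ` is negative. Since `V` and
`Vᗮ` are invariant, the component of `v` in `Vᗮ` is zero or again an eigenvector for `μ`; the latter
is impossible where the form is nonnegative. Used in both directions, this gives uniqueness of the
negative space. -/
theorem le_of_neg_of_nonneg {B : H →L[ℝ] H} (hB : IsSelfAdjoint B) {V V' : Submodule ℝ H}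
    [FiniteDimensional ℝ V] [FiniteDimensional ℝ V'] (hinv' : ∀ v ∈ V', B v ∈ V')
    (hneg' : ∀ v ∈ V', v ≠ 0 → inner ℝ (B v) v < 0) (hinv : ∀ v ∈ V, B v ∈ V)
    (hnonneg : ∀ w ∈ Vᗮ, 0 ≤ inner ℝ (B w) w) : V' ≤ V := by
  have hsym : B.toLinearMap.IsSymmetric := hB.isSymmetric
  refine le_of_forall_eigenvector_mem hB hinv' fun μ v hv hμ => ?_
  by_cases hv0 : v = 0
  · rw [hv0]; exact V.zero_mem
  have hμ0 : μ < 0 := by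
    have h1 := hneg' v hv hv0
    rw [hμ, real_inner_smul_left, real_inner_self_eq_norm_sq] at h1
    have : 0 < ‖v‖ ^ 2 := by positivity
    nlinarith
  set a := V.starProjection v
  set b := Vᗮ.starProjection v
  have hab : v = a + b := (V.starProjection_add_starProjection_orthogonal v).symm
  have ha : a ∈ V := V.starProjection_apply_mem v
  have hb : b ∈ Vᗮ := Vᗮ.starProjection_apply_mem v
  have hbb : B b = μ • b := by
    have h1 : B b - μ • b = μ • a - B a := by
      have h2 : B a + B b = μ • a + μ • b := by rw [← map_add, ← smul_add, ← hab, hμ]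
      rw [sub_eq_sub_iff_add_eq_add, add_comm, h2]
    have h3 : B b - μ • b ∈ V := h1 ▸ V.sub_mem (V.smul_mem _ ha) (hinv a ha)
    have h4 : B b - μ • b ∈ Vᗮ := by
      refine Vᗮ.sub_mem (fun y hy => ?_) (Vᗮ.smul_mem _ hb)
      have h5 : inner ℝ (B y) b = inner ℝ y (B b) := hsym y b
      rw [← h5]
      exact hb _ (hinv y hy)
    exact sub_eq_zero.mp (inner_self_eq_zero.mp (h4 _ h3))
  have hb0 : b = 0 := by
    by_contra hne
    have h1 := hnonneg b hb
    rw [hbb, real_inner_smul_left, real_inner_self_eq_norm_sq] at h1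
    have : 0 < ‖b‖ ^ 2 := by positivity
    nlinarith
  rw [hab, hb0, add_zero]
  exact ha

/-- If a self-adjoint operator is coercive on a subspace of finite codimension and its form takes
a negative value on a closed invariant subspace, then the latter contains an eigenvector for a
negative eigenvalue. -/
theorem exists_neg_eigenvector {B : H →L[ℝ] H} (hB : IsSelfAdjoint B)
    {N : Submodule ℝ H} [N.HasOrthogonalProjection] [FiniteDimensional ℝ Nᗮ] {c : ℝ} (hc : 0 < c)
    (hN : ∀ x ∈ N, c * ‖x‖ ^ 2 ≤ inner ℝ (B x) x) {W : Submodule ℝ H}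
    (hW : IsClosed (W : Set H)) (hinv : ∀ w ∈ W, B w ∈ W) {w : H} (hw : w ∈ W)
    (hneg : inner ℝ (B w) w < 0) :
    ∃ μ : ℝ, μ < 0 ∧ ∃ x ∈ W, x ≠ 0 ∧ B x = μ • x := by
  have hsym : ∀ x y, inner ℝ (B x) y = inner ℝ x (B y) := hB.isSymmetric
  have hw0 : 0 < ‖w‖ := by
    rw [norm_pos_iff]; rintro rfl; simp at hneg
  -- The values of the Rayleigh quotient on `W`; the infimum `m` turns out to be an eigenvalue.
  set Q : Set ℝ := {r | ∃ x ∈ W, ‖x‖ = 1 ∧ r = inner ℝ (B x) x}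
  have hbd : BddBelow Q := by
    refine ⟨-‖B‖, ?_⟩
    rintro r ⟨x, -, hx, rfl⟩
    have h1 := abs_real_inner_le_norm (B x) x
    have h2 := B.le_opNorm x
    rw [hx, mul_one] at *
    linarith [neg_abs_le (inner ℝ (B x) x)]
  have hmem : ∀ x ∈ W, x ≠ 0 → inner ℝ (B x) x / ‖x‖ ^ 2 ∈ Q := by
    intro x hx hx0
    have hx0' : ‖x‖ ≠ 0 := norm_ne_zero_iff.mpr hx0
    refine ⟨‖x‖⁻¹ • x, W.smul_mem _ hx, ?_, ?_⟩
    · rw [norm_smul, norm_inv, norm_norm, inv_mul_cancel₀ hx0']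
    · rw [map_smul, real_inner_smul_left, real_inner_smul_right]
      field_simp
  set m := sInf Q
  have hm : m < 0 := (csInf_le hbd (hmem w hw (norm_pos_iff.mp hw0))).trans_lt
    (div_neg_of_neg_of_pos hneg (by positivity))
  have hle : ∀ x ∈ W, m * ‖x‖ ^ 2 ≤ inner ℝ (B x) x := by
    intro x hx
    by_cases hx0 : x = 0
    · simp [hx0]
    have := csInf_le hbd (hmem x hx hx0)
    rwa [le_div_iff₀ (by positivity)] at this
  by_contra! hcon
  -- `A` has a nonnegative form on `W` and stays coercive on `N` because `m < 0`. If `m` had no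
  -- eigenvector in `W`, `A` would be bounded below there.
  set A : H →L[ℝ] H := B - m • ContinuousLinearMap.id ℝ H
  have hAx : ∀ x, A x = B x - m • x := fun x => rfl
  have hAin : ∀ x, inner ℝ (A x) x = inner ℝ (B x) x - m * ‖x‖ ^ 2 := fun x => by
    rw [hAx, inner_sub_left, real_inner_smul_left, real_inner_self_eq_norm_sq]
  obtain ⟨δ, hδ, hbb⟩ := exists_bounded_below (A := A) (N := N) hc
    (fun x hx => by rw [hAin]; nlinarith [hN x hx, sq_nonneg ‖x‖]) hW
    (fun x hx h0 => by
      by_contra hne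
      exact hcon m hm x hx hne (sub_eq_zero.mp h0))
  set C := ‖A‖ + 1
  have hC : 0 < C := by positivity
  -- Nonnegativity of the form of `A` at `x - C⁻¹ A x` gives `⟨A x, x⟩ ≥ ‖A x‖² / C ≥ (δ² / C)
  -- ‖x‖²`, so the Rayleigh quotient stays above `m + δ² / C`, contrary to the choice of `m`.
  have hgain : ∀ x ∈ W, (m + δ ^ 2 / C) * ‖x‖ ^ 2 ≤ inner ℝ (B x) x := by
    intro x hx
    have hy : A x ∈ W := W.sub_mem (hinv x hx) (W.smul_mem _ hx)
    have h1 := hle (x - C⁻¹ • A x) (W.sub_mem hx (W.smul_mem _ hy))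
    have h2 : 0 ≤ inner ℝ (A (x - C⁻¹ • A x)) (x - C⁻¹ • A x) := by rw [hAin]; linarith
    have h3 : inner ℝ (A (A x)) x = ‖A x‖ ^ 2 := by
      rw [← real_inner_self_eq_norm_sq, hAx (A x), hAx x]
      simp only [map_sub, map_smul, inner_sub_left, inner_sub_right, real_inner_smul_left,
        real_inner_smul_right, hsym (B x)]
      rw [hsym x x]
      ring
    have h4 : inner ℝ (A (A x)) (A x) ≤ C * ‖A x‖ ^ 2 := by
      refine (real_inner_le_norm _ _).trans ?_
      have := A.le_opNorm (A x)
      nlinarith [norm_nonneg (A x), sq_nonneg ‖A x‖]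
    have h5 : 0 ≤ inner ℝ (A x) x - ‖A x‖ ^ 2 / C := by
      have e : inner ℝ (A (x - C⁻¹ • A x)) (x - C⁻¹ • A x) =
          inner ℝ (A x) x - 2 * (C⁻¹ * ‖A x‖ ^ 2) + C⁻¹ ^ 2 * inner ℝ (A (A x)) (A x) := by
        simp only [map_sub, map_smul, inner_sub_left, inner_sub_right, real_inner_smul_left,
          real_inner_smul_right, h3, real_inner_self_eq_norm_sq]
        ring
      have e2 : C⁻¹ ^ 2 * inner ℝ (A (A x)) (A x) ≤ C⁻¹ * ‖A x‖ ^ 2 := by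
        calc C⁻¹ ^ 2 * inner ℝ (A (A x)) (A x) ≤ C⁻¹ ^ 2 * (C * ‖A x‖ ^ 2) := by gcongr
          _ = C⁻¹ * ‖A x‖ ^ 2 := by field_simp
      rw [e] at h2
      rw [div_eq_inv_mul]
      linarith
    have h6 : δ ^ 2 / C * ‖x‖ ^ 2 ≤ ‖A x‖ ^ 2 / C := by
      rw [div_mul_eq_mul_div, ← mul_pow]
      gcongr
      exact hbb x hx
    rw [hAin] at h5
    linarith
  have hcontra : m + δ ^ 2 / C ≤ m := by
    refine le_csInf ⟨_, hmem w hw (norm_pos_iff.mp hw0)⟩ ?_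
    rintro r ⟨x, hx, hx1, rfl⟩
    simpa [hx1] using hgain x hx
  have : 0 < δ ^ 2 / C := by positivity
  linarith

/-- Take an invariant negative subspace of maximal dimension; `finrank Nᗮ` bounds these dimensions
since the form is nonnegative on `N`. A negative value on `Vᗮ` would produce an eigenvector there by
which `V` could be enlarged. -/
theorem exists_isNegativeSpace {B : H →L[ℝ] H} (hB : IsSelfAdjoint B)
    {N : Submodule ℝ H} [N.HasOrthogonalProjection] [FiniteDimensional ℝ Nᗮ] {c : ℝ} (hc : 0 < c)
    (hN : ∀ x ∈ N, c * ‖x‖ ^ 2 ≤ inner ℝ (B x) x) :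
    ∃ V : Submodule ℝ H, IsNegativeSpace B V ∧
      (∀ V' : Submodule ℝ H, IsNegativeSpace B V' → V' = V) ∧ FiniteDimensional ℝ V ∧
      ∀ S : Submodule ℝ H, (∀ v ∈ S, v ≠ 0 → inner ℝ (B v) v < 0) →
        FiniteDimensional ℝ S ∧ Module.finrank ℝ S ≤ Module.finrank ℝ V := by
  have hsym : ∀ x y, inner ℝ (B x) y = inner ℝ x (B y) := hB.isSymmetric
  have hNneg : ∀ w ∈ Nᗮᗮ, 0 ≤ inner ℝ (B w) w := fun w hw => by
    rw [Submodule.orthogonal_orthogonal] at hw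
    exact le_trans (by positivity) (hN w hw)
  set D : Set ℕ := {d | ∃ V : Submodule ℝ H, FiniteDimensional ℝ V ∧ (∀ v ∈ V, B v ∈ V) ∧
    (∀ v ∈ V, v ≠ 0 → inner ℝ (B v) v < 0) ∧ Module.finrank ℝ V = d} with hD
  have hDne : D.Nonempty := ⟨0, ⊥, inferInstance, by simp, by simp, by simp⟩
  have hDbd : BddAbove D := by
    refine ⟨Module.finrank ℝ Nᗮ, ?_⟩
    rintro d ⟨V, -, -, hneg, rfl⟩
    exact (finrank_le_of_neg_of_nonneg hNneg hneg).2
  obtain ⟨V, hfd, hinv, hneg, hdim⟩ := Nat.sSup_mem hDne hDbd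
  have hinvo : ∀ w ∈ Vᗮ, B w ∈ Vᗮ := fun w hw y hy => by
    rw [← hsym]; exact hw _ (hinv y hy)
  have hnonneg : ∀ w ∈ Vᗮ, 0 ≤ inner ℝ (B w) w := by
    intro w hw
    by_contra! hlt
    obtain ⟨μ, hμ, x, hx, hx0, hBx⟩ :=
      exists_neg_eigenvector hB hc hN V.isClosed_orthogonal hinvo hw hlt
    have hmem : Module.finrank ℝ (V ⊔ ℝ ∙ x : Submodule ℝ H) ∈ D := by
      refine ⟨V ⊔ ℝ ∙ x, inferInstance, fun y hy => ?_, fun y hy hy0 => ?_, rfl⟩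
      · obtain ⟨v, hv, z, hz, rfl⟩ := Submodule.mem_sup.mp hy
        obtain ⟨s, rfl⟩ := Submodule.mem_span_singleton.mp hz
        rw [map_add, map_smul, hBx, smul_smul]
        exact Submodule.add_mem_sup (hinv v hv)
          (Submodule.smul_mem _ _ (Submodule.mem_span_singleton_self x))
      · obtain ⟨v, hv, z, hz, rfl⟩ := Submodule.mem_sup.mp hy
        obtain ⟨s, rfl⟩ := Submodule.mem_span_singleton.mp hz
        have e : inner ℝ (B (v + s • x)) (v + s • x) = inner ℝ (B v) v + s ^ 2 * μ * ‖x‖ ^ 2 := by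
          have o1 : inner ℝ (B v) x = (0 : ℝ) := hx _ (hinv v hv)
          have o2 : inner ℝ x v = (0 : ℝ) := by rw [real_inner_comm]; exact hx v hv
          simp only [map_add, map_smul, hBx, inner_add_left, inner_add_right,
            real_inner_smul_left, real_inner_smul_right, o1, o2, real_inner_self_eq_norm_sq]
          ring
        rw [e]
        have hx2 : 0 < ‖x‖ ^ 2 := by positivity
        by_cases hv0 : v = 0
        · have hs : s ≠ 0 := by rintro rfl; simp [hv0] at hy0
          have : 0 < s ^ 2 := by positivity
          simp only [hv0, map_zero, inner_zero_left, zero_add]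
          exact mul_neg_of_neg_of_pos (mul_neg_of_pos_of_neg this hμ) hx2
        · have h1 := hneg v hv hv0
          nlinarith [mul_nonneg (mul_nonneg (sq_nonneg s) (neg_nonneg.mpr hμ.le)) hx2.le]
    have hlt' : V < V ⊔ ℝ ∙ x := by
      refine lt_of_le_of_ne le_sup_left fun h => hx0 ?_
      have hxV : x ∈ V := by
        rw [h]; exact Submodule.mem_sup_right (Submodule.mem_span_singleton_self x)
      exact inner_self_eq_zero.mp (hx x hxV)
    have h1 := Submodule.finrank_lt_finrank_of_lt hlt'
    have h2 := le_csSup hDbd hmem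
    omega
  refine ⟨V, ⟨V.closed_of_finiteDimensional, hinv, hneg, hnonneg⟩, fun V' hV' => ?_, hfd,
    fun S hS => finrank_le_of_neg_of_nonneg hnonneg hS⟩
  have hfd' := (finrank_le_of_neg_of_nonneg hnonneg hV'.neg).1
  exact le_antisymm (le_of_neg_of_nonneg hB hV'.invariant hV'.neg hinv hnonneg)
    (le_of_neg_of_nonneg hB hinv hneg hV'.invariant hV'.nonneg)

end Abstract

/-! ### The du Bois-Reymond lemma on the circle -/

/-- A smooth function with compact support in `(0, T)` extends to a smooth periodic function. -/
theorem exists_periodic_extension {T : ℝ} (hT : 0 < T) {f : ℝ → ℝ} (hf : ContDiff ℝ ∞ f)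
    (hsupp : tsupport f ⊆ Ioo 0 T) :
    ∃ g : ℝ → ℝ, ContDiff ℝ ∞ g ∧ Periodic g T ∧ ∀ t ∈ Ioc 0 T, g t = f t := by
  have hzero : ∀ t, t ∉ Ioo 0 T → f t = 0 := fun t ht => by
    by_contra hne
    exact ht (hsupp (subset_tsupport f hne))
  -- The sum of all translates is locally finite, because `f` vanishes off `(0, T)`; for `t` in `(0,
  -- T]` only the term `k = 0` can be nonzero.
  refine ⟨fun t => ∑ᶠ k : ℤ, f (t + k * T), ?_, ?_, ?_⟩
  · rw [← contMDiff_iff_contDiff]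
    refine contMDiff_finsum (fun k => ?_) ?_
    · rw [contMDiff_iff_contDiff]
      exact hf.comp (contDiff_id.add contDiff_const)
    · intro t₀
      refine ⟨Metric.ball t₀ 1, Metric.ball_mem_nhds _ one_pos,
        (Set.finite_Icc ⌊(-t₀ - 1) / T⌋ ⌈(T - t₀ + 1) / T⌉).subset ?_⟩
      rintro k ⟨x, hx, hx1⟩
      have h1 : x + k * T ∈ Ioo 0 T := by
        by_contra hne
        exact hx (hzero _ hne)
      rw [Metric.mem_ball, Real.dist_eq, abs_lt] at hx1
      constructor
      · have : ((-t₀ - 1) / T) ≤ k := by rw [div_le_iff₀ hT]; linarith [h1.1]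
        exact Int.floor_le_iff.mpr (by linarith)
      · have : (k : ℝ) ≤ (T - t₀ + 1) / T := by rw [le_div_iff₀ hT]; linarith [h1.2]
        exact_mod_cast this.trans (Int.le_ceil _)
  · intro t
    refine finsum_eq_of_bijective (fun k : ℤ => k + 1) (Equiv.addRight (1 : ℤ)).bijective
      fun k => ?_
    congr 1
    push_cast
    ring
  · intro t ht
    beta_reduce
    rw [finsum_eq_single _ (0 : ℤ) fun k hk => hzero _ fun hmem => hk ?_]
    · simp
    · have h1 : (k : ℝ) * T < 1 * T := by linarith [hmem.2, ht.1]
      have h2 : (-1 : ℝ) * T < k * T := by linarith [hmem.1, ht.2]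
      have h3 : (k : ℝ) < 1 := lt_of_mul_lt_mul_right h1 hT.le
      have h4 : (-1 : ℝ) < k := lt_of_mul_lt_mul_right h2 hT.le
      have h5 : k < 1 := by exact_mod_cast h3
      have h6 : -1 < k := by exact_mod_cast h4
      omega

theorem exists_periodic_primitive {T : ℝ} {θ : ℝ → ℝ} (hθ : ContDiff ℝ ∞ θ)
    (hper : Periodic θ T) (hmean : ∫ t in (0 : ℝ)..T, θ t = 0) :
    ∃ ψ : ℝ → ℝ, ContDiff ℝ ∞ ψ ∧ Periodic ψ T ∧ deriv ψ = θ := by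
  have hd : ∀ t, HasDerivAt (fun t => ∫ s in (0 : ℝ)..t, θ s) (θ t) t := fun t =>
    hθ.continuous.integral_hasStrictDerivAt 0 t |>.hasDerivAt
  have hderiv : deriv (fun t => ∫ s in (0 : ℝ)..t, θ s) = θ := funext fun t => (hd t).deriv
  refine ⟨fun t => ∫ s in (0 : ℝ)..t, θ s, ?_, fun t => ?_, hderiv⟩
  · rw [contDiff_infty_iff_deriv, hderiv]
    exact ⟨fun t => (hd t).differentiableAt, hθ⟩
  · have h1 := intervalIntegral.integral_add_adjacent_intervals (a := 0) (b := t) (c := t + T)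
      (hθ.continuous.intervalIntegrable (μ := volume) _ _)
      (hθ.continuous.intervalIntegrable _ _)
    have h2 := hper.intervalIntegral_add_eq t 0
    rw [zero_add, hmean] at h2
    beta_reduce
    rw [← h1, h2, add_zero]

/-- Fix a bump `χ` of integral one and put `c = ∫ χ g`. For a test function `θ₀` of integral `I`,
the function `θ₀ - I χ` has mean zero, so its periodic extension is `ψ'` for some smooth periodic
`ψ`. The hypothesis becomes `∫ θ₀ g = I c = ∫ θ₀ c`, whence `g = c` almost everywhere. -/
theorem ae_eq_const_of_integral_deriv_smul_eq_zero {E : Type*} [NormedAddCommGroup E]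
    [NormedSpace ℝ E] [CompleteSpace E] {T : ℝ} (hT : 0 < T) {g : ℝ → E}
    (hg : IntegrableOn g (Ioc 0 T))
    (h : ∀ ψ : ℝ → ℝ, ContDiff ℝ ∞ ψ → Periodic ψ T → ∫ t in Ioc 0 T, deriv ψ t • g t = 0) :
    ∃ c : E, g =ᵐ[perMeas T] fun _ => c := by
  let χ₀ : ContDiffBump (T / 2) := ⟨T / 8, T / 4, by positivity, by linarith⟩
  let χ : ℝ → ℝ := χ₀.normed volume
  have hχ : ContDiff ℝ ∞ χ := χ₀.contDiff_normed
  have hχs : tsupport χ ⊆ Ioo 0 T := by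
    rw [χ₀.tsupport_normed_eq]
    intro t ht
    rw [Metric.mem_closedBall, Real.dist_eq, abs_le] at ht
    have : χ₀.rOut = T / 4 := rfl
    constructor <;> linarith [ht.1, ht.2]
  have hχi : ∫ t in Ioc 0 T, χ t = 1 := by
    rw [setIntegral_eq_integral_of_forall_compl_eq_zero, χ₀.integral_normed]
    intro t ht
    by_contra hne
    exact ht (Ioo_subset_Ioc_self (hχs (subset_tsupport χ hne)))
  have hsm : ∀ {f : ℝ → ℝ}, Continuous f → IntegrableOn (fun t => f t • g t) (Ioc 0 T) :=
    fun {f} hf => by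
      obtain ⟨C, hC⟩ := (isCompact_Icc (a := (0 : ℝ)) (b := T)).exists_bound_of_continuousOn
        hf.continuousOn
      refine Integrable.bdd_smul hg C hf.aestronglyMeasurable ?_
      filter_upwards [ae_restrict_mem measurableSet_Ioc] with t ht
      exact hC t (Ioc_subset_Icc_self ht)
  set c := ∫ t in Ioc 0 T, χ t • g t with hc
  refine ⟨c, ?_⟩
  have hgc : IntegrableOn (fun t => g t - c) (Ioc 0 T) := hg.sub (integrable_const c)
  have key := isOpen_Ioo.ae_eq_zero_of_integral_contDiff_smul_eq_zero (U := Ioo 0 T)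
    (f := fun t => g t - c) (μ := volume)
    ((hgc.mono_set Ioo_subset_Ioc_self).locallyIntegrableOn) (fun θ₀ hθ₀ _ hs => by
      set I := ∫ t in Ioc 0 T, θ₀ t with hI
      have hθs : tsupport (fun t => θ₀ t - I * χ t) ⊆ Ioo 0 T := by
        refine (tsupport_sub _ _).trans (union_subset hs ?_)
        exact (tsupport_mul_subset_right (f := fun _ => I) (g := χ)).trans hχs
      have hθd : ContDiff ℝ ∞ fun t => θ₀ t - I * χ t := hθ₀.sub (contDiff_const.mul hχ)
      obtain ⟨θ, hθ, hθp, hθe⟩ := exists_periodic_extension hT hθd hθs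
      have hmean : ∫ t in (0 : ℝ)..T, θ t = 0 := by
        rw [intervalIntegral.integral_of_le hT.le, setIntegral_congr_fun measurableSet_Ioc hθe,
          integral_sub hθ₀.continuous.integrableOn_Ioc
          (hχ.continuous.integrableOn_Ioc.const_mul I), integral_const_mul, hχi]
        simp [hI]
      obtain ⟨ψ, hψ, hψp, hψd⟩ := exists_periodic_primitive hθ hθp hmean
      have h1 := h ψ hψ hψp
      rw [hψd, setIntegral_congr_fun (g := fun t => θ₀ t • g t - I • (χ t • g t)) measurableSet_Ioc
        (fun t ht => by simp only [hθe t ht, sub_smul, mul_smul]),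
        integral_sub (hsm hθ₀.continuous) ((hsm hχ.continuous).fun_smul I), integral_smul, ← hc] at h1
      rw [← setIntegral_eq_integral_of_forall_compl_eq_zero (s := Ioc 0 T)]
      · simp only [smul_sub]
        rw [integral_sub (hsm hθ₀.continuous) (hθ₀.continuous.integrableOn_Ioc.smul_const c),
          integral_smul_const, ← hI, h1]
      · intro t ht
        have : θ₀ t = 0 := by
          by_contra hne
          exact ht (Ioo_subset_Ioc_self (hs (subset_tsupport θ₀ hne)))
        rw [this, zero_smul])
  have hae : perMeas T = volume.restrict (Ioo 0 T) := restrict_Ioo_eq_restrict_Ioc.symm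
  rw [hae]
  filter_upwards [ae_restrict_of_ae key, ae_restrict_mem measurableSet_Ioo] with t ht ht'
  exact sub_eq_zero.mp (ht ht')

/-! ### Continuous representatives -/

theorem L2.integrable {T : ℝ} {n : ℕ} (u : L2 T n) : Integrable u (perMeas T) :=
  (Lp.memLp u).integrable one_le_two

theorem integrable_continuous_smul {T : ℝ} {n : ℕ} {f : ℝ → ℝ} (hf : Continuous f) {u : ℝ → Eu n}
    (hu : Integrable u (perMeas T)) : Integrable (fun t => f t • u t) (perMeas T) := by
  obtain ⟨C, hC⟩ := (isCompact_Icc (a := (0 : ℝ)) (b := T)).exists_bound_of_continuousOn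
    hf.continuousOn
  refine Integrable.bdd_smul hu C hf.aestronglyMeasurable ?_
  filter_upwards [ae_restrict_mem measurableSet_Ioc] with t ht
  exact hC t (Ioc_subset_Icc_self ht)

theorem IsWeakDeriv.integral_deriv_smul {T : ℝ} {n : ℕ} {u w : L2 T n} (h : IsWeakDeriv u w)
    {ψ : ℝ → ℝ} (hψ : ContDiff ℝ ∞ ψ) (hper : Periodic ψ T) :
    ∫ t, deriv ψ t • u t ∂(perMeas T) = -∫ t, ψ t • w t ∂(perMeas T) := by
  refine ext_inner_left ℝ fun e => ?_
  rw [inner_neg_right, ← integral_inner (integrable_continuous_smul (hψ.continuous_deriv (by simp))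
    u.integrable), ← integral_inner (integrable_continuous_smul hψ.continuous w.integrable)]
  have h1 := h (fun t => ψ t • e) (hψ.smul contDiff_const) (fun t => by simp [hper t])
  have h2 : ∀ t, deriv (fun t => ψ t • e) t = deriv ψ t • e := fun t =>
    ((hψ.differentiable (by simp) t).hasDerivAt.smul_const e).deriv
  simp only [h2, real_inner_smul_right] at h1 ⊢
  simpa only [real_inner_comm] using h1

theorem IsWeakDeriv.integral_eq_zero {T : ℝ} {n : ℕ} {u w : L2 T n} (h : IsWeakDeriv u w) :
    ∫ t, w t ∂(perMeas T) = 0 := by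
  have h1 := h.integral_deriv_smul (ψ := fun _ => 1) contDiff_const (fun _ => rfl)
  simpa using h1.symm

/-- After pairing with a fixed vector this is integration by parts for absolutely continuous
functions. The boundary terms vanish: the primitive is zero at `0` by definition and at `T` by the
mean condition. -/
theorem integral_deriv_smul_primitive {T : ℝ} (hT : 0 < T) {n : ℕ} {w : ℝ → Eu n}
    (hw : Integrable w (perMeas T)) (h0 : ∫ t, w t ∂(perMeas T) = 0) {ψ : ℝ → ℝ}
    (hψ : ContDiff ℝ ∞ ψ) :
    ∫ t, deriv ψ t • (∫ s in (0 : ℝ)..t, w s) ∂(perMeas T) = -∫ t, ψ t • w t ∂(perMeas T) := by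
  have hwi : IntervalIntegrable w volume 0 T :=
    (intervalIntegrable_iff_integrableOn_Ioc_of_le hT.le).mpr hw
  have hUc : ContinuousOn (fun t => ∫ s in (0 : ℝ)..t, w s) (Icc 0 T) := by
    have := intervalIntegral.continuousOn_primitive_interval' hwi left_mem_uIcc
    rwa [uIcc_of_le hT.le] at this
  have hUi : Integrable (fun t => ∫ s in (0 : ℝ)..t, w s) (perMeas T) :=
    (hUc.integrableOn_Icc).mono_set Ioc_subset_Icc_self
  refine ext_inner_left ℝ fun e => ?_
  rw [inner_neg_right, ← integral_inner (integrable_continuous_smul (hψ.continuous_deriv (by simp))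
    hUi), ← integral_inner (integrable_continuous_smul hψ.continuous hw)]
  set f : ℝ → ℝ := fun t => inner ℝ e (w t) with hf
  have hfi : IntervalIntegrable f volume 0 T :=
    (intervalIntegrable_iff_integrableOn_Ioc_of_le hT.le).mpr (hw.const_inner e)
  have hprim : ∀ t ∈ Ioc 0 T, inner ℝ e (∫ s in (0 : ℝ)..t, w s) = ∫ s in (0 : ℝ)..t, f s := by
    intro t ht
    rw [intervalIntegral.integral_of_le ht.1.le, intervalIntegral.integral_of_le ht.1.le]
    exact (integral_inner (IntegrableOn.mono_set hw (Ioc_subset_Ioc_right ht.2)) e).symm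
  have hac := hfi.absolutelyContinuousOnInterval_intervalIntegral (c := 0) left_mem_uIcc
  have hacψ : AbsolutelyContinuousOnInterval ψ 0 T :=
    (hψ.of_le (by simp) : ContDiff ℝ 1 ψ).contDiffOn.absolutelyContinuousOnInterval
  have hT0 : ∫ s in (0 : ℝ)..T, f s = 0 := by
    rw [← hprim T ⟨hT, le_rfl⟩, intervalIntegral.integral_of_le hT.le, h0, inner_zero_right]
  have key := hac.integral_mul_deriv_eq_deriv_mul hacψ
  rw [hT0, intervalIntegral.integral_same, zero_mul, zero_mul, sub_zero, zero_sub,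
    intervalIntegral.integral_of_le hT.le, intervalIntegral.integral_of_le hT.le] at key
  calc ∫ t in Ioc 0 T, inner ℝ e (deriv ψ t • ∫ s in (0 : ℝ)..t, w s)
      = ∫ t in Ioc 0 T, (∫ s in (0 : ℝ)..t, f s) * deriv ψ t := by
        refine setIntegral_congr_fun measurableSet_Ioc fun t ht => ?_
        simp only [real_inner_smul_right, hprim t ht]
        ring
    _ = _ := key
    _ = -∫ t in Ioc 0 T, inner ℝ e (ψ t • w t) := by
        congr 1
        refine integral_congr_ae ?_
        filter_upwards [ae_restrict_of_ae hfi.ae_hasDerivAt_integral,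
          ae_restrict_mem measurableSet_Ioc] with t ht ht'
        have htu : t ∈ uIcc 0 T := by
          rw [uIcc_of_le hT.le]; exact Ioc_subset_Icc_self ht'
        rw [(ht htu 0 left_mem_uIcc).deriv, real_inner_smul_right, mul_comm]

/-- The difference of `u` and the primitive of `w` annihilates every `ψ'`, so it is constant by du
Bois-Reymond. The mean of `w` vanishes, as the test function `1` shows. -/
theorem IsWeakDeriv.exists_ae_eq_primitive {T : ℝ} (hT : 0 < T) {n : ℕ} {u w : L2 T n}
    (h : IsWeakDeriv u w) :
    ∃ c : Eu n, u =ᵐ[perMeas T] fun t => c + ∫ s in (0 : ℝ)..t, w s := by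
  have hwi : IntervalIntegrable w volume 0 T :=
    (intervalIntegrable_iff_integrableOn_Ioc_of_le hT.le).mpr w.integrable
  have hUc : ContinuousOn (fun t => ∫ s in (0 : ℝ)..t, w s) (Icc 0 T) := by
    have := intervalIntegral.continuousOn_primitive_interval' hwi left_mem_uIcc
    rwa [uIcc_of_le hT.le] at this
  have hUi : Integrable (fun t => ∫ s in (0 : ℝ)..t, w s) (perMeas T) :=
    (hUc.integrableOn_Icc).mono_set Ioc_subset_Icc_self
  obtain ⟨c, hc⟩ := ae_eq_const_of_integral_deriv_smul_eq_zero hT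
    (g := fun t => u t - ∫ s in (0 : ℝ)..t, w s) (u.integrable.sub hUi) (fun ψ hψ hper => by
      have hd := hψ.continuous_deriv (n := ∞) (by simp)
      simp only [smul_sub]
      rw [integral_sub (integrable_continuous_smul hd u.integrable)
        (integrable_continuous_smul hd hUi), h.integral_deriv_smul hψ hper,
        integral_deriv_smul_primitive hT w.integrable h.integral_eq_zero hψ, sub_self])
  refine ⟨c, ?_⟩
  filter_upwards [hc] with t ht
  rw [← ht]
  abel

theorem IsWeakDeriv.exists_continuous_periodic {T : ℝ} (hT : 0 < T) {n : ℕ} {u w : L2 T n}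
    (h : IsWeakDeriv u w) :
    ∃ U : ℝ → Eu n, Continuous U ∧ Periodic U T ∧ u =ᵐ[perMeas T] U := by
  obtain ⟨c, hc⟩ := h.exists_ae_eq_primitive hT
  -- The periodic extension of `w` from `(0, T]`; its primitive is periodic because `w` has mean
  -- zero.
  set W : ℝ → Eu n := fun t => w (toIocMod hT 0 t)
  have hWp : Periodic W T := fun t => by simp [W]
  have hWe : ∀ t ∈ Ioc 0 T, W t = w t := fun t ht => by
    have : toIocMod hT 0 t = t := (toIocMod_eq_self hT).mpr (by simpa using ht)
    simp only [W, this]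
  have hwi : IntervalIntegrable W volume 0 (0 + T) := by
    rw [zero_add, intervalIntegrable_iff_integrableOn_Ioc_of_le hT.le]
    exact IntegrableOn.congr_fun w.integrable (fun t ht => (hWe t ht).symm) measurableSet_Ioc
  have hWi : ∀ a b, IntervalIntegrable W volume a b := fun a b =>
    hWp.intervalIntegrable hT.ne' hwi a b
  refine ⟨fun t => c + ∫ s in (0 : ℝ)..t, W s,
    continuous_const.add (intervalIntegral.continuous_primitive hWi 0), fun t => ?_, ?_⟩
  · have h1 := intervalIntegral.integral_add_adjacent_intervals (hWi 0 t) (hWi t (t + T))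
    have h2 := hWp.intervalIntegral_add_eq t 0
    rw [zero_add, intervalIntegral.integral_of_le hT.le,
      setIntegral_congr_fun measurableSet_Ioc hWe, h.integral_eq_zero] at h2
    beta_reduce
    rw [← h1, h2, add_zero]
  · filter_upwards [hc, ae_restrict_mem measurableSet_Ioc] with t ht ht'
    rw [ht, intervalIntegral.integral_of_le ht'.1.le, intervalIntegral.integral_of_le ht'.1.le]
    congr 1
    refine setIntegral_congr_fun measurableSet_Ioc fun s hs => (hWe s ⟨hs.1, hs.2.trans ht'.2⟩).symm

/-! ### Elements of `C¹(S_T, ℝⁿ)` -/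

theorem exists_norm_le_of_periodic {E : Type*} [NormedAddCommGroup E] {T : ℝ} (hT : 0 < T)
    {f : ℝ → E} (hf : Continuous f) (hper : Periodic f T) : ∃ C, ∀ t, ‖f t‖ ≤ C := by
  obtain ⟨C, hC⟩ := (isCompact_Icc (a := (0 : ℝ)) (b := T)).exists_bound_of_continuousOn
    hf.continuousOn
  refine ⟨C, fun t => ?_⟩
  obtain ⟨s, hs, hst⟩ := hper.exists_mem_Ico₀ hT t
  rw [hst]
  exact hC s (Ico_subset_Icc_self hs)

theorem exists_C1 {T : ℝ} (hT : 0 < T) {n : ℕ} {f g : ℝ → Eu n} (hper : Periodic f T)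
    (hd : ∀ t, HasDerivAt f (g t) t) (hg : Continuous g) :
    ∃ p : C1 T n, (∀ t, p.1.1 t = f t) ∧ ∀ t, p.1.2 t = g t := by
  have hf : Continuous f := continuous_iff_continuousAt.mpr fun t => (hd t).continuousAt
  have hgp : Periodic g T := fun t => by
    have h1 : HasDerivAt (fun s => f (s + T)) (g (t + T)) t := by
      simpa using (hd (t + T)).comp_add_const t T
    exact h1.unique (by simpa only [hper _] using hd t)
  obtain ⟨C, hC⟩ := exists_norm_le_of_periodic hT hf hper
  obtain ⟨C', hC'⟩ := exists_norm_le_of_periodic hT hg hgp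
  exact ⟨⟨(BoundedContinuousFunction.ofNormedAddCommGroup f hf C hC,
    BoundedContinuousFunction.ofNormedAddCommGroup g hg C' hC'), hper, hd⟩,
    fun _ => rfl, fun _ => rfl⟩

/-- An element of `W^{1,2}` whose weak derivative is continuous is of class `C¹`. -/
theorem mem_range_incl_of_ae_eq {T : ℝ} (hT : 0 < T) {n : ℕ} (ξ : W12 T n) {W : ℝ → Eu n}
    (hW : Continuous W) (hper : Periodic W T) (hξ : ξ.1.snd =ᵐ[perMeas T] W) :
    ξ ∈ LinearMap.range (incl T n) := by
  have hweak : IsWeakDeriv ξ.1.fst ξ.1.snd := ξ.2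
  obtain ⟨c, hc⟩ := hweak.exists_ae_eq_primitive hT
  have hW0 : ∫ t in (0 : ℝ)..T, W t = 0 := by
    rw [intervalIntegral.integral_of_le hT.le, ← integral_congr_ae hξ]
    exact hweak.integral_eq_zero
  obtain ⟨p, hp1, hp2⟩ := exists_C1 hT (f := fun t => c + ∫ s in (0 : ℝ)..t, W s) (g := W)
    (fun t => by
      have h1 := intervalIntegral.integral_add_adjacent_intervals (a := 0) (b := t) (c := t + T)
        (hW.intervalIntegrable (μ := volume) _ _) (hW.intervalIntegrable _ _)
      have h2 := hper.intervalIntegral_add_eq t 0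
      rw [zero_add, hW0] at h2
      beta_reduce
      rw [← h1, h2, add_zero])
    (fun t => (hW.integral_hasStrictDerivAt 0 t).hasDerivAt.const_add c) hW
  refine ⟨p, Subtype.ext ?_⟩
  have e1 : (memLp_of_continuous (T := T) p.1.1.continuous).toLp = ξ.1.fst := by
    refine Lp.ext ?_
    filter_upwards [(memLp_of_continuous (T := T) p.1.1.continuous).coeFn_toLp, hc,
      ae_restrict_mem measurableSet_Ioc] with t h1 h2 h3
    rw [h1, h2, hp1, intervalIntegral.integral_of_le h3.1.le,
      intervalIntegral.integral_of_le h3.1.le]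
    congr 1
    exact (integral_congr_ae (ae_restrict_of_ae_restrict_of_subset
      (Ioc_subset_Ioc_right h3.2) hξ)).symm
  have e2 : (memLp_of_continuous (T := T) p.1.2.continuous).toLp = ξ.1.snd := by
    refine Lp.ext ?_
    filter_upwards [(memLp_of_continuous (T := T) p.1.2.continuous).coeFn_toLp, hξ] with t h1 h2
    rw [h1, h2, hp2]
  change WithLp.toLp 2 (_, _) = ξ.1
  rw [e1, e2]
  rfl

/-! ### Regularity of weak solutions and density of `C¹(S_T, ℝⁿ)` -/

section Regularity

variable {T : ℝ} {n : ℕ}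

/-- The function that underlies an element of `W^{1,2}(S_T, ℝⁿ)`. -/
def valL (T : ℝ) (n : ℕ) : W12 T n →L[ℝ] L2 T n :=
  (WithLp.fstL 2 ℝ (L2 T n) (L2 T n)).comp (W12 T n).subtypeL

/-- The weak derivative of an element of `W^{1,2}(S_T, ℝⁿ)`. -/
def derivL (T : ℝ) (n : ℕ) : W12 T n →L[ℝ] L2 T n :=
  (WithLp.sndL 2 ℝ (L2 T n) (L2 T n)).comp (W12 T n).subtypeL

theorem inner_W12 (ξ η : W12 T n) :
    inner ℝ ξ η = inner ℝ (valL T n ξ) (valL T n η) + inner ℝ (derivL T n ξ) (derivL T n η) :=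
  WithLp.prod_inner_apply ξ.1 η.1

theorem norm_sq_W12 (ξ : W12 T n) : ‖ξ‖ ^ 2 = ‖valL T n ξ‖ ^ 2 + ‖derivL T n ξ‖ ^ 2 := by
  simp only [← real_inner_self_eq_norm_sq, inner_W12]

theorem isWeakDeriv_W12 (ξ : W12 T n) : IsWeakDeriv (valL T n ξ) (derivL T n ξ) := ξ.2

theorem coeFn_valL_incl (p : C1 T n) : valL T n (incl T n p) =ᵐ[perMeas T] p.1.1 :=
  (memLp_of_continuous (T := T) p.1.1.continuous).coeFn_toLp

theorem coeFn_derivL_incl (p : C1 T n) : derivL T n (incl T n p) =ᵐ[perMeas T] p.1.2 :=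
  (memLp_of_continuous (T := T) p.1.2.continuous).coeFn_toLp

/-- Smooth periodic test functions are themselves `C¹` loops. This reads an identity tested against
`C¹` loops as a weak Euler-Lagrange equation. -/
theorem isWeakDeriv_of_inner_incl (hT : 0 < T) {f k : L2 T n}
    (h : ∀ η : C1 T n, inner ℝ f (derivL T n (incl T n η)) + inner ℝ k (valL T n (incl T n η)) = 0) :
    IsWeakDeriv f k := by
  rw [isWeakDeriv_iff]
  intro ψ hψ hper
  obtain ⟨p, hp1, hp2⟩ := exists_C1 hT hper
    (fun t => (hψ.differentiable (by simp) t).hasDerivAt) (hψ.continuous_deriv (by simp))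
  have e1 : valL T n (incl T n p) = (memLp_of_continuous (T := T) hψ.continuous).toLp := by
    refine Lp.ext ?_
    filter_upwards [coeFn_valL_incl p,
      (memLp_of_continuous (T := T) hψ.continuous).coeFn_toLp] with t h1 h2
    rw [h1, h2, hp1]
  have e2 : derivL T n (incl T n p) =
      (memLp_of_continuous (T := T) (hψ.continuous_deriv (n := ∞) (by simp))).toLp := by
    refine Lp.ext ?_
    filter_upwards [coeFn_derivL_incl p,
      (memLp_of_continuous (T := T) (hψ.continuous_deriv (n := ∞) (by simp))).coeFn_toLp]
      with t h1 h2
    rw [h1, h2, hp2]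
  rw [← e1, ← e2]
  exact h p

/-- If `P ξ' + V` has a weak derivative in `L²`, where `P` is continuous with invertible values
and `V` is continuous, then `ξ` is of class `C¹`. -/
theorem mem_range_incl_of_isWeakDeriv (hT : 0 < T) {ξ : W12 T n} {f k : L2 T n}
    (h : IsWeakDeriv f k) {P : ℝ → Eu n →L[ℝ] Eu n} (hP : Continuous P) (hPp : Periodic P T)
    (hPu : ∀ t, IsUnit (P t)) {V : ℝ → Eu n} (hV : Continuous V) (hVp : Periodic V T)
    (hf : f =ᵐ[perMeas T] fun t => P t (derivL T n ξ t) + V t) :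
    ξ ∈ LinearMap.range (incl T n) := by
  obtain ⟨F, hF, hFp, hfF⟩ := h.exists_continuous_periodic hT
  have hinv : Continuous fun t => Ring.inverse (P t) := continuous_iff_continuousAt.mpr fun t => by
    obtain ⟨u, hu⟩ := hPu t
    have := NormedRing.inverse_continuousAt u
    rw [hu] at this
    exact ContinuousAt.comp (f := P) this hP.continuousAt
  -- With `F` the continuous representative of `f`, solving `F = P ξ' + V` for `ξ'` exhibits a
  -- continuous representative of `ξ'`.
  refine mem_range_incl_of_ae_eq hT ξ (W := fun t => Ring.inverse (P t) (F t - V t))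
    (hinv.clm_apply (hF.sub hV)) (fun t => by simp only [hPp t, hFp t, hVp t]) ?_
  filter_upwards [hf, hfF] with t h1 h2
  have h3 : F t - V t = P t (derivL T n ξ t) := by rw [← h2, h1, add_sub_cancel_right]
  have h4 : (Ring.inverse (P t) * P t) (derivL T n ξ t) = derivL T n ξ t := by
    rw [Ring.inverse_mul_cancel _ (hPu t)]; rfl
  rw [h3]
  exact h4.symm

/-- If `ξ` is orthogonal to all `C¹` loops, then `ξ'` has weak derivative `ξ`. The regularity lemma
makes `ξ` itself a `C¹` loop, so it is orthogonal to itself. -/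
theorem topologicalClosure_range_incl (hT : 0 < T) :
    (LinearMap.range (incl T n)).topologicalClosure = ⊤ := by
  rw [Submodule.topologicalClosure_eq_top_iff, eq_bot_iff]
  intro ξ hξ
  have hmem : ξ ∈ LinearMap.range (incl T n) := by
    refine mem_range_incl_of_isWeakDeriv hT (f := derivL T n ξ) (k := valL T n ξ)
      (isWeakDeriv_of_inner_incl hT fun η => ?_) (P := fun _ => 1) continuous_const
      (fun _ => rfl) (fun _ => isUnit_one) (V := fun _ => 0) continuous_const (fun _ => rfl)
      (Eventually.of_forall fun t => by simp)
    have h1 := hξ (incl T n η) ⟨η, rfl⟩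
    rw [real_inner_comm, inner_W12] at h1
    linarith
  exact inner_self_eq_zero.mp (hξ ξ hmem)

theorem denseRange_incl (hT : 0 < T) : DenseRange (incl T n) := by
  have h := topologicalClosure_range_incl (n := n) hT
  rw [← Submodule.dense_iff_topologicalClosure_eq_top] at h
  exact h

end Regularity

/-! ### Multiplication operators and the operator of a quadratic functional -/

section Multiplication

variable {T : ℝ} {n : ℕ}

theorem exists_bound_mul (T : ℝ) (M : C(ℝ, Eu n →L[ℝ] Eu n)) :
    ∃ C, 0 ≤ C ∧ ∀ᵐ t ∂(perMeas T), ‖M t‖ ≤ C := by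
  obtain ⟨C, hC⟩ := (isCompact_Icc (a := (0 : ℝ)) (b := T)).exists_bound_of_continuousOn
    M.continuous.continuousOn
  refine ⟨max C 0, le_max_right _ _, ?_⟩
  filter_upwards [ae_restrict_mem measurableSet_Ioc] with t ht
  exact (hC t (Ioc_subset_Icc_self ht)).trans (le_max_left _ _)

theorem memLp_mul (M : C(ℝ, Eu n →L[ℝ] Eu n)) (u : L2 T n) :
    MemLp (fun t => M t (u t)) 2 (perMeas T) := by
  obtain ⟨C, -, hC⟩ := exists_bound_mul T M
  refine (Lp.memLp u).of_le_mul (c := C) ?_ ?_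
  · exact isBoundedBilinearMap_apply.continuous.comp_aestronglyMeasurable
      (M.continuous.aestronglyMeasurable.prodMk (Lp.aestronglyMeasurable u))
  · filter_upwards [hC] with t ht
    exact (M t).le_of_opNorm_le ht _

/-- Multiplication by a continuous operator-valued function, as an operator on `L²`. -/
def mulOp (T : ℝ) (M : C(ℝ, Eu n →L[ℝ] Eu n)) : L2 T n →L[ℝ] L2 T n :=
  LinearMap.mkContinuousOfExistsBound
    { toFun := fun u => (memLp_mul M u).toLp
      map_add' := fun u v => by
        refine Lp.ext ?_
        filter_upwards [(memLp_mul M (u + v)).coeFn_toLp, (memLp_mul M u).coeFn_toLp,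
          (memLp_mul M v).coeFn_toLp, Lp.coeFn_add u v,
          Lp.coeFn_add ((memLp_mul M u).toLp) ((memLp_mul M v).toLp)] with t h1 h2 h3 h4 h5
        rw [h1, h5, Pi.add_apply, h2, h3, h4, Pi.add_apply, map_add]
      map_smul' := fun c u => by
        refine Lp.ext ?_
        filter_upwards [(memLp_mul M (c • u)).coeFn_toLp, (memLp_mul M u).coeFn_toLp,
          Lp.coeFn_smul c u, Lp.coeFn_smul c ((memLp_mul M u).toLp)] with t h1 h2 h3 h4
        rw [RingHom.id_apply, h1, h4, Pi.smul_apply, h2, h3, Pi.smul_apply, map_smul] }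
    (by
      obtain ⟨C, -, hC⟩ := exists_bound_mul T M
      refine ⟨C, fun u => Lp.norm_le_mul_norm_of_ae_le_mul ?_⟩
      filter_upwards [hC, (memLp_mul M u).coeFn_toLp] with t h1 h2
      change ‖((memLp_mul M u).toLp : L2 T n) t‖ ≤ _
      rw [h2]
      exact (M t).le_of_opNorm_le h1 _)

theorem coeFn_mulOp (M : C(ℝ, Eu n →L[ℝ] Eu n)) (u : L2 T n) :
    mulOp T M u =ᵐ[perMeas T] fun t => M t (u t) :=
  (memLp_mul M u).coeFn_toLp

theorem inner_mulOp (M : C(ℝ, Eu n →L[ℝ] Eu n)) (u v : L2 T n) :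
    inner ℝ (mulOp T M u) v = ∫ t, inner ℝ (M t (u t)) (v t) ∂(perMeas T) := by
  rw [L2.inner_def]
  refine integral_congr_ae ?_
  filter_upwards [coeFn_mulOp M u] with t ht
  rw [ht]

theorem inner_mulOp_comm {M M' : C(ℝ, Eu n →L[ℝ] Eu n)}
    (h : ∀ t v w, inner ℝ (M t v) w = inner ℝ v (M' t w)) (u v : L2 T n) :
    inner ℝ (mulOp T M u) v = inner ℝ u (mulOp T M' v) := by
  rw [real_inner_comm _ u, inner_mulOp, inner_mulOp]
  refine integral_congr_ae (Eventually.of_forall fun t => ?_)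
  simp only [h, real_inner_comm]

theorem norm_sq_L2 (u : L2 T n) : ‖u‖ ^ 2 = ∫ t, ‖u t‖ ^ 2 ∂(perMeas T) := by
  rw [← real_inner_self_eq_norm_sq, L2.inner_def]
  simp only [real_inner_self_eq_norm_sq]

theorem integrable_norm_sq (u : L2 T n) : Integrable (fun t => ‖u t‖ ^ 2) (perMeas T) :=
  (Lp.memLp u).integrable_norm_pow (by norm_num)

theorem mul_norm_sq_le_inner_mulOp {P : C(ℝ, Eu n →L[ℝ] Eu n)} {p : ℝ}
    (hp : ∀ t ∈ Icc 0 T, ∀ v, p * ‖v‖ ^ 2 ≤ inner ℝ (P t v) v) (u : L2 T n) :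
    p * ‖u‖ ^ 2 ≤ inner ℝ (mulOp T P u) u := by
  rw [inner_mulOp, norm_sq_L2, ← integral_const_mul]
  refine integral_mono_ae ((integrable_norm_sq u).const_mul p) ?_ ?_
  · refine (L2.integrable_inner (𝕜 := ℝ) (mulOp T P u) u).congr ?_
    filter_upwards [coeFn_mulOp P u] with t ht
    rw [ht]
  · filter_upwards [ae_restrict_mem measurableSet_Ioc] with t ht
    exact hp t (Ioc_subset_Icc_self ht) _

/-- The operator on `W^{1,2}` of the form
`∫₀ᵀ (P ξ' · η' + Q ξ · η' + Q' ξ' · η + R ξ · η) dt`. -/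
def formOp (T : ℝ) (P Q Q' R : C(ℝ, Eu n →L[ℝ] Eu n)) : W12 T n →L[ℝ] W12 T n :=
  (derivL T n).adjoint.comp ((mulOp T P).comp (derivL T n) + (mulOp T Q).comp (valL T n)) +
  (valL T n).adjoint.comp ((mulOp T Q').comp (derivL T n) + (mulOp T R).comp (valL T n))

theorem inner_formOp (P Q Q' R : C(ℝ, Eu n →L[ℝ] Eu n)) (ξ η : W12 T n) :
    inner ℝ (formOp T P Q Q' R ξ) η =
      inner ℝ (mulOp T P (derivL T n ξ) + mulOp T Q (valL T n ξ)) (derivL T n η) +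
      inner ℝ (mulOp T Q' (derivL T n ξ) + mulOp T R (valL T n ξ)) (valL T n η) := by
  simp only [formOp, add_apply, ContinuousLinearMap.comp_apply, inner_add_left,
    ContinuousLinearMap.adjoint_inner_left]

theorem isSelfAdjoint_formOp {P Q Q' R : C(ℝ, Eu n →L[ℝ] Eu n)}
    (hP : ∀ t v w, inner ℝ (P t v) w = inner ℝ v (P t w))
    (hQ : ∀ t v w, inner ℝ (Q t v) w = inner ℝ v (Q' t w))
    (hR : ∀ t v w, inner ℝ (R t v) w = inner ℝ v (R t w)) :
    IsSelfAdjoint (formOp T P Q Q' R) := by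
  rw [ContinuousLinearMap.isSelfAdjoint_iff_isSymmetric]
  intro ξ η
  have hQ' : ∀ t v w, inner ℝ (Q' t v) w = inner ℝ v (Q t w) := fun t v w => by
    rw [real_inner_comm, ← hQ, real_inner_comm]
  have h1 := inner_formOp P Q Q' R ξ η
  have h2 := inner_formOp P Q Q' R η ξ
  rw [real_inner_comm] at h2
  rw [inner_add_left, inner_add_left] at h1 h2
  rw [inner_mulOp_comm hP, inner_mulOp_comm hQ, inner_mulOp_comm hQ', inner_mulOp_comm hR,
    real_inner_comm _ (derivL T n η), real_inner_comm _ (derivL T n η),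
    real_inner_comm _ (valL T n η), real_inner_comm _ (valL T n η)] at h2
  refine h1.trans (Eq.trans ?_ h2.symm)
  ring

/-- Tested against `C¹` loops, the equation says that `(P - μ) ξ' + Q ξ - g'` has the weak
derivative `Q' ξ' + R ξ - μ ξ - g`. As `Q ξ - g'` is continuous, `ξ'` can be solved for. The
parameters `μ` and `g` allow one proof for (CP2) and for eigenvectors. -/
theorem mem_range_incl_of_formOp (hT : 0 < T) {P Q Q' R : C(ℝ, Eu n →L[ℝ] Eu n)}
    (hPp : Periodic P T) (hQp : Periodic Q T) {μ : ℝ}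
    (hPu : ∀ t, IsUnit (P t - μ • (1 : Eu n →L[ℝ] Eu n)))
    {ξ : W12 T n} {g : C1 T n} (h : formOp T P Q Q' R ξ = μ • ξ + incl T n g) :
    ξ ∈ LinearMap.range (incl T n) := by
  obtain ⟨U, hU, hUp, hξU⟩ := (isWeakDeriv_W12 ξ).exists_continuous_periodic hT
  have hgp : Periodic g.1.2 T := fun t => by
    have h1 : HasDerivAt (fun s => g.1.1 (s + T)) (g.1.2 (t + T)) t := by
      simpa using (g.2.2 (t + T)).comp_add_const t T
    exact h1.unique (by simpa only [g.2.1 _] using g.2.2 t)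
  refine mem_range_incl_of_isWeakDeriv hT
    (f := mulOp T P (derivL T n ξ) + mulOp T Q (valL T n ξ) - μ • derivL T n ξ -
      derivL T n (incl T n g))
    (k := mulOp T Q' (derivL T n ξ) + mulOp T R (valL T n ξ) - μ • valL T n ξ -
      valL T n (incl T n g))
    (isWeakDeriv_of_inner_incl hT fun η => ?_)
    (P := fun t => P t - μ • (1 : Eu n →L[ℝ] Eu n)) (P.continuous.sub continuous_const)
    (fun t => by simp only [hPp t]) hPu (V := fun t => Q t (U t) - g.1.2 t)
    ((Q.continuous.clm_apply hU).sub g.1.2.continuous)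
    (fun t => by simp only [hQp t, hUp t, hgp t]) ?_
  · have h1 := inner_formOp P Q Q' R ξ (incl T n η)
    rw [h, inner_add_left, inner_W12 (μ • ξ), inner_W12 (incl T n g), map_smul, map_smul] at h1
    simp only [inner_sub_left]
    linarith
  · filter_upwards [Lp.coeFn_sub (mulOp T P (derivL T n ξ) + mulOp T Q (valL T n ξ) -
        μ • derivL T n ξ) (derivL T n (incl T n g)),
      Lp.coeFn_sub (mulOp T P (derivL T n ξ) + mulOp T Q (valL T n ξ)) (μ • derivL T n ξ),
      Lp.coeFn_add (mulOp T P (derivL T n ξ)) (mulOp T Q (valL T n ξ)),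
      Lp.coeFn_smul μ (derivL T n ξ), coeFn_mulOp P (derivL T n ξ), coeFn_mulOp Q (valL T n ξ),
      coeFn_derivL_incl g, hξU] with t h1 h2 h3 h4 h5 h6 h7 h8
    rw [h1, Pi.sub_apply, h2, Pi.sub_apply, h3, Pi.add_apply, h4, Pi.smul_apply, h5, h6, h7, h8]
    simp only [sub_apply, smul_apply, one_apply_eq_self]
    abel

end Multiplication

/-! ### The Poincaré inequality on short intervals -/

section Poincare

variable {T : ℝ} {n : ℕ}

/-- Cauchy-Schwarz against the constant `1`, obtained by expanding the nonnegative integral of the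
squared deviation of `‖w‖` from its mean. -/
theorem sq_integral_norm_le {E : Type*} [NormedAddCommGroup E] {a b : ℝ} (hab : a < b) {w : ℝ → E}
    (hw : IntervalIntegrable (fun t => ‖w t‖) volume a b)
    (hw2 : IntervalIntegrable (fun t => ‖w t‖ ^ 2) volume a b) :
    (∫ t in a..b, ‖w t‖) ^ 2 ≤ (b - a) * ∫ t in a..b, ‖w t‖ ^ 2 := by
  set S := ∫ t in a..b, ‖w t‖ with hS
  have hh : 0 < b - a := sub_pos.mpr hab
  have h1 : 0 ≤ ∫ t in a..b, (‖w t‖ - S / (b - a)) ^ 2 :=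
    intervalIntegral.integral_nonneg hab.le fun t _ => sq_nonneg _
  have h2 : ∫ t in a..b, (‖w t‖ - S / (b - a)) ^ 2 =
      (∫ t in a..b, ‖w t‖ ^ 2) - 2 * (S / (b - a)) * S + (b - a) * (S / (b - a)) ^ 2 := by
    have e : (fun t => (‖w t‖ - S / (b - a)) ^ 2) = fun t =>
        ‖w t‖ ^ 2 - 2 * (S / (b - a)) * ‖w t‖ + (S / (b - a)) ^ 2 := by
      funext t; ring
    rw [e, intervalIntegral.integral_add (hw2.sub (hw.const_mul _)) intervalIntegrable_const,
      intervalIntegral.integral_sub hw2 (hw.const_mul _), intervalIntegral.integral_const_mul,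
      intervalIntegral.integral_const, ← hS, smul_eq_mul]
  rw [h2] at h1
  have h3 : 0 ≤ (b - a) * ((∫ t in a..b, ‖w t‖ ^ 2) - 2 * (S / (b - a)) * S +
    (b - a) * (S / (b - a)) ^ 2) := mul_nonneg hh.le h1
  have h4 : (b - a) * ((∫ t in a..b, ‖w t‖ ^ 2) - 2 * (S / (b - a)) * S +
    (b - a) * (S / (b - a)) ^ 2) = (b - a) * (∫ t in a..b, ‖w t‖ ^ 2) - S ^ 2 := by
    field_simp
    ring
  linarith

/-- For the continuous representative `U`, mean zero gives `(b - a) U(t) = ∫ (U(t) - U(s)) ds`. Each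
difference is at most `∫ ‖w‖`, hence so is `U`, and Cauchy-Schwarz bounds the square of that
integral. -/
theorem integral_norm_sq_le_of_integral_eq_zero (hT : 0 < T) {u w : L2 T n} (h : IsWeakDeriv u w)
    {a b : ℝ} (hab : a < b) (ha : 0 ≤ a) (hb : b ≤ T) (h0 : ∫ t in a..b, u t = 0) :
    ∫ t in a..b, ‖u t‖ ^ 2 ≤ (b - a) ^ 2 * ∫ t in a..b, ‖w t‖ ^ 2 := by
  obtain ⟨c, hc⟩ := h.exists_ae_eq_primitive hT
  have hsub : Ioc a b ⊆ Ioc 0 T := Ioc_subset_Ioc ha hb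
  have hii : ∀ {E : Type} [NormedAddCommGroup E] {f : ℝ → E}, Integrable f (perMeas T) →
      ∀ s t, 0 ≤ s → s ≤ t → t ≤ T → IntervalIntegrable f volume s t :=
    fun hf s t hs hst ht => (intervalIntegrable_iff_integrableOn_Ioc_of_le hst).mpr
      (IntegrableOn.mono_set hf (Ioc_subset_Ioc hs ht))
  have hw := hii w.integrable
  have hwn := hii w.integrable.norm
  have hh : 0 < b - a := sub_pos.mpr hab
  set S := ∫ t in a..b, ‖w t‖ with hS
  set U : ℝ → Eu n := fun t => c + ∫ s in (0 : ℝ)..t, w s with hU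
  have huU : ∀ᵐ t ∂volume, t ∈ Ioc a b → u t = U t := by
    rw [← ae_restrict_iff' measurableSet_Ioc]
    exact ae_restrict_of_ae_restrict_of_subset hsub hc
  have huU' : ∀ᵐ t ∂volume, t ∈ uIoc a b → u t = U t := by rwa [uIoc_of_le hab.le]
  have hUi : IntervalIntegrable U volume a b :=
    (hii u.integrable a b ha hab.le hb).congr_ae
      ((ae_restrict_iff' measurableSet_uIoc).mpr huU')
  have hdiff : ∀ s ∈ Ioc a b, ∀ t ∈ Ioc a b, s ≤ t → ‖U t - U s‖ ≤ S := by
    intro s hs t ht hst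
    have e : U t - U s = ∫ r in s..t, w r := by
      simp only [hU, add_sub_add_left_eq_sub]
      rw [intervalIntegral.integral_interval_sub_left
        (hw 0 t le_rfl (ha.trans ht.1.le) (ht.2.trans hb))
        (hw 0 s le_rfl (ha.trans hs.1.le) (hs.2.trans hb))]
    rw [e]
    refine (intervalIntegral.norm_integral_le_integral_norm hst).trans ?_
    refine intervalIntegral.integral_mono_interval hs.1.le hst ht.2
      (Eventually.of_forall fun _ => norm_nonneg _) (hwn a b ha hab.le hb)
  have hdiff' : ∀ s ∈ Ioc a b, ∀ t ∈ Ioc a b, ‖U t - U s‖ ≤ S := by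
    intro s hs t ht
    rcases le_total s t with hst | hst
    · exact hdiff s hs t ht hst
    · rw [norm_sub_rev]; exact hdiff t ht s hs hst
  have hU0 : ∫ t in a..b, U t = 0 := by
    rw [← h0]
    exact intervalIntegral.integral_congr_ae (huU'.mono fun t ht htm => (ht htm).symm)
  have hbound : ∀ t ∈ Ioc a b, ‖U t‖ ≤ S := by
    intro t ht
    have e1 : ∫ s in a..b, (U t - U s) = (b - a) • U t := by
      rw [intervalIntegral.integral_sub intervalIntegrable_const hUi, hU0, sub_zero,
        intervalIntegral.integral_const]
    have e2 : ‖∫ s in a..b, (U t - U s)‖ ≤ S * |b - a| :=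
      intervalIntegral.norm_integral_le_of_norm_le_const fun s hs => by
        rw [uIoc_of_le hab.le] at hs
        exact hdiff' s hs t ht
    rw [e1, norm_smul, Real.norm_eq_abs, abs_of_pos hh, mul_comm] at e2
    exact le_of_mul_le_mul_right e2 hh
  have hS2 := sq_integral_norm_le hab (hwn a b ha hab.le hb)
    (hii (integrable_norm_sq w) a b ha hab.le hb)
  have h5 : ∫ t in a..b, ‖u t‖ ^ 2 ≤ ∫ _ in a..b, S ^ 2 := by
    refine intervalIntegral.integral_mono_ae_restrict hab.le
      (hii (integrable_norm_sq u) a b ha hab.le hb) intervalIntegrable_const ?_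
    -- The comparison of integrals is over the closed interval, whereas the pointwise bound holds on
    -- `(a, b]`.
    have hne : ∀ᵐ t ∂volume, t ≠ a := by simp [ae_iff]
    rw [EventuallyLE, ae_restrict_iff' measurableSet_Icc]
    filter_upwards [huU, hne] with t ht hta htm
    have htm' : t ∈ Ioc a b := ⟨lt_of_le_of_ne htm.1 hta.symm, htm.2⟩
    rw [ht htm']
    exact pow_le_pow_left₀ (norm_nonneg _) (hbound t htm') 2
  rw [intervalIntegral.integral_const, smul_eq_mul] at h5
  calc ∫ t in a..b, ‖u t‖ ^ 2 ≤ (b - a) * S ^ 2 := h5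
    _ ≤ (b - a) * ((b - a) * ∫ t in a..b, ‖w t‖ ^ 2) := by gcongr
    _ = _ := by ring

/-- For every `h > 0`, `‖ξ‖ ≤ h ‖ξ'‖` on a subspace of finite codimension of `W^{1,2}`. -/
theorem exists_poincare_subspace (hT : 0 < T) {h : ℝ} (hh : 0 < h) :
    ∃ K : Submodule ℝ (W12 T n), FiniteDimensional ℝ K ∧
      ∀ ξ ∈ Kᗮ, ‖valL T n ξ‖ ≤ h * ‖derivL T n ξ‖ := by
  obtain ⟨m, hm⟩ := exists_nat_gt (T / h)
  have hm0 : (0 : ℝ) < m := lt_trans (by positivity) hm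
  have hmpos : 0 < m := by exact_mod_cast hm0
  set x : ℕ → ℝ := fun j => j * (T / m) with hx
  have hxs : ∀ j, x (j + 1) - x j = T / m := fun j => by simp only [hx]; push_cast; ring
  have hlt : ∀ j, x j < x (j + 1) := fun j => by
    have := hxs j
    have h2 : 0 < T / m := by positivity
    linarith
  have hx0 : ∀ j, 0 ≤ x j := fun j => by positivity
  have hxT : ∀ j < m, x (j + 1) ≤ T := fun j hj => by
    have h1 : ((j + 1 : ℕ) : ℝ) ≤ m := by exact_mod_cast hj
    calc x (j + 1) = ((j + 1 : ℕ) : ℝ) * (T / m) := rfl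
      _ ≤ m * (T / m) := by gcongr
      _ = T := by field_simp
  have hμ : ∀ s : Set ℝ, perMeas T s ≠ ⊤ := fun s => measure_ne_top _ s
  -- Pairing `ξ` with `F (j, i)` gives the `i`-th coordinate of the integral of `ξ` over the `j`-th
  -- of `m` intervals of length `T / m < h`. Orthogonality to the span thus means mean zero on every
  -- interval.
  let F : Fin m × Fin n → W12 T n := fun ji => (valL T n).adjoint
    (indicatorConstLp 2 (measurableSet_Ioc (a := x ji.1) (b := x (ji.1 + 1))) (hμ _)
      (EuclideanSpace.single ji.2 (1 : ℝ)))
  refine ⟨Submodule.span ℝ (range F), FiniteDimensional.span_of_finite ℝ (finite_range F),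
    fun ξ hξ => ?_⟩
  set u := valL T n ξ
  set w := derivL T n ξ
  have hmean : ∀ j < m, ∫ t in x j..x (j + 1), u t = 0 := by
    intro j hj
    rw [intervalIntegral.integral_of_le (hlt j).le]
    have hsub : Ioc (x j) (x (j + 1)) ⊆ Ioc 0 T := Ioc_subset_Ioc (hx0 j) (hxT j hj)
    ext i
    have h1 := hξ (F (⟨j, hj⟩, i)) (Submodule.subset_span ⟨_, rfl⟩)
    rw [ContinuousLinearMap.adjoint_inner_left,
      L2.inner_indicatorConstLp_eq_inner_setIntegral, Measure.restrict_restrict measurableSet_Ioc,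
      inter_eq_left.mpr hsub] at h1
    simpa [EuclideanSpace.inner_single_left] using h1
  have hii : ∀ v : L2 T n, ∀ j < m, IntervalIntegrable (fun t => ‖v t‖ ^ 2) volume (x j) (x (j + 1)) :=
    fun v j hj => (intervalIntegrable_iff_integrableOn_Ioc_of_le (hlt j).le).mpr
      (IntegrableOn.mono_set (integrable_norm_sq v) (Ioc_subset_Ioc (hx0 j) (hxT j hj)))
  have hsum : ∀ v : L2 T n, ‖v‖ ^ 2 = ∑ j ∈ Finset.range m, ∫ t in x j..x (j + 1), ‖v t‖ ^ 2 := by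
    intro v
    rw [intervalIntegral.sum_integral_adjacent_intervals (hii v), norm_sq_L2,
      intervalIntegral.integral_of_le (hx0 m |>.trans' (by simp [hx]))]
    have e1 : x m = T := by simp only [hx]; field_simp
    have e0 : x 0 = 0 := by simp [hx]
    rw [e1, e0]
  have hle : ‖u‖ ^ 2 ≤ (T / m) ^ 2 * ‖w‖ ^ 2 := by
    rw [hsum u, hsum w, Finset.mul_sum]
    refine Finset.sum_le_sum fun j hj => ?_
    have hj' := Finset.mem_range.mp hj
    have := integral_norm_sq_le_of_integral_eq_zero hT (isWeakDeriv_W12 ξ) (hlt j) (hx0 j)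
      (hxT j hj') (hmean j hj')
    rwa [hxs j] at this
  have hTm : T / m ≤ h := by
    rw [div_le_iff₀ hm0]
    rw [div_lt_iff₀ hh] at hm
    linarith
  rw [← mul_pow] at hle
  calc ‖u‖ ≤ T / m * ‖w‖ := (sq_le_sq₀ (norm_nonneg _) (by positivity)).mp hle
    _ ≤ h * ‖w‖ := by gcongr

/-- The Gårding inequality, on a subspace of finite codimension. -/
theorem exists_coercive_subspace (hT : 0 < T) {P : C(ℝ, Eu n →L[ℝ] Eu n)}
    (Q Q' R : C(ℝ, Eu n →L[ℝ] Eu n)) {p : ℝ} (hp0 : 0 < p)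
    (hp : ∀ t ∈ Icc 0 T, ∀ v, p * ‖v‖ ^ 2 ≤ inner ℝ (P t v) v) :
    ∃ K : Submodule ℝ (W12 T n), FiniteDimensional ℝ K ∧
      ∀ ξ ∈ Kᗮ, p / 4 * ‖ξ‖ ^ 2 ≤ inner ℝ (formOp T P Q Q' R ξ) ξ := by
  set C := ‖mulOp T Q‖ + ‖mulOp T Q'‖ + ‖mulOp T R‖ with hC
  have hC0 : 0 ≤ C := by positivity
  -- The second bound makes the terms with `Q`, `Q'`, `R` at most `p / 2 * ‖ξ'‖²` together. The
  -- bound `1` gives `‖ξ‖ ≤ ‖ξ'‖` in `L²`, so the surviving `p / 2 * ‖ξ'‖²` dominates `p / 4` times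
  -- the squared `W^{1,2}` norm.
  have hh0 : 0 < min 1 (p / (2 * (C + 1))) := lt_min one_pos (by positivity)
  obtain ⟨K, hK, hpoin⟩ := exists_poincare_subspace (n := n) hT hh0
  refine ⟨K, hK, fun ξ hξ => ?_⟩
  have h1 := hpoin ξ hξ
  rw [inner_formOp, norm_sq_W12]
  set u := valL T n ξ
  set w := derivL T n ξ
  set h := min 1 (p / (2 * (C + 1)))
  have hh1 : h ≤ 1 := min_le_left _ _
  have hhp : h * (C + 1) ≤ p / 2 := by
    have : h ≤ p / (2 * (C + 1)) := min_le_right _ _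
    rw [le_div_iff₀ (by positivity)] at this
    linarith
  have huw : ‖u‖ ≤ ‖w‖ := h1.trans (mul_le_of_le_one_left (norm_nonneg _) hh1)
  have hPw := mul_norm_sq_le_inner_mulOp hp w
  have hb : ∀ (A : L2 T n →L[ℝ] L2 T n) (y z : L2 T n), -(‖A‖ * ‖y‖ * ‖z‖) ≤ inner ℝ (A y) z := by
    intro A y z
    have e1 := (abs_le.mp (abs_real_inner_le_norm (A y) z)).1
    have e2 : ‖A y‖ * ‖z‖ ≤ ‖A‖ * ‖y‖ * ‖z‖ := by gcongr; exact A.le_opNorm y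
    linarith
  have hQ := hb (mulOp T Q) u w
  have hQ' := hb (mulOp T Q') w u
  have hR := hb (mulOp T R) u u
  rw [inner_add_left, inner_add_left]
  have e1 : ‖u‖ * ‖w‖ ≤ h * ‖w‖ ^ 2 := by nlinarith [norm_nonneg w]
  have e2 : ‖u‖ * ‖u‖ ≤ h * ‖w‖ ^ 2 := by nlinarith [norm_nonneg w, norm_nonneg u]
  have e3 : C * (h * ‖w‖ ^ 2) ≤ p / 2 * ‖w‖ ^ 2 := by
    have : C * h ≤ p / 2 := by nlinarith
    nlinarith [sq_nonneg ‖w‖]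
  have f1 : ‖mulOp T Q‖ * ‖u‖ * ‖w‖ ≤ ‖mulOp T Q‖ * (h * ‖w‖ ^ 2) := by
    rw [mul_assoc]; gcongr
  have f2 : ‖mulOp T Q'‖ * ‖w‖ * ‖u‖ ≤ ‖mulOp T Q'‖ * (h * ‖w‖ ^ 2) := by
    rw [mul_assoc, mul_comm ‖w‖]; gcongr
  have f3 : ‖mulOp T R‖ * ‖u‖ * ‖u‖ ≤ ‖mulOp T R‖ * (h * ‖w‖ ^ 2) := by
    rw [mul_assoc]; gcongr
  have e4 : C * (h * ‖w‖ ^ 2) = ‖mulOp T Q‖ * (h * ‖w‖ ^ 2) + ‖mulOp T Q'‖ * (h * ‖w‖ ^ 2) +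
    ‖mulOp T R‖ * (h * ‖w‖ ^ 2) := by rw [hC]; ring
  have e5 : ‖u‖ ^ 2 ≤ ‖w‖ ^ 2 := pow_le_pow_left₀ (norm_nonneg _) huw 2
  nlinarith

/-- Compactness of `[0, T]` times the unit sphere, then homogeneity in `v`. -/
theorem exists_uniform_lower_bound (T : ℝ) {P : C(ℝ, Eu n →L[ℝ] Eu n)}
    (hpos : ∀ t v, v ≠ 0 → 0 < inner ℝ (P t v) v) :
    ∃ p > 0, ∀ t ∈ Icc 0 T, ∀ v, p * ‖v‖ ^ 2 ≤ inner ℝ (P t v) v := by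
  obtain ⟨p, hp0, hp⟩ := ((isCompact_Icc (a := (0 : ℝ)) (b := T)).prod
    (isCompact_sphere (0 : Eu n) 1)).exists_forall_le' (f := fun z => inner ℝ (P z.1 z.2) z.2)
    (a := 0) (by fun_prop) (fun z hz => hpos z.1 z.2 (by
      rintro h0
      have := hz.2
      simp [h0] at this))
  refine ⟨p, hp0, fun t ht v => ?_⟩
  by_cases hv : v = 0
  · simp [hv]
  have hv' : ‖v‖ ≠ 0 := norm_ne_zero_iff.mpr hv
  have h1 := hp (t, ‖v‖⁻¹ • v) ⟨ht, by simp [norm_smul, hv']⟩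
  simp only [map_smul, real_inner_smul_left, real_inner_smul_right] at h1
  rw [← mul_assoc, ← mul_inv, inv_mul_eq_div, le_div_iff₀ (by positivity)] at h1
  linarith [h1, sq ‖v‖]

/-- The spectral properties of the operator of a form with positive definite leading part. -/
theorem formOp_spectral (hT : 0 < T) {P Q Q' R : C(ℝ, Eu n →L[ℝ] Eu n)}
    (hPp : Periodic P T) (hQp : Periodic Q T)
    (hP : ∀ t v w, inner ℝ (P t v) w = inner ℝ v (P t w))
    (hQ : ∀ t v w, inner ℝ (Q t v) w = inner ℝ v (Q' t w))
    (hR : ∀ t v w, inner ℝ (R t v) w = inner ℝ v (R t w))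
    (hpos : ∀ t v, v ≠ 0 → 0 < inner ℝ (P t v) v) {B : W12 T n →L[ℝ] W12 T n}
    (hB : B = formOp T P Q Q' R) :
    IsSelfAdjoint B ∧
    ((0 : ℝ) ∉ spectrum ℝ B ∨ ∃ ε > 0, spectrum ℝ B ∩ Metric.ball 0 ε = {0}) ∧
    (∀ ξ : W12 T n, B ξ ∈ LinearMap.range (incl T n) → ξ ∈ LinearMap.range (incl T n)) ∧
    ∃ V : Submodule ℝ (W12 T n), IsNegativeSpace B V ∧
      (∀ V' : Submodule ℝ (W12 T n), IsNegativeSpace B V' → V' = V) ∧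
      FiniteDimensional ℝ V ∧ V ≤ LinearMap.range (incl T n) ∧
      ∀ S : Submodule ℝ (W12 T n), (∀ v ∈ S, v ≠ 0 → inner ℝ (B v) v < 0) →
        FiniteDimensional ℝ S ∧ Module.finrank ℝ S ≤ Module.finrank ℝ V := by
  have hsa : IsSelfAdjoint B := hB ▸ isSelfAdjoint_formOp hP hQ hR
  obtain ⟨p, hp0, hp⟩ := exists_uniform_lower_bound T hpos
  obtain ⟨K, hK, hcoer⟩ := exists_coercive_subspace hT Q Q' R hp0 hp
  rw [← hB] at hcoer
  have hKfd : FiniteDimensional ℝ Kᗮᗮ := by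
    rw [Submodule.orthogonal_orthogonal]; exact hK
  -- For `μ ≤ 0` the operator `P t - μ` is still positive definite, hence injective, hence
  -- invertible in finite dimension.
  have hunit : ∀ μ : ℝ, μ ≤ 0 → ∀ t, IsUnit (P t - μ • (1 : Eu n →L[ℝ] Eu n)) := by
    intro μ hμ t
    have hinj : Injective (P t - μ • (1 : Eu n →L[ℝ] Eu n)) := by
      rw [injective_iff_map_eq_zero]
      intro v hv
      by_contra hne
      have h1 := hpos t v hne
      have h2 : inner ℝ ((P t - μ • (1 : Eu n →L[ℝ] Eu n)) v) v = (0 : ℝ) := by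
        rw [hv, inner_zero_left]
      simp only [sub_apply, smul_apply, one_apply_eq_self,
        inner_sub_left, real_inner_smul_left, real_inner_self_eq_norm_sq] at h2
      nlinarith [sq_nonneg ‖v‖]
    exact ContinuousLinearMap.isUnit_iff_bijective.mpr
      ⟨hinj, LinearMap.injective_iff_surjective.mp hinj⟩
  refine ⟨hsa, zero_notMem_spectrum_or_isolated hsa (by positivity) hcoer, ?_, ?_⟩
  · rintro ξ ⟨g, hg⟩
    exact mem_range_incl_of_formOp hT hPp hQp (hunit 0 le_rfl) (R := R) (Q' := Q') (g := g)
      (by rw [← hB, hg, zero_smul, zero_add])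
  · obtain ⟨V, hV, huniq, hfd, hdim⟩ := exists_isNegativeSpace hsa (by positivity) hcoer
    refine ⟨V, hV, huniq, hfd, le_of_forall_eigenvector_mem hsa hV.invariant fun μ v hv hμ => ?_,
      hdim⟩
    by_cases hv0 : v = 0
    · rw [hv0]; exact Submodule.zero_mem _
    have hμ0 : μ ≤ 0 := by
      have h1 := hV.neg v hv hv0
      rw [hμ, real_inner_smul_left, real_inner_self_eq_norm_sq] at h1
      by_contra! h2
      exact absurd (mul_nonneg h2.le (sq_nonneg ‖v‖)) (not_le.mpr h1)
    exact mem_range_incl_of_formOp hT hPp hQp (hunit μ hμ0) (R := R) (Q' := Q') (g := 0)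
      (by rw [← hB, hμ, map_zero, add_zero])

end Poincare

/-! ### Calculus of families of maps -/

theorem eventually_nhds_slice {X : Type*} [TopologicalSpace X] {p : ℝ × X} {q : ℝ × X → Prop}
    (h : ∀ᶠ z in 𝓝 p, q z) :
    ∀ᶠ x in 𝓝 p.2, q (p.1, x) :=
  (Continuous.prodMk_right p.1).continuousAt.eventually (p := q) h

section Calculus

variable {E E' F G K : Type} [NormedAddCommGroup E] [NormedSpace ℝ E]
  [NormedAddCommGroup E'] [NormedSpace ℝ E'] [NormedAddCommGroup F] [NormedSpace ℝ F]
  [NormedAddCommGroup G] [NormedSpace ℝ G] [NormedAddCommGroup K] [NormedSpace ℝ K]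

theorem contDiffSndAt_zero {h : ℝ → E → F} {p : ℝ × E} :
    ContDiffSndAt 0 h p ↔ ∀ᶠ z in 𝓝 p, ContinuousAt (uncurry h) z := by
  have hc : ∀ z : ℝ × E, ContinuousAt (fun w : ℝ × E => iteratedFDeriv ℝ 0 (h w.1) w.2) z ↔
      ContinuousAt (uncurry h) z := fun z =>
    (continuousMultilinearCurryFin0 ℝ E F).symm.toHomeomorph.comp_continuousAt_iff (uncurry h) z
  constructor
  · intro H
    exact H.mono fun z hz => (hc z).mp (hz.2 0 le_rfl)
  · intro H
    filter_upwards [H.eventually_nhds] with z hz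
    refine ⟨?_, fun j hj => ?_⟩
    · rw [Nat.cast_zero, contDiffAt_zero]
      refine ⟨_, eventually_nhds_slice hz, fun x hx => ?_⟩
      have hx' : ContinuousAt (uncurry h) (z.1, x) := hx
      exact (hx'.comp (f := fun y => (z.1, y))
        (Continuous.prodMk_right z.1).continuousAt).continuousWithinAt
    · obtain rfl : j = 0 := Nat.le_zero.mp hj
      exact (hc z).mpr hz.self_of_nhds

/-- This recursion trades iterated derivatives for a single spatial derivative, so that the closure
properties below can be proved by induction on `r`. -/
theorem contDiffSndAt_succ {r : ℕ} {h : ℝ → E → F} {p : ℝ × E} :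
    ContDiffSndAt (r + 1) h p ↔
      (∀ᶠ z in 𝓝 p, ContinuousAt (uncurry h) z ∧ DifferentiableAt ℝ (h z.1) z.2) ∧
      ContDiffSndAt r (fun t x => fderiv ℝ (h t) x) p := by
  have hc0 : ∀ z : ℝ × E, ContinuousAt (fun w : ℝ × E => iteratedFDeriv ℝ 0 (h w.1) w.2) z ↔
      ContinuousAt (uncurry h) z := fun z =>
    (continuousMultilinearCurryFin0 ℝ E F).symm.toHomeomorph.comp_continuousAt_iff (uncurry h) z
  have hc : ∀ (j : ℕ) (z : ℝ × E),
      ContinuousAt (fun w : ℝ × E => iteratedFDeriv ℝ (j + 1) (h w.1) w.2) z ↔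
      ContinuousAt (fun w : ℝ × E => iteratedFDeriv ℝ j (fderiv ℝ (h w.1)) w.2) z := by
    intro j z
    have := (continuousMultilinearCurryRightEquiv' ℝ j E F).symm.toHomeomorph.comp_continuousAt_iff
      (fun w : ℝ × E => iteratedFDeriv ℝ j (fderiv ℝ (h w.1)) w.2) z
    rw [← this]
    simp only [iteratedFDeriv_succ_eq_comp_right]
    rfl
  constructor
  · intro H
    refine ⟨H.mono fun z hz => ⟨(hc0 z).mp (hz.2 0 (Nat.zero_le _)),
      hz.1.differentiableAt (by simp)⟩, H.mono fun z hz => ⟨?_, fun j hj => ?_⟩⟩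
    · exact hz.1.fderiv_right (by norm_cast)
    · exact (hc j z).mp (hz.2 (j + 1) (by omega))
  · rintro ⟨H1, H2⟩
    filter_upwards [H1.eventually_nhds, H2] with z hz1 hz2
    refine ⟨?_, fun j hj => ?_⟩
    · rw [Nat.cast_add, Nat.cast_one]
      refine contDiffAt_succ_iff_hasFDerivAt.mpr ⟨fderiv ℝ (h z.1),
        ⟨_, eventually_nhds_slice hz1, fun x hx => ?_⟩, hz2.1⟩
      have hx' : ContinuousAt (uncurry h) (z.1, x) ∧ DifferentiableAt ℝ (h z.1) x := hx
      exact hx'.2.hasFDerivAt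
    · cases j with
      | zero => exact (hc0 z).mpr hz1.self_of_nhds.1
      | succ j => exact (hc j z).mpr (hz2.2 j (by omega))

theorem ContDiffSndAt.eventually_continuousAt {r : ℕ} {h : ℝ → E → F} {p : ℝ × E}
    (H : ContDiffSndAt r h p) : ∀ᶠ z in 𝓝 p, ContinuousAt (uncurry h) z := by
  cases r with
  | zero => exact contDiffSndAt_zero.mp H
  | succ r => exact (contDiffSndAt_succ.mp H).1.mono fun z hz => hz.1

theorem ContDiffSndAt.continuousAt {r : ℕ} {h : ℝ → E → F} {p : ℝ × E}
    (H : ContDiffSndAt r h p) : ContinuousAt (uncurry h) p :=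
  H.eventually_continuousAt.self_of_nhds

theorem ContDiffSndAt.mono {r s : ℕ} (hs : s ≤ r) {h : ℝ → E → F} {p : ℝ × E}
    (H : ContDiffSndAt r h p) : ContDiffSndAt s h p :=
  Eventually.mono H fun _ hz => ⟨hz.1.of_le (by exact_mod_cast hs), fun j hj => hz.2 j (hj.trans hs)⟩

theorem ContDiffSndAt.congr {r : ℕ} {h h' : ℝ → E → F} {p : ℝ × E} (H : ContDiffSndAt r h p)
    (hh : ∀ᶠ z in 𝓝 p, h' z.1 z.2 = h z.1 z.2) : ContDiffSndAt r h' p := by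
  filter_upwards [H, hh.eventually_nhds] with z hz hzz
  have hsl : ∀ w : ℝ × E, (∀ᶠ y in 𝓝 w, h' y.1 y.2 = h y.1 y.2) → h' w.1 =ᶠ[𝓝 w.2] h w.1 :=
    fun w hw => eventually_nhds_slice hw
  refine ⟨hz.1.congr_of_eventuallyEq (hsl z hzz), fun j hj => (hz.2 j hj).congr ?_⟩
  filter_upwards [hzz.eventually_nhds] with w hw
  exact ((hsl w hw).symm.iteratedFDeriv ℝ j).self_of_nhds

theorem contDiffSndAt_const {r : ℕ} {g : ℝ → F} (hg : Continuous g) (p : ℝ × E) :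
    ContDiffSndAt r (fun t (_ : E) => g t) p := by
  have hc : ∀ z : ℝ × E, ContinuousAt (uncurry fun t (_ : E) => g t) z := fun z =>
    (hg.comp continuous_fst).continuousAt
  induction r generalizing F with
  | zero => exact contDiffSndAt_zero.mpr (Eventually.of_forall hc)
  | succ r ih =>
    refine contDiffSndAt_succ.mpr ⟨Eventually.of_forall fun z => ⟨hc z, by fun_prop⟩, ?_⟩
    have h0 : (fun (t : ℝ) (x : E) => fderiv ℝ (fun _ : E => g t) x) =
        fun _ _ => (0 : E →L[ℝ] F) := by
      funext t x; simp
    rw [h0]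
    exact ih continuous_const fun z => continuousAt_const

theorem ContDiffSndAt.add {r : ℕ} {f g : ℝ → E → F} {p : ℝ × E} (hf : ContDiffSndAt r f p)
    (hg : ContDiffSndAt r g p) : ContDiffSndAt r (fun t x => f t x + g t x) p := by
  induction r generalizing F with
  | zero =>
    rw [contDiffSndAt_zero] at *
    filter_upwards [hf, hg] with z h1 h2 using h1.add h2
  | succ r ih =>
    rw [contDiffSndAt_succ] at *
    refine ⟨?_, (ih hf.2 hg.2).congr ?_⟩
    · filter_upwards [hf.1, hg.1] with z h1 h2 using ⟨h1.1.add h2.1, h1.2.add h2.2⟩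
    · filter_upwards [hf.1, hg.1] with z h1 h2 using fderiv_fun_add h1.2 h2.2

/-- By the product rule the derivative is a sum of two bilinear expressions, in `(f, Dg)` and in
`(Df, g)`. The induction closes because it runs over all bilinear maps at once. -/
theorem ContDiffSndAt.bilinear {r : ℕ} (β : F →L[ℝ] G →L[ℝ] K) {f : ℝ → E → F} {g : ℝ → E → G}
    {p : ℝ × E} (hf : ContDiffSndAt r f p) (hg : ContDiffSndAt r g p) :
    ContDiffSndAt r (fun t x => β (f t x) (g t x)) p := by
  have hβ : ∀ {z : ℝ × E}, ContinuousAt (uncurry f) z → ContinuousAt (uncurry g) z →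
      ContinuousAt (uncurry fun t x => β (f t x) (g t x)) z := fun h1 h2 =>
    ContinuousAt.clm_apply (β.continuous.continuousAt.comp h1) h2
  induction r generalizing F G K with
  | zero =>
    rw [contDiffSndAt_zero] at *
    filter_upwards [hf, hg] with z h1 h2 using hβ h1 h2
  | succ r ih =>
    have hf' := contDiffSndAt_succ.mp hf
    have hg' := contDiffSndAt_succ.mp hg
    rw [contDiffSndAt_succ]
    refine ⟨?_, ((ih (β.precompR E) (hf.mono r.le_succ) hg'.2 ?_).add
      (ih (β.precompL E) hf'.2 (hg.mono r.le_succ) ?_)).congr ?_⟩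
    · filter_upwards [hf'.1, hg'.1] with z h1 h2
      exact ⟨hβ h1.1 h2.1, (β.hasFDerivAt_of_bilinear h1.2.hasFDerivAt
        h2.2.hasFDerivAt).differentiableAt⟩
    · intro z h1 h2
      exact ContinuousAt.clm_apply ((β.precompR E).continuous.continuousAt.comp h1) h2
    · intro z h1 h2
      exact ContinuousAt.clm_apply ((β.precompL E).continuous.continuousAt.comp h1) h2
    · filter_upwards [hf'.1, hg'.1] with z h1 h2
      exact (β.hasFDerivAt_of_bilinear h1.2.hasFDerivAt h2.2.hasFDerivAt).fderiv

/-- Only spatial derivatives are taken, so continuity of `Λ` in `t` suffices. This covers variations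
`s ↦ s η(t)` and the projections `(q, v) ↦ q`. -/
theorem ContDiffSndAt.comp_linear {r : ℕ} {h : ℝ → E → F} {Λ : ℝ → E' →L[ℝ] E} (hΛ : Continuous Λ)
    {p : ℝ × E'} (H : ContDiffSndAt r h (p.1, Λ p.1 p.2)) :
    ContDiffSndAt r (fun t x => h t (Λ t x)) p := by
  have hcont : Continuous fun z : ℝ × E' => (z.1, Λ z.1 z.2) := by fun_prop
  have hev : ∀ {q : ℝ × E → Prop}, (∀ᶠ z in 𝓝 (p.1, Λ p.1 p.2), q z) →
      ∀ᶠ z in 𝓝 p, q (z.1, Λ z.1 z.2) := fun {q} hq => hcont.continuousAt.eventually (p := q) hq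
  have hc : ∀ {z : ℝ × E'}, ContinuousAt (uncurry h) (z.1, Λ z.1 z.2) →
      ContinuousAt (uncurry fun t x => h t (Λ t x)) z := fun {z} h1 =>
    ContinuousAt.comp (g := uncurry h) (f := fun z : ℝ × E' => (z.1, Λ z.1 z.2)) h1
      hcont.continuousAt
  induction r generalizing F with
  | zero =>
    rw [contDiffSndAt_zero] at *
    filter_upwards [hev H] with z h1 using hc h1
  | succ r ih =>
    rw [contDiffSndAt_succ] at *
    refine ⟨?_, (ContDiffSndAt.bilinear (ContinuousLinearMap.compL ℝ E' E F) (ih H.2 ?_)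
      (contDiffSndAt_const hΛ p)).congr ?_⟩
    · filter_upwards [hev H.1] with z h1
      exact ⟨hc h1.1, h1.2.comp z.2 (Λ z.1).differentiableAt⟩
    · intro z h1
      exact ContinuousAt.comp (g := uncurry fun t x => fderiv ℝ (h t) x)
        (f := fun z : ℝ × E' => (z.1, Λ z.1 z.2)) h1 hcont.continuousAt
    · filter_upwards [hev H.1] with z h1
      exact (h1.2.hasFDerivAt.comp z.2 (Λ z.1).hasFDerivAt).fderiv

theorem contDiffSndAt_linear {r : ℕ} {Λ : ℝ → E →L[ℝ] F} (hΛ : Continuous Λ) (p : ℝ × E) :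
    ContDiffSndAt r (fun t x => Λ t x) p := by
  have hc : ∀ z, ContinuousAt (uncurry fun t x => Λ t x) z := fun z => by
    have : Continuous fun z : ℝ × E => Λ z.1 z.2 := by fun_prop
    exact this.continuousAt
  cases r with
  | zero => exact contDiffSndAt_zero.mpr (Eventually.of_forall hc)
  | succ r =>
    refine contDiffSndAt_succ.mpr ⟨Eventually.of_forall fun z => ⟨hc z, (Λ z.1).differentiableAt⟩,
      (contDiffSndAt_const hΛ p).congr (Eventually.of_forall fun z => (Λ z.1).fderiv)⟩

/-- The spatial derivative is `∂₂ℓ(t, h) ∘ Dh`: a bilinear expression whose first factor is again of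
the form treated, with `ℓ` replaced by `∂₂ℓ` of one class less. -/
theorem ContDiffSndAt.comp_left {r : ℕ} {h : ℝ → E → F} {p : ℝ × E} (H : ContDiffSndAt r h p)
    {ℓ : ℝ × F → G} (hℓ : ContDiffAt ℝ r ℓ (p.1, h p.1 p.2)) :
    ContDiffSndAt r (fun t x => ℓ (t, h t x)) p := by
  have hcp : ∀ {z : ℝ × E}, ContinuousAt (uncurry h) z →
      ContinuousAt (fun z : ℝ × E => (z.1, h z.1 z.2)) z := fun {z} h1 =>
    continuousAt_fst.prodMk h1
  have hev : ∀ {q : ℝ × F → Prop}, (∀ᶠ z in 𝓝 (p.1, h p.1 p.2), q z) →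
      ∀ᶠ z in 𝓝 p, q (z.1, h z.1 z.2) := fun {q} hq =>
    (hcp H.continuousAt).eventually (p := q) hq
  induction r generalizing G with
  | zero =>
    have h0 := hev (hℓ.eventually (by simp))
    rw [contDiffSndAt_zero] at *
    filter_upwards [H, h0] with z h1 h2
    exact ContinuousAt.comp (g := ℓ) (f := fun z : ℝ × E => (z.1, h z.1 z.2)) h2.continuousAt
      (hcp h1)
  | succ r ih =>
    have h0 := hev (hℓ.eventually (by simp))
    have H' := contDiffSndAt_succ.mp H
    have hℓ' : ContDiffAt ℝ r (fun z => (fderiv ℝ ℓ z).comp (ContinuousLinearMap.inr ℝ ℝ F))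
        (p.1, h p.1 p.2) :=
      (hℓ.fderiv_right (m := r) (by norm_cast)).clm_comp contDiffAt_const
    rw [contDiffSndAt_succ]
    have hd : ∀ {z : ℝ × E}, DifferentiableAt ℝ (h z.1) z.2 →
        DifferentiableAt ℝ ℓ (z.1, h z.1 z.2) → HasFDerivAt (fun x => ℓ (z.1, h z.1 x))
          (((fderiv ℝ ℓ (z.1, h z.1 z.2)).comp (ContinuousLinearMap.inr ℝ ℝ F)).comp
            (fderiv ℝ (h z.1) z.2)) z.2 := fun {z} h1 h2 => by
      have e1 : HasFDerivAt (fun x => (z.1, h z.1 x))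
          ((ContinuousLinearMap.inr ℝ ℝ F).comp (fderiv ℝ (h z.1) z.2)) z.2 :=
        (hasFDerivAt_prodMk_right z.1 (h z.1 z.2)).comp z.2 h1.hasFDerivAt
      exact h2.hasFDerivAt.comp z.2 e1
    refine ⟨?_, (ContDiffSndAt.bilinear (ContinuousLinearMap.compL ℝ E F G)
      (ih (H.mono r.le_succ) hℓ') H'.2).congr ?_⟩
    · filter_upwards [H'.1, h0] with z h1 h2
      exact ⟨ContinuousAt.comp (g := ℓ) (f := fun z : ℝ × E => (z.1, h z.1 z.2)) h2.continuousAt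
        (hcp h1.1), (hd h1.2 (h2.differentiableAt (by simp))).differentiableAt⟩
    · filter_upwards [H'.1, h0] with z h1 h2
      exact (hd h1.2 (h2.differentiableAt (by simp))).fderiv

theorem ContDiffSndAt.clm_left {r : ℕ} {h : ℝ → E → F} {p : ℝ × E} (H : ContDiffSndAt r h p)
    (A : F →L[ℝ] G) : ContDiffSndAt r (fun t x => A (h t x)) p :=
  H.comp_left (ℓ := fun z => A z.2) (A.contDiff.comp contDiff_snd).contDiffAt

theorem ContDiffSndAt.prodMk {r : ℕ} {f : ℝ → E → F} {g : ℝ → E → G} {p : ℝ × E}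
    (hf : ContDiffSndAt r f p) (hg : ContDiffSndAt r g p) :
    ContDiffSndAt r (fun t x => (f t x, g t x)) p :=
  ((hf.clm_left (ContinuousLinearMap.inl ℝ F G)).add
    (hg.clm_left (ContinuousLinearMap.inr ℝ F G))).congr (Eventually.of_forall fun z => by simp)

end Calculus

/-! ### Families of maps into a manifold, in charts -/

section Charts

variable {n : ℕ} {M : Type*} [TopologicalSpace M] [ChartedSpace (Eu n) M]
  {E : Type} [NormedAddCommGroup E] [NormedSpace ℝ E]

section

variable {r s : ℕ} {f : ℝ → E → M} {U : Set E}

theorem IsFamily.continuousAt (hf : IsFamily n r s f U) (hU : IsOpen U) {t : ℝ} {q : E}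
    (hq : q ∈ U) : ContinuousAt (uncurry f) (t, q) :=
  hf.cont.continuousAt ((isOpen_univ.prod hU).mem_nhds ⟨mem_univ t, hq⟩)

/-- Partial derivatives in `t` and in `q` that are continuous jointly in both variables yield total
differentiability. -/
theorem IsFamily.hasFDerivAt_localRep (hf : IsFamily n r s f U) (hr : 1 ≤ r) {t : ℝ} {q : E}
    (hq : q ∈ U) :
    ∀ᶠ z in 𝓝 (t, q), HasFDerivAt (uncurry (localRep n f t q))
      ((ContinuousLinearMap.toSpanSingleton ℝ
        (deriv (fun t' => localRep n f t q t' z.2) z.1)).coprod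
        (fderiv ℝ (localRep n f t q z.1) z.2)) z := by
  have h1 := contDiffSndAt_succ.mp ((hf.space t q hq).mono hr)
  have h2 := (hf.time t q hq).eventually_continuousAt
  filter_upwards [h1.1.eventually_nhds, h1.2.eventually_continuousAt, h2,
    (hf.diff t q hq).eventually_nhds] with z hz1 hz2 hz3 hz4
  refine (hasStrictFDerivAt_uncurry_coprod (f := localRep n f t q)
    (f₁ := fun t' x => ContinuousLinearMap.toSpanSingleton ℝ
        (deriv (fun t'' => localRep n f t q t'' x) t'))
    (f₂ := fun t' x => fderiv ℝ (localRep n f t q t') x) ?_ ?_ ?_ ?_).hasFDerivAt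
  · filter_upwards [hz4] with w hw
    exact hw.hasDerivAt.hasFDerivAt
  · filter_upwards [hz1] with w hw
    exact hw.2.hasFDerivAt
  · exact (ContinuousLinearMap.toSpanSingletonCLE (𝕜 := ℝ) (E := Eu n)).continuous.continuousAt.comp hz3
  · exact hz2

theorem IsFamily.eventually_mem_source (hf : IsFamily n r s f U) (hU : IsOpen U) {t : ℝ} {q : E}
    (hq : q ∈ U) : ∀ᶠ z in 𝓝 (t, q), f z.1 z.2 ∈ (chartAt (Eu n) (f t q)).source :=
  (hf.continuousAt hU hq).eventually
    ((chartAt (Eu n) (f t q)).open_source.mem_nhds (mem_chart_source _ _))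

theorem IsFamily.mdifferentiableAt (hf : IsFamily n r s f U) (hU : IsOpen U) (hr : 1 ≤ r) {t : ℝ}
    {q : E} (hq : q ∈ U) :
    MDifferentiableAt 𝓘(ℝ, ℝ × E) (𝓡 n) (uncurry f) (t, q) := by
  rw [mdifferentiableAt_iff]
  refine ⟨hf.continuousAt hU hq, ?_⟩
  have h := (hf.hasFDerivAt_localRep hr (t := t) hq).self_of_nhds.differentiableAt
  have h' : DifferentiableWithinAt ℝ (uncurry (localRep n f t q)) (range 𝓘(ℝ, ℝ × E)) (t, q) :=
    h.differentiableWithinAt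
  exact h'

end

variable [IsManifold (𝓡 n) 1 M]

/-- The chart at `f t q` is kept fixed while `z` moves near `(t, q)`. The fibre coordinate of the
velocity thereby becomes a function of `z` with known regularity. -/
theorem IsFamily.mfderiv_chart_apply {r s : ℕ} {f : ℝ → E → M} {U : Set E}
    (hf : IsFamily n r s f U) (hU : IsOpen U) (hr : 1 ≤ r) {t : ℝ} {q : E} (hq : q ∈ U) :
    ∀ᶠ z in 𝓝 (t, q), ∀ (c : ℝ) (v : E),
      mfderiv (𝓡 n) 𝓘(ℝ, Eu n) (extChartAt (𝓡 n) (f t q)) (f z.1 z.2)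
        (mfderiv 𝓘(ℝ, ℝ × E) (𝓡 n) (uncurry f) z ((c, v) : ℝ × E)) =
      c • deriv (fun t' => localRep n f t q t' z.2) z.1 + fderiv ℝ (localRep n f t q z.1) z.2 v := by
  have hmem : ∀ᶠ z : ℝ × E in 𝓝 (t, q), z.2 ∈ U :=
    continuousAt_snd.eventually (hU.mem_nhds hq)
  filter_upwards [hf.hasFDerivAt_localRep hr hq, hf.eventually_mem_source hU hq, hmem]
    with z hz1 hz2 hz3 c v
  have hd : MDifferentiableAt 𝓘(ℝ, ℝ × E) (𝓡 n) (uncurry f) z := hf.mdifferentiableAt hU hr hz3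
  have hψ : MDifferentiableAt (𝓡 n) 𝓘(ℝ, Eu n) (extChartAt (𝓡 n) (f t q)) (uncurry f z) :=
    mdifferentiableAt_extChartAt hz2
  have hcomp := mfderiv_comp z hψ hd
  have hfd : mfderiv 𝓘(ℝ, ℝ × E) 𝓘(ℝ, Eu n) (extChartAt (𝓡 n) (f t q) ∘ uncurry f) z =
      (ContinuousLinearMap.toSpanSingleton ℝ
        (deriv (fun t' => localRep n f t q t' z.2) z.1)).coprod
        (fderiv ℝ (localRep n f t q z.1) z.2) := by
    rw [mfderiv_eq_fderiv]
    exact hz1.fderiv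
  rw [hfd] at hcomp
  have := congrArg (fun A : ℝ × E →L[ℝ] Eu n => A (c, v)) hcomp
  refine Eq.trans ?_ (this.symm.trans ?_)
  · rfl
  · simp

/-- The chart of `TM` is built from the trivialization over the base chart, which acts on fibres as
the differential of that chart. Smoothness of `L` is thus turned into smoothness in position and
velocity coordinates. -/
theorem extChartAt_tangentBundle_apply (t₀ t : ℝ) (z₀ : TangentBundle (𝓡 n) M) {x : M}
    (hx : x ∈ (chartAt (Eu n) z₀.proj).source) (v : TangentSpace (𝓡 n) x) :
    extChartAt (𝓘(ℝ, ℝ).prod (𝓡 n).tangent) (t₀, z₀)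
      (t, (⟨x, v⟩ : TangentBundle (𝓡 n) M)) =
    (t, (extChartAt (𝓡 n) z₀.proj x,
      mfderiv (𝓡 n) 𝓘(ℝ, Eu n) (extChartAt (𝓡 n) z₀.proj) x v)) := by
  rw [← TangentBundle.continuousLinearMapAt_trivializationAt hx]
  rw [extChartAt_prod]
  refine Prod.ext rfl ?_
  change extChartAt ((𝓡 n).prod 𝓘(ℝ, Eu n)) z₀ ⟨x, v⟩ = _
  rw [FiberBundle.extChartAt]
  have hb : x ∈ (trivializationAt (Eu n) (TangentSpace (𝓡 n)) z₀.proj).baseSet := hx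
  refine Prod.ext ?_ ?_
  · change extChartAt (𝓡 n) z₀.proj
      ((trivializationAt (Eu n) (TangentSpace (𝓡 n)) z₀.proj) ⟨x, v⟩).1 = _
    rw [Bundle.Trivialization.coe_fst' _ hb]
  · change ((trivializationAt (Eu n) (TangentSpace (𝓡 n)) z₀.proj) ⟨x, v⟩).2 = _
    exact (congrFun (Bundle.Trivialization.coe_linearMapAt_of_mem (R := ℝ) _ hb) v).symm

end Charts

/-! ### The pulled-back Lagrangian -/

section Pullback

variable {n : ℕ} {M : Type*} [TopologicalSpace M] [ChartedSpace (Eu n) M]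
  {φ : ℝ → Eu n → M} {U : Set (Eu n)}

theorem tangentBundle_mk_congr {x y : M} (hxy : x = y) {v w : Eu n} (hvw : v = w) :
    (⟨x, (v : TangentSpace (𝓡 n) x)⟩ : TangentBundle (𝓡 n) M) =
      ⟨y, (w : TangentSpace (𝓡 n) y)⟩ := by
  subst hxy hvw
  rfl

/-- The chain rule along `s ↦ (s, q s)`; it identifies the action of `t ↦ φ t (ξ t)` with the
pulled-back functional at `ξ`. -/
theorem mfderiv_curve (hφ : IsFamily n 3 2 φ U) (hU : IsOpen U) {q : ℝ → Eu n} {q' : Eu n} {t : ℝ}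
    (hq : HasDerivAt q q' t) (hmem : q t ∈ U) :
    mfderiv 𝓘(ℝ, ℝ) (𝓡 n) (fun s => φ s (q s)) t (1 : ℝ) =
      mfderiv 𝓘(ℝ, ℝ × Eu n) (𝓡 n) (uncurry φ) (t, q t) ((1, q') : ℝ × Eu n) := by
  have hd : MDifferentiableAt 𝓘(ℝ, ℝ × Eu n) (𝓡 n) (uncurry φ) (t, q t) :=
    hφ.mdifferentiableAt hU (by norm_num) hmem
  have hc : HasMFDerivAt 𝓘(ℝ, ℝ) 𝓘(ℝ, ℝ × Eu n) (fun s => (s, q s)) t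
      ((ContinuousLinearMap.id ℝ ℝ).prod (ContinuousLinearMap.toSpanSingleton ℝ q')) :=
    ((hasFDerivAt_id t).prodMk hq.hasFDerivAt).hasMFDerivAt
  have h1 := (HasMFDerivAt.comp t (f := fun s => (s, q s)) hd.hasMFDerivAt hc).mfderiv
  have h2 := congrArg (fun A : ℝ →L[ℝ] Eu n => A 1) h1
  refine Eq.trans h2 ?_
  change (mfderiv 𝓘(ℝ, ℝ × Eu n) (𝓡 n) (uncurry φ) (t, q t) : ℝ × Eu n →L[ℝ] Eu n)
    ((1 : ℝ), (1 : ℝ) • q') = _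
  rw [one_smul]

theorem mfderiv_slice (hφ : IsFamily n 3 2 φ U) (hU : IsOpen U) {q : Eu n} (hq : q ∈ U) (t : ℝ)
    (v : Eu n) :
    mfderiv 𝓘(ℝ, Eu n) (𝓡 n) (φ t) q v =
      mfderiv 𝓘(ℝ, ℝ × Eu n) (𝓡 n) (uncurry φ) (t, q) ((0, v) : ℝ × Eu n) := by
  have hd : MDifferentiableAt 𝓘(ℝ, ℝ × Eu n) (𝓡 n) (uncurry φ) (t, q) :=
    hφ.mdifferentiableAt hU (by norm_num) hq
  have hc : HasMFDerivAt 𝓘(ℝ, Eu n) 𝓘(ℝ, ℝ × Eu n) (fun x => (t, x)) q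
      (ContinuousLinearMap.inr ℝ ℝ (Eu n)) :=
    (hasFDerivAt_prodMk_right t q).hasMFDerivAt
  have h1 := (HasMFDerivAt.comp q (f := fun x => (t, x)) hd.hasMFDerivAt hc).mfderiv
  exact congrArg (fun A : Eu n →L[ℝ] Eu n => A v) h1

variable {L : ℝ × TangentBundle (𝓡 n) M → ℝ}

theorem pullback_periodic {T : ℝ} (hLT : ∀ t z, L (t + T, z) = L (t, z))
    (hφ : IsFamily n 3 2 φ U) (hU : IsOpen U) (hper : ∀ t, ∀ q ∈ U, φ (t + T) q = φ t q)
    {q : Eu n} (hq : q ∈ U) (t : ℝ) (v : Eu n) :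
    pullback L φ (t + T) q v = pullback L φ t q v := by
  rw [pullback, pullback, hLT]
  congr 2
  refine tangentBundle_mk_congr (hper t q hq) ?_
  have hshift : HasMFDerivAt 𝓘(ℝ, ℝ × Eu n) 𝓘(ℝ, ℝ × Eu n)
      (fun z : ℝ × Eu n => (z.1 + T, z.2)) (t, q) (ContinuousLinearMap.id ℝ (ℝ × Eu n)) := by
    have h1 : HasFDerivAt (fun z : ℝ × Eu n => z + (T, 0)) (ContinuousLinearMap.id ℝ (ℝ × Eu n))
        (t, q) := (hasFDerivAt_id (t, q)).add_const (T, 0)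
    have h2 : (fun z : ℝ × Eu n => (z.1 + T, z.2)) = fun z => z + (T, 0) := by
      funext z; ext <;> simp
    rw [h2]
    exact h1.hasMFDerivAt
  have hd : MDifferentiableAt 𝓘(ℝ, ℝ × Eu n) (𝓡 n) (uncurry φ) (t + T, q) :=
    hφ.mdifferentiableAt hU (by norm_num) hq
  have hcomp := (HasMFDerivAt.comp (t, q) (f := fun z : ℝ × Eu n => (z.1 + T, z.2))
    hd.hasMFDerivAt hshift)
  have heq : uncurry φ =ᶠ[𝓝 (t, q)] uncurry φ ∘ fun z : ℝ × Eu n => (z.1 + T, z.2) := by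
    have hmem : ∀ᶠ z : ℝ × Eu n in 𝓝 (t, q), z.2 ∈ U :=
      continuousAt_snd.eventually (hU.mem_nhds hq)
    filter_upwards [hmem] with z hz
    exact (hper z.1 z.2 hz).symm
  have h2 := (hcomp.congr_of_eventuallyEq heq).mfderiv
  have h3 := congrArg (fun A : ℝ × Eu n →L[ℝ] Eu n => A (1, v)) h2
  exact h3.symm

theorem action_eq_pulledAction {T : ℝ} (hφ : IsFamily n 3 2 φ U) (hU : IsOpen U) (ξ : C1 T n)
    (hξ : ∀ t, ξ.1.1 t ∈ U) : action T L (fun t => φ t (ξ.1.1 t)) = pulledAction T L φ ξ := by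
  refine intervalIntegral.integral_congr fun t _ => ?_
  beta_reduce
  rw [pullback, mfderiv_curve hφ hU (ξ.2.2 t) (hξ t)]

/-- The variation `s ↦ φ t (s η(t))` is a `C¹` path of `C¹` loops. -/
theorem isFamily_variation {T : ℝ} (hφ : IsFamily n 3 2 φ U) (η : C1 T n) {ε : ℝ}
    (hε : ∀ s ∈ Metric.ball (0 : ℝ) ε, ∀ t, s • η.1.1 t ∈ U) :
    IsFamily n 1 1 (fun t (s : ℝ) => φ t (s • η.1.1 t)) (Metric.ball 0 ε) := by
  set Λ : ℝ → ℝ →L[ℝ] Eu n := fun t => ContinuousLinearMap.toSpanSingleton ℝ (η.1.1 t)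
  have hΛ : Continuous Λ :=
    (ContinuousLinearMap.toSpanSingletonCLE (𝕜 := ℝ) (E := Eu n)).continuous.comp η.1.1.continuous
  set Λ' : ℝ → ℝ →L[ℝ] Eu n := fun t => ContinuousLinearMap.toSpanSingleton ℝ (η.1.2 t) with hΛd'
  have hΛ' : Continuous Λ' :=
    (ContinuousLinearMap.toSpanSingletonCLE (𝕜 := ℝ) (E := Eu n)).continuous.comp η.1.2.continuous
  have hη : Continuous fun z : ℝ × ℝ => (z.1, z.2 • η.1.1 z.1) :=
    continuous_fst.prodMk (continuous_snd.smul (η.1.1.continuous.comp continuous_fst))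
  -- The time derivative of the variation is `∂ₜφ + D_qφ (s η')`, evaluated at `(t, s η(t))`. It is
  -- `C¹` in `s` because `∂ₜφ` and `D_qφ` are `C²` in `q`; in `t` only continuity of `η'` is used.
  have hder : ∀ t, ∀ s ∈ Metric.ball (0 : ℝ) ε, ∀ᶠ z : ℝ × ℝ in 𝓝 (t, s),
      HasDerivAt (fun t' => localRep n φ t (s • η.1.1 t) t' (z.2 • η.1.1 t'))
        (deriv (fun t' => localRep n φ t (s • η.1.1 t) t' (Λ z.1 z.2)) z.1 +
          fderiv ℝ (localRep n φ t (s • η.1.1 t) z.1) (Λ z.1 z.2) (Λ' z.1 z.2)) z.1 := by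
    intro t s hs
    filter_upwards [hη.continuousAt.eventually
      (hφ.hasFDerivAt_localRep (t := t) (by norm_num) (hε s hs t))] with z hz
    have h1 : HasDerivAt (fun t' => (t', z.2 • η.1.1 t')) ((1 : ℝ), z.2 • η.1.2 z.1) z.1 :=
      (hasDerivAt_id z.1).prodMk ((η.2.2 z.1).const_smul z.2)
    refine (hz.comp_hasDerivAt z.1 h1).congr_deriv ?_
    simp [Λ, Λ']
  refine ⟨?_, fun t s hs => ?_, fun t s hs => ?_, fun t s hs => ?_⟩
  · exact hφ.cont.comp hη.continuousOn fun z hz => ⟨mem_univ _, hε z.2 hz.2 z.1⟩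
  · exact ContDiffSndAt.comp_linear hΛ (p := (t, s))
      ((hφ.space t (s • η.1.1 t) (hε s hs t)).mono (by norm_num))
  · filter_upwards [hder t s hs] with z hz
    exact hz.differentiableAt
  · have s1 := hφ.space t (s • η.1.1 t) (hε s hs t)
    have s2 := (contDiffSndAt_succ.mp s1).2
    have s3 := hφ.time t (s • η.1.1 t) (hε s hs t)
    refine ContDiffSndAt.congr (ContDiffSndAt.add
      (ContDiffSndAt.comp_linear hΛ (p := (t, s)) (s3.mono (by norm_num)))
      (ContDiffSndAt.bilinear (ContinuousLinearMap.id ℝ (Eu n →L[ℝ] Eu n))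
        (ContDiffSndAt.comp_linear hΛ (p := (t, s)) (s2.mono (by norm_num)))
        (contDiffSndAt_linear hΛ' (t, s)))) ?_
    filter_upwards [hder t s hs] with z hz
    exact hz.deriv

variable [IsManifold (𝓡 n) 1 M]

theorem mem_extChartAt_tangentBundle_source (t₀ t : ℝ) (z₀ : TangentBundle (𝓡 n) M) {x : M}
    (hx : x ∈ (chartAt (Eu n) z₀.proj).source) (v : TangentSpace (𝓡 n) x) :
    (t, (⟨x, v⟩ : TangentBundle (𝓡 n) M)) ∈
      (extChartAt (𝓘(ℝ, ℝ).prod (𝓡 n).tangent) (t₀, z₀)).source := by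
  rw [extChartAt_source]
  refine ⟨mem_univ _, ?_⟩
  exact (TangentBundle.mem_chart_source_iff _ _).mpr hx

/-- In charts the pull-back is `ℓ(t, h t (q, v))` with `ℓ` of class `C²` and `h = (φ, ∂ₜφ + D_qφ
v)`. The term `D_qφ` costs one derivative of `φ`, hence class `C³` in `q`. -/
theorem contDiffSndAt_pullback (hL : ContMDiff (𝓘(ℝ, ℝ).prod (𝓡 n).tangent) 𝓘(ℝ, ℝ) 2 L)
    (hφ : IsFamily n 3 2 φ U) (hU : IsOpen U) {q : Eu n} (hq : q ∈ U) (t : ℝ) (v : Eu n) :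
    ContDiffSndAt 2 (fun t (z : Eu n × Eu n) => pullback L φ t z.1 z.2) (t, (q, v)) := by
  set z₀ : TangentBundle (𝓡 n) M :=
    ⟨φ t q, mfderiv 𝓘(ℝ, ℝ × Eu n) (𝓡 n) (uncurry φ) (t, q) ((1, v) : ℝ × Eu n)⟩ with hz₀
  set e := extChartAt (𝓘(ℝ, ℝ).prod (𝓡 n).tangent) (t, z₀)
  set h : ℝ → Eu n × Eu n → Eu n × Eu n := fun t' z => (localRep n φ t q t' z.1,
    deriv (fun t'' => localRep n φ t q t'' z.1) t' + fderiv ℝ (localRep n φ t q t') z.1 z.2) with hh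
  have hev : ∀ᶠ z : ℝ × (Eu n × Eu n) in 𝓝 (t, (q, v)),
      (z.1, (⟨φ z.1 z.2.1, mfderiv 𝓘(ℝ, ℝ × Eu n) (𝓡 n) (uncurry φ) (z.1, z.2.1)
        ((1, z.2.2) : ℝ × Eu n)⟩ : TangentBundle (𝓡 n) M)) ∈ e.source ∧
      e (z.1, (⟨φ z.1 z.2.1, mfderiv 𝓘(ℝ, ℝ × Eu n) (𝓡 n) (uncurry φ) (z.1, z.2.1)
        ((1, z.2.2) : ℝ × Eu n)⟩ : TangentBundle (𝓡 n) M)) = (z.1, h z.1 z.2) := by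
    have hc : ContinuousAt (fun z : ℝ × (Eu n × Eu n) => (z.1, z.2.1)) (t, (q, v)) := by fun_prop
    filter_upwards [hc.eventually (hφ.eventually_mem_source hU hq),
      hc.eventually (hφ.mfderiv_chart_apply hU (by norm_num) hq)] with z hz1 hz2
    refine ⟨mem_extChartAt_tangentBundle_source t z.1 z₀ hz1 _, ?_⟩
    refine (extChartAt_tangentBundle_apply t z.1 z₀ hz1 _).trans ?_
    have h3 := hz2 1 z.2.2
    rw [one_smul] at h3
    exact Prod.ext rfl (Prod.ext rfl h3)
  have hpt := hev.self_of_nhds.2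
  have hℓ : ContDiffAt ℝ 2 (L ∘ e.symm) (t, h t (q, v)) := by
    have h1 := (contMDiffAt_iff.mp (hL (t, z₀))).2
    rw [ModelWithCorners.range_eq_univ, contDiffWithinAt_univ] at h1
    have h2 : ContDiffAt ℝ 2 (L ∘ e.symm) (e (t, z₀)) := h1
    have h3 : e (t, z₀) = (t, h t (q, v)) := hpt
    rwa [h3] at h2
  have hfst : Continuous fun _ : ℝ => ContinuousLinearMap.fst ℝ (Eu n) (Eu n) := continuous_const
  have hsnd : Continuous fun _ : ℝ => ContinuousLinearMap.snd ℝ (Eu n) (Eu n) := continuous_const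
  have hH : ContDiffSndAt 2 h (t, (q, v)) := by
    have s1 := hφ.space t q hq
    have s2 := (contDiffSndAt_succ.mp s1).2
    have s3 := hφ.time t q hq
    refine ContDiffSndAt.prodMk (ContDiffSndAt.comp_linear hfst (p := (t, (q, v)))
      (s1.mono (by norm_num))) (ContDiffSndAt.add
        (ContDiffSndAt.comp_linear hfst (p := (t, (q, v))) s3) ?_)
    exact ContDiffSndAt.bilinear (ContinuousLinearMap.id ℝ (Eu n →L[ℝ] Eu n))
      (ContDiffSndAt.comp_linear hfst (p := (t, (q, v))) s2)
      (contDiffSndAt_linear hsnd (t, (q, v)))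
  refine (hH.comp_left hℓ).congr ?_
  filter_upwards [hev] with z hz
  rw [← hz.2, comp_apply, e.left_inv hz.1]
  rfl

end Pullback

/-! ### Differentiability of integral functionals on `C¹(S_T, ℝⁿ)` -/

section Taylor

variable {E F : Type} [NormedAddCommGroup E] [NormedSpace ℝ E]
  [NormedAddCommGroup F] [NormedSpace ℝ F]

/-- First order Taylor approximation along a curve, uniformly on a compact interval. -/
theorem exists_uniform_taylor {g : ℝ → E → F} {u : ℝ → E} (hu : Continuous u)
    (hg : ∀ t, ContDiffSndAt 1 g (t, u t)) (T : ℝ) {ε : ℝ} (hε : 0 < ε) :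
    ∃ δ > 0, ∀ t ∈ Icc 0 T, ∀ h, ‖h‖ < δ →
      ‖g t (u t + h) - g t (u t) - fderiv ℝ (g t) (u t) h‖ ≤ ε * ‖h‖ := by
  -- Compactness of `[0, T]` makes the neighbourhood of `0` independent of `t`; the mean value
  -- inequality on a ball about `u t` then bounds the remainder.
  have key : ∀ᶠ h : E in 𝓝 0, ∀ t ∈ Icc 0 T, DifferentiableAt ℝ (g t) (u t + h) ∧
      ‖fderiv ℝ (g t) (u t + h) - fderiv ℝ (g t) (u t)‖ ≤ ε := by
    refine isCompact_Icc.eventually_forall_of_forall_eventually fun t _ => ?_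
    have hs := contDiffSndAt_succ.mp (hg t)
    have hc : Continuous fun z : E × ℝ => (z.2, u z.2 + z.1) := by fun_prop
    have hc' : Continuous fun z : E × ℝ => (z.2, u z.2) := by fun_prop
    have e0 : (t, u t + 0) = (t, u t) := by rw [add_zero]
    have h1 : ∀ᶠ z : E × ℝ in 𝓝 (0, t), DifferentiableAt ℝ (g z.2) (u z.2 + z.1) := by
      have h2 : Tendsto (fun z : E × ℝ => (z.2, u z.2 + z.1)) (𝓝 (0, t)) (𝓝 (t, u t)) := by
        have := hc.tendsto (0, t)
        rwa [e0] at this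
      exact (h2.eventually hs.1).mono fun z hz => hz.2
    have hcd := hs.2.continuousAt
    have h2 : ContinuousAt (fun z : E × ℝ =>
        fderiv ℝ (g z.2) (u z.2 + z.1) - fderiv ℝ (g z.2) (u z.2)) (0, t) := by
      refine ContinuousAt.sub ?_ ?_
      · refine ContinuousAt.comp (g := uncurry fun t x => fderiv ℝ (g t) x)
          (f := fun z : E × ℝ => (z.2, u z.2 + z.1)) ?_ hc.continuousAt
        rw [e0]
        exact hcd
      · exact ContinuousAt.comp (g := uncurry fun t x => fderiv ℝ (g t) x)
          (f := fun z : E × ℝ => (z.2, u z.2)) hcd hc'.continuousAt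
    have h3 : ∀ᶠ z : E × ℝ in 𝓝 (0, t),
        ‖fderiv ℝ (g z.2) (u z.2 + z.1) - fderiv ℝ (g z.2) (u z.2)‖ < ε := by
      refine h2.norm.eventually_lt continuousAt_const ?_
      simpa using hε
    filter_upwards [h1, h3] with z hz1 hz3 using ⟨hz1, hz3.le⟩
  obtain ⟨δ, hδ, hball⟩ := Metric.eventually_nhds_iff.mp key
  refine ⟨δ, hδ, fun t ht h hh => ?_⟩
  have hmem : ∀ x ∈ Metric.ball (u t) δ, DifferentiableAt ℝ (g t) x ∧
      ‖fderiv ℝ (g t) x - fderiv ℝ (g t) (u t)‖ ≤ ε := by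
    intro x hx
    have := hball (y := x - u t) (by simpa [dist_eq_norm] using hx) t ht
    rwa [add_sub_cancel] at this
  have := (convex_ball (u t) δ).norm_image_sub_le_of_norm_hasFDerivWithin_le'
    (f := g t) (f' := fderiv ℝ (g t)) (φ := fderiv ℝ (g t) (u t)) (C := ε) (x := u t) (y := u t + h)
    (fun x hx => (hmem x hx).1.hasFDerivAt.hasFDerivWithinAt) (fun x hx => (hmem x hx).2)
    (Metric.mem_ball_self hδ) (by simpa [dist_eq_norm] using hh)
  rwa [add_sub_cancel_left] at this

end Taylor

section Functional

variable {T : ℝ} {n : ℕ}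

/-- The 1-jet of a loop. -/
def jet (ξ : C1 T n) (t : ℝ) : Eu n × Eu n := (ξ.1.1 t, ξ.1.2 t)

theorem continuous_jet (ξ : C1 T n) : Continuous (jet ξ) :=
  ξ.1.1.continuous.prodMk ξ.1.2.continuous

theorem norm_jet_le (ξ : C1 T n) (t : ℝ) : ‖jet ξ t‖ ≤ ‖ξ‖ :=
  max_le ((ξ.1.1.norm_coe_le_norm t).trans (norm_fst_le ξ.1))
    ((ξ.1.2.norm_coe_le_norm t).trans (norm_snd_le ξ.1))

theorem exists_integral_bound {F : Type*} [NormedAddCommGroup F] {A : ℝ → F} (hA : Continuous A)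
    (T : ℝ) : ∃ C, 0 ≤ C ∧ ∀ t ∈ Icc 0 T, ‖A t‖ ≤ C := by
  obtain ⟨C, hC⟩ := (isCompact_Icc (a := (0 : ℝ)) (b := T)).exists_bound_of_continuousOn
    hA.continuousOn
  exact ⟨max C 0, le_max_right _ _, fun t ht => (hC t ht).trans (le_max_left _ _)⟩

theorem abs_integral_le (hT : 0 ≤ T) {f : ℝ → ℝ} {C : ℝ} (h : ∀ t ∈ Icc 0 T, ‖f t‖ ≤ C) :
    ‖∫ t in (0 : ℝ)..T, f t‖ ≤ C * T := by
  have := intervalIntegral.norm_integral_le_of_norm_le_const (a := 0) (b := T) (f := f) (C := C)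
    (fun t ht => h t (by rw [uIoc_of_le hT] at ht; exact Ioc_subset_Icc_self ht))
  rwa [sub_zero, abs_of_nonneg hT] at this

/-- The linear functional `η ↦ ∫₀ᵀ A(t) (η, η') dt`. -/
def firstVariation (hT : 0 ≤ T) (A : C(ℝ, Eu n × Eu n →L[ℝ] ℝ)) : C1 T n →L[ℝ] ℝ :=
  LinearMap.mkContinuousOfExistsBound
    { toFun := fun η => ∫ t in (0 : ℝ)..T, A t (jet η t)
      map_add' := fun η ζ => by
        rw [← intervalIntegral.integral_add
          ((A.continuous.clm_apply (continuous_jet η)).intervalIntegrable _ _)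
          ((A.continuous.clm_apply (continuous_jet ζ)).intervalIntegrable _ _)]
        exact intervalIntegral.integral_congr fun t _ => (A t).map_add (jet η t) (jet ζ t)
      map_smul' := fun c η => by
        rw [RingHom.id_apply, ← intervalIntegral.integral_smul]
        exact intervalIntegral.integral_congr fun t _ => (A t).map_smul c (jet η t) }
    (by
      obtain ⟨C, hC0, hC⟩ := exists_integral_bound A.continuous T
      refine ⟨C * T, fun η => ?_⟩
      refine (abs_integral_le (C := C * ‖η‖) hT fun t ht => ?_).trans (le_of_eq (by ring))
      exact (A t).le_of_opNorm_le_of_le (hC t ht) (norm_jet_le η t))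

theorem firstVariation_apply (hT : 0 ≤ T) (A : C(ℝ, Eu n × Eu n →L[ℝ] ℝ)) (η : C1 T n) :
    firstVariation hT A η = ∫ t in (0 : ℝ)..T, A t (jet η t) := rfl

/-- The bilinear form `∫₀ᵀ a(t) (ξ, ξ') (η, η') dt`. -/
def secondVariation (hT : 0 ≤ T) (a : C(ℝ, Eu n × Eu n →L[ℝ] Eu n × Eu n →L[ℝ] ℝ)) :
    C1 T n →L[ℝ] C1 T n →L[ℝ] ℝ :=
  LinearMap.mkContinuousOfExistsBound
    { toFun := fun ξ => firstVariation hT ⟨fun t => a t (jet ξ t),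
        a.continuous.clm_apply (continuous_jet ξ)⟩
      map_add' := fun ξ ζ => by
        ext η
        simp only [add_apply, firstVariation_apply, ContinuousMap.coe_mk]
        rw [← intervalIntegral.integral_add
          (((a.continuous.clm_apply (continuous_jet ξ)).clm_apply
            (continuous_jet η)).intervalIntegrable _ _)
          (((a.continuous.clm_apply (continuous_jet ζ)).clm_apply
            (continuous_jet η)).intervalIntegrable _ _)]
        exact intervalIntegral.integral_congr fun t _ => by
          have : jet (ξ + ζ) t = jet ξ t + jet ζ t := rfl
          simp only [this, map_add, add_apply]
      map_smul' := fun c ξ => by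
        ext η
        simp only [smul_apply, firstVariation_apply, ContinuousMap.coe_mk, RingHom.id_apply]
        rw [← intervalIntegral.integral_smul]
        exact intervalIntegral.integral_congr fun t _ => by
          have : jet (c • ξ) t = c • jet ξ t := rfl
          simp only [this, map_smul, smul_apply] }
    (by
      obtain ⟨C, hC0, hC⟩ := exists_integral_bound
        (F := Eu n × Eu n →L[ℝ] Eu n × Eu n →L[ℝ] ℝ) a.continuous T
      refine ⟨C * T, fun ξ => ?_⟩
      refine ContinuousLinearMap.opNorm_le_bound _ (by positivity) fun η => ?_
      refine (abs_integral_le (C := C * ‖ξ‖ * ‖η‖) hT fun t ht => ?_).trans (le_of_eq (by ring))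
      exact ContinuousLinearMap.le_of_opNorm_le_of_le _
        ((a t).le_of_opNorm_le_of_le (hC t ht) (norm_jet_le ξ t)) (norm_jet_le η t))

theorem secondVariation_apply (hT : 0 ≤ T) (a : C(ℝ, Eu n × Eu n →L[ℝ] Eu n × Eu n →L[ℝ] ℝ))
    (ξ η : C1 T n) :
    secondVariation hT a ξ η = ∫ t in (0 : ℝ)..T, a t (jet ξ t) (jet η t) := rfl

variable {G : ℝ → Eu n × Eu n → ℝ} {ρ : ℝ}

theorem continuous_comp_of_contDiffSndAt {E F : Type} [NormedAddCommGroup E] [NormedSpace ℝ E]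
    [NormedAddCommGroup F] [NormedSpace ℝ F] {r : ℕ} {g : ℝ → E → F} {u : ℝ → E}
    (hu : Continuous u) (hg : ∀ t, ContDiffSndAt r g (t, u t)) : Continuous fun t => g t (u t) :=
  continuous_iff_continuousAt.mpr fun t => ContinuousAt.comp (g := uncurry g)
    (f := fun t => (t, u t)) (hg t).continuousAt (continuous_id.prodMk hu).continuousAt

theorem jet_mem_ball {ξ : C1 T n} (hξ : ‖ξ‖ < ρ) (t : ℝ) : jet ξ t ∈ Metric.ball 0 ρ :=
  mem_ball_zero_iff.mpr ((norm_jet_le ξ t).trans_lt hξ)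

theorem continuous_fderiv_jet (hG : ∀ t, ∀ z ∈ Metric.ball 0 ρ, ContDiffSndAt 2 G (t, z))
    {ξ : C1 T n} (hξ : ‖ξ‖ < ρ) : Continuous fun t => fderiv ℝ (G t) (jet ξ t) :=
  continuous_comp_of_contDiffSndAt (g := fun t z => fderiv ℝ (G t) z) (continuous_jet ξ)
    fun t => (contDiffSndAt_succ.mp (hG t _ (jet_mem_ball hξ t))).2

theorem continuous_hessian (hρ : 0 < ρ)
    (hG : ∀ t, ∀ z ∈ Metric.ball 0 ρ, ContDiffSndAt 2 G (t, z)) :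
    Continuous fun t => fderiv ℝ (fderiv ℝ (G t)) 0 :=
  continuous_comp_of_contDiffSndAt (g := fun t z => fderiv ℝ (fderiv ℝ (G t)) z) continuous_const
    fun t => (contDiffSndAt_succ.mp (contDiffSndAt_succ.mp
      (hG t 0 (Metric.mem_ball_self hρ))).2).2

/-- The `C¹` norm controls the 1-jet uniformly in `t`, so the pointwise Taylor remainder is at most
`c / T * ‖h‖` and integrates to `c ‖h‖`. -/
theorem hasFDerivAt_integral_jet (hT : 0 < T)
    (hG : ∀ t, ∀ z ∈ Metric.ball 0 ρ, ContDiffSndAt 2 G (t, z)) {ξ : C1 T n} (hξ : ‖ξ‖ < ρ) :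
    HasFDerivAt (fun ξ : C1 T n => ∫ t in (0 : ℝ)..T, G t (jet ξ t))
      (firstVariation hT.le ⟨_, continuous_fderiv_jet hG hξ⟩) ξ := by
  rw [hasFDerivAt_iff_isLittleO_nhds_zero, Asymptotics.isLittleO_iff]
  intro c hc
  obtain ⟨δ, hδ, htay⟩ := exists_uniform_taylor (continuous_jet ξ)
    (fun t => (hG t _ (jet_mem_ball hξ t)).mono (by norm_num : 1 ≤ 2)) T (ε := c / T) (by positivity)
  have hcont : ∀ {ζ : C1 T n}, ‖ζ‖ < ρ → Continuous fun t => G t (jet ζ t) := fun {ζ} hζ =>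
    continuous_comp_of_contDiffSndAt (continuous_jet ζ) fun t => hG t _ (jet_mem_ball hζ t)
  have hnear : ∀ᶠ h : C1 T n in 𝓝 0, ‖h‖ < min δ (ρ - ‖ξ‖) :=
    (continuous_norm.tendsto (0 : C1 T n)).eventually_lt_const
      (by rw [norm_zero]; exact lt_min hδ (by linarith))
  filter_upwards [hnear] with h hh
  have hξh : ‖ξ + h‖ < ρ := by
    have := lt_of_lt_of_le hh (min_le_right _ _)
    linarith [norm_add_le ξ h]
  simp only [firstVariation_apply, ContinuousMap.coe_mk]
  rw [← intervalIntegral.integral_sub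
    ((hcont hξh).intervalIntegrable _ _) ((hcont hξ).intervalIntegrable _ _),
    ← intervalIntegral.integral_sub
    (((hcont hξh).fun_sub (hcont hξ)).intervalIntegrable _ _)
    (((continuous_fderiv_jet hG hξ).clm_apply (continuous_jet h)).intervalIntegrable _ _)]
  refine (abs_integral_le (C := c / T * ‖h‖) hT.le fun t ht => ?_).trans
    (le_of_eq (by rw [mul_right_comm, div_mul_cancel₀ _ hT.ne']))
  have hj : ‖jet h t‖ < δ := (norm_jet_le h t).trans_lt (hh.trans_le (min_le_left _ _))
  refine (htay t ht (jet h t) hj).trans ?_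
  gcongr
  exact norm_jet_le h t

/-- The Taylor estimate is now applied to the fibre derivative `DG` at `0`. Tested on `η`, the
remainder is at most `c ‖h‖ ‖η‖`, which is an operator norm bound. -/
theorem hasFDerivAt_fderiv_integral_jet (hT : 0 < T) (hρ : 0 < ρ)
    (hG : ∀ t, ∀ z ∈ Metric.ball 0 ρ, ContDiffSndAt 2 G (t, z)) :
    HasFDerivAt (fderiv ℝ fun ξ : C1 T n => ∫ t in (0 : ℝ)..T, G t (jet ξ t))
      (secondVariation hT.le ⟨_, continuous_hessian hρ hG⟩) 0 := by
  rw [hasFDerivAt_iff_isLittleO_nhds_zero, Asymptotics.isLittleO_iff]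
  intro c hc
  have h0 : ‖(0 : C1 T n)‖ < ρ := by rwa [norm_zero]
  obtain ⟨δ, hδ, htay⟩ := exists_uniform_taylor (g := fun t z => fderiv ℝ (G t) z)
    (u := fun _ => 0) continuous_const
    (fun t => (contDiffSndAt_succ.mp (hG t 0 (Metric.mem_ball_self hρ))).2) T
    (ε := c / T) (by positivity)
  have hnear : ∀ᶠ h : C1 T n in 𝓝 0, ‖h‖ < min δ ρ :=
    (continuous_norm.tendsto (0 : C1 T n)).eventually_lt_const
      (by rw [norm_zero]; exact lt_min hδ hρ)
  filter_upwards [hnear] with h hh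
  have hhρ : ‖h‖ < ρ := hh.trans_le (min_le_right _ _)
  rw [zero_add, (hasFDerivAt_integral_jet hT hG hhρ).fderiv,
    (hasFDerivAt_integral_jet hT hG h0).fderiv]
  refine ContinuousLinearMap.opNorm_le_bound _ (by positivity) fun η => ?_
  simp only [sub_apply, firstVariation_apply, secondVariation_apply, ContinuousMap.coe_mk]
  have c1 : ∀ {ζ : C1 T n}, ‖ζ‖ < ρ → Continuous fun t => fderiv ℝ (G t) (jet ζ t) (jet η t) :=
    fun {ζ} hζ => (continuous_fderiv_jet hG hζ).clm_apply (continuous_jet η)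
  have c2 : Continuous fun t => fderiv ℝ (fderiv ℝ (G t)) 0 (jet h t) (jet η t) :=
    ((continuous_hessian hρ hG).clm_apply (continuous_jet h)).clm_apply (continuous_jet η)
  rw [← intervalIntegral.integral_sub ((c1 hhρ).intervalIntegrable _ _)
    ((c1 h0).intervalIntegrable _ _), ← intervalIntegral.integral_sub
    (((c1 hhρ).fun_sub (c1 h0)).intervalIntegrable _ _) (c2.intervalIntegrable _ _)]
  refine (abs_integral_le (C := c / T * ‖h‖ * ‖η‖) hT.le fun t ht => ?_).trans
    (le_of_eq (by rw [mul_right_comm _ ‖η‖, mul_right_comm _ ‖h‖, div_mul_cancel₀ _ hT.ne']))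
  have hj : ‖jet h t‖ < δ := (norm_jet_le h t).trans_lt (hh.trans_le (min_le_left _ _))
  have h1 := htay t ht (jet h t) hj
  rw [zero_add] at h1
  have h2 : ‖fderiv ℝ (G t) (jet h t) - fderiv ℝ (G t) 0 - fderiv ℝ (fderiv ℝ (G t)) 0 (jet h t)‖ ≤
      c / T * ‖h‖ := h1.trans (by gcongr; exact norm_jet_le h t)
  exact ContinuousLinearMap.le_of_opNorm_le_of_le _ h2 (norm_jet_le η t)

end Functional

/-! ### The operator of the second variation -/

section Blocks

variable {n : ℕ}

/-- The operator `A` with `(A v) · w = b (Y w) (X v)`. -/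
def blockOp (X Y : Eu n →L[ℝ] Eu n × Eu n) (b : Eu n × Eu n →L[ℝ] Eu n × Eu n →L[ℝ] ℝ) :
    Eu n →L[ℝ] Eu n :=
  ∑ i, ((b (Y (EuclideanSpace.single i 1))).comp X).smulRight (EuclideanSpace.single i (1 : ℝ))

theorem inner_blockOp (X Y : Eu n →L[ℝ] Eu n × Eu n)
    (b : Eu n × Eu n →L[ℝ] Eu n × Eu n →L[ℝ] ℝ) (v w : Eu n) :
    inner ℝ (blockOp X Y b v) w = b (Y w) (X v) := by
  have hw : w = ∑ i, w i • EuclideanSpace.single i (1 : ℝ) := by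
    simpa using ((EuclideanSpace.basisFun (Fin n) ℝ).sum_repr w).symm
  have h1 : b (Y w) (X v) = ∑ i, w i * b (Y (EuclideanSpace.single i 1)) (X v) := by
    conv_lhs => rw [hw]
    simp only [map_sum, map_smul, sum_apply, smul_apply, smul_eq_mul]
  rw [h1]
  simp only [blockOp, sum_apply, ContinuousLinearMap.smulRight_apply,
    ContinuousLinearMap.comp_apply, sum_inner, real_inner_smul_left,
    EuclideanSpace.inner_single_left]
  refine Finset.sum_congr rfl fun i _ => ?_
  simp [mul_comm]

theorem continuous_blockOp (X Y : Eu n →L[ℝ] Eu n × Eu n) :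
    Continuous (blockOp X Y) := by
  refine continuous_finsetSum _ fun i _ => ?_
  have h : Continuous fun b : Eu n × Eu n →L[ℝ] Eu n × Eu n →L[ℝ] ℝ =>
      (b (Y (EuclideanSpace.single i 1))).comp X :=
    (continuous_id.clm_apply continuous_const).clm_comp continuous_const
  exact ((ContinuousLinearMap.smulRightL ℝ (Eu n) (Eu n)).flip
    (EuclideanSpace.single i (1 : ℝ))).continuous.comp h

/-- Splitting each jet as `(ξ, 0) + (0, ξ')` breaks the Hessian into its four blocks. Symmetry is
needed because the blocks take the jet of `η` as first argument. -/
theorem secondVariation_eq_inner_formOp {T : ℝ} (hT : 0 ≤ T)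
    (a : C(ℝ, Eu n × Eu n →L[ℝ] Eu n × Eu n →L[ℝ] ℝ)) (hsymm : ∀ t z w, a t z w = a t w z)
    {P Q Q' R : C(ℝ, Eu n →L[ℝ] Eu n)}
    (hP : ∀ t v w, inner ℝ (P t v) w = a t (0, w) (0, v))
    (hQ : ∀ t v w, inner ℝ (Q t v) w = a t (0, w) (v, 0))
    (hQ' : ∀ t v w, inner ℝ (Q' t v) w = a t (w, 0) (0, v))
    (hR : ∀ t v w, inner ℝ (R t v) w = a t (w, 0) (v, 0)) (ξ η : C1 T n) :
    secondVariation hT a ξ η = inner ℝ (formOp T P Q Q' R (incl T n ξ)) (incl T n η) := by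
  have hcont : ∀ (A : C(ℝ, Eu n →L[ℝ] Eu n)) (u v : ℝ →ᵇ Eu n),
      Integrable (fun t => inner ℝ (A t (u t)) (v t)) (perMeas T) := fun A u v =>
    ((A.continuous.clm_apply u.continuous).inner v.continuous).integrableOn_Ioc
  have e1 : ∀ A : C(ℝ, Eu n →L[ℝ] Eu n), inner ℝ (mulOp T A (derivL T n (incl T n ξ)))
      (derivL T n (incl T n η)) = ∫ t, inner ℝ (A t (ξ.1.2 t)) (η.1.2 t) ∂(perMeas T) := fun A => by
    rw [inner_mulOp]
    refine integral_congr_ae ?_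
    filter_upwards [coeFn_derivL_incl ξ, coeFn_derivL_incl η] with t h1 h2
    rw [h1, h2]
  have e2 : ∀ A : C(ℝ, Eu n →L[ℝ] Eu n), inner ℝ (mulOp T A (valL T n (incl T n ξ)))
      (derivL T n (incl T n η)) = ∫ t, inner ℝ (A t (ξ.1.1 t)) (η.1.2 t) ∂(perMeas T) := fun A => by
    rw [inner_mulOp]
    refine integral_congr_ae ?_
    filter_upwards [coeFn_valL_incl ξ, coeFn_derivL_incl η] with t h1 h2
    rw [h1, h2]
  have e3 : ∀ A : C(ℝ, Eu n →L[ℝ] Eu n), inner ℝ (mulOp T A (derivL T n (incl T n ξ)))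
      (valL T n (incl T n η)) = ∫ t, inner ℝ (A t (ξ.1.2 t)) (η.1.1 t) ∂(perMeas T) := fun A => by
    rw [inner_mulOp]
    refine integral_congr_ae ?_
    filter_upwards [coeFn_derivL_incl ξ, coeFn_valL_incl η] with t h1 h2
    rw [h1, h2]
  have e4 : ∀ A : C(ℝ, Eu n →L[ℝ] Eu n), inner ℝ (mulOp T A (valL T n (incl T n ξ)))
      (valL T n (incl T n η)) = ∫ t, inner ℝ (A t (ξ.1.1 t)) (η.1.1 t) ∂(perMeas T) := fun A => by
    rw [inner_mulOp]
    refine integral_congr_ae ?_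
    filter_upwards [coeFn_valL_incl ξ, coeFn_valL_incl η] with t h1 h2
    rw [h1, h2]
  rw [inner_formOp, inner_add_left, inner_add_left, e1, e2, e3, e4,
    ← integral_add (hcont P _ _) (hcont Q _ _), ← integral_add (hcont Q' _ _) (hcont R _ _),
    ← integral_add ((hcont P _ _).fun_add (hcont Q _ _)) ((hcont Q' _ _).fun_add (hcont R _ _)),
    secondVariation_apply, intervalIntegral.integral_of_le hT]
  refine integral_congr_ae (Eventually.of_forall fun t => ?_)
  have hd : ∀ ζ : C1 T n, jet ζ t = (ζ.1.1 t, 0) + (0, ζ.1.2 t) := fun ζ => by simp [jet]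
  simp only [hP, hQ, hQ', hR]
  rw [hsymm, hd ξ, hd η]
  simp only [map_add, add_apply]
  ring

end Blocks

/-- This passes from fibrewise convexity, which is expressed by second derivatives along lines, to
the Hessian. -/
theorem iteratedDeriv_two_line {E : Type*} [NormedAddCommGroup E] [NormedSpace ℝ E] {f : E → ℝ}
    {x : E} (hf : ContDiffAt ℝ 2 f x) (v : E) :
    iteratedDeriv 2 (fun s : ℝ => f (x + s • v)) 0 = fderiv ℝ (fderiv ℝ f) x v v := by
  have hline : ∀ s : ℝ, HasDerivAt (fun s : ℝ => x + s • v) v s := fun s => by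
    simpa using ((hasDerivAt_id s).smul_const v).const_add x
  have hc : Tendsto (fun s : ℝ => x + s • v) (𝓝 0) (𝓝 x) := by
    have := (hline 0).continuousAt.tendsto
    rwa [zero_smul, add_zero] at this
  have h1 : deriv (fun s : ℝ => f (x + s • v)) =ᶠ[𝓝 0] fun s => fderiv ℝ f (x + s • v) v := by
    filter_upwards [hc.eventually (hf.eventually (by simp))] with s hs
    exact ((hs.differentiableAt (by simp)).hasFDerivAt.comp_hasDerivAt s (hline s)).deriv
  have h2 : HasFDerivAt (fderiv ℝ f) (fderiv ℝ (fderiv ℝ f) x) (x + (0 : ℝ) • v) := by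
    rw [zero_smul, add_zero]
    exact ((hf.fderiv_right (m := 1) one_add_one_eq_two.le).differentiableAt (by simp)).hasFDerivAt
  have h3 : HasDerivAt (fun s : ℝ => fderiv ℝ f (x + s • v) v)
      (fderiv ℝ (fderiv ℝ f) x v v) 0 :=
    (ContinuousLinearMap.apply ℝ ℝ v).hasFDerivAt.comp_hasDerivAt 0
      (h2.comp_hasDerivAt 0 (hline 0))
  rw [iteratedDeriv_succ, iteratedDeriv_one, h1.deriv_eq, h3.deriv]

/-- The second derivative is unique, so the two forms agree on `C¹` loops; density of these in
`W^{1,2}` is used once for each argument. -/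
theorem RepresentsHessian.eq {T : ℝ} (hT : 0 < T) {n : ℕ} {f : C1 T n → ℝ}
    {B B' : W12 T n →L[ℝ] W12 T n} (hB : RepresentsHessian f B) (hB' : RepresentsHessian f B') :
    B = B' := by
  obtain ⟨-, D, hD, h⟩ := hB
  obtain ⟨-, D', hD', h'⟩ := hB'
  obtain rfl := hD.unique hD'
  have hd := denseRange_incl (n := n) hT
  refine ContinuousLinearMap.coeFn_injective
    (hd.equalizer B.continuous B'.continuous (funext fun ξ => ?_))
  refine ext_inner_right ℝ fun η => ?_
  have hη : (fun η => inner ℝ (B (incl T n ξ)) η) = fun η => inner ℝ (B' (incl T n ξ)) η :=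
    hd.equalizer (by fun_prop) (by fun_prop) (funext fun η => (h ξ η).symm.trans (h' ξ η))
  exact congrFun hη η

/-! ### Positivity of the pulled-back Hessian and criticality of the zero loop -/

section Main

variable {n : ℕ} {M : Type*} [TopologicalSpace M] [ChartedSpace (Eu n) M]
  {L : ℝ × TangentBundle (𝓡 n) M → ℝ} {T ρ : ℝ} {γ : ℝ → M} {φ : ℝ → Eu n → M}

/-- The pull-back, as a function of the time and the 1-jet. -/
def jetPullback (L : ℝ × TangentBundle (𝓡 n) M → ℝ) (φ : ℝ → Eu n → M) (t : ℝ)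
    (z : Eu n × Eu n) : ℝ :=
  pullback L φ t z.1 z.2

theorem fst_mem_ball {z : Eu n × Eu n} (hz : z ∈ Metric.ball 0 ρ) : z.1 ∈ Metric.ball 0 ρ := by
  rw [mem_ball_zero_iff] at *
  exact (norm_fst_le z).trans_lt hz

theorem hessian_jetPullback_periodic (hLT : ∀ t z, L (t + T, z) = L (t, z)) (hρ : 0 < ρ)
    (hφ : IsLoopChart T ρ γ φ) (t : ℝ) :
    fderiv ℝ (fderiv ℝ (jetPullback L φ (t + T))) 0 = fderiv ℝ (fderiv ℝ (jetPullback L φ t)) 0 := by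
  have h : jetPullback L φ (t + T) =ᶠ[𝓝 0] jetPullback L φ t := by
    filter_upwards [Metric.ball_mem_nhds (0 : Eu n × Eu n) hρ] with z hz
    exact pullback_periodic hLT hφ.regular Metric.isOpen_ball hφ.periodic (fst_mem_ball hz) t z.2
  exact h.fderiv.fderiv_eq

/-- Along the line `s ↦ (0, s v)` the pull-back is `L` on a line in one fixed tangent space, with
direction `D_qφ(t, 0) v`. The immersion property makes this direction nonzero, so fibrewise
convexity applies. -/
theorem hessian_jetPullback_pos (hρ : 0 < ρ) (hφ : IsLoopChart T ρ γ φ) (hconv : FibrewiseConvex L)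
    {t : ℝ} (hG : ContDiffAt ℝ 2 (jetPullback L φ t) 0) {v : Eu n} (hv : v ≠ 0) :
    0 < fderiv ℝ (fderiv ℝ (jetPullback L φ t)) 0 (0, v) (0, v) := by
  have h0 : (0 : Eu n) ∈ Metric.ball (0 : Eu n) ρ := Metric.mem_ball_self hρ
  rw [← iteratedDeriv_two_line hG ((0, v) : Eu n × Eu n)]
  set A : ℝ × Eu n →L[ℝ] Eu n := mfderiv 𝓘(ℝ, ℝ × Eu n) (𝓡 n) (uncurry φ) (t, 0)
  have hu : A (0, v) ≠ 0 := by
    have h1 : mfderiv 𝓘(ℝ, Eu n) (𝓡 n) (φ t) 0 v = A (0, v) :=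
      mfderiv_slice hφ.regular Metric.isOpen_ball h0 t v
    rw [← h1]
    intro h2
    exact hv (hφ.immersion t 0 h0 (h2.trans (map_zero _).symm))
  have key := hconv t (φ t 0) (A (1, 0)) (A (0, v)) hu
  have hfun : (fun s : ℝ => jetPullback L φ t (0 + s • ((0, v) : Eu n × Eu n))) =
      fun s : ℝ => L (t, ⟨φ t 0, A (1, 0) + s • A (0, v)⟩) := by
    funext s
    have e1 : (0 + s • ((0, v) : Eu n × Eu n)) = (0, s • v) := by simp
    have e2 : A (1, s • v) = A (1, 0) + s • A (0, v) := by
      rw [← map_smul, ← map_add]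
      simp
    rw [e1]
    change L (t, ⟨φ t 0, A (1, s • v)⟩) = _
    rw [e2]
  rw [hfun]
  exact key

/-- The derivative at `0` exists, so only its values on single directions `η` matter. These are
derivatives of the action along the admissible paths `s ↦ φ t (s η(t))`, which vanish by criticality
of `γ`. -/
theorem hasFDerivAt_pulledAction_zero (hT : 0 < T) (hρ : 0 < ρ) (hγ : IsCriticalLoop T L γ)
    (hφ : IsLoopChart T ρ γ φ)
    (hG : ∀ t, ∀ z ∈ Metric.ball 0 ρ, ContDiffSndAt 2 (jetPullback L φ) (t, z)) :
    HasFDerivAt (pulledAction T L φ) (0 : C1 T n →L[ℝ] ℝ) 0 := by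
  have h0 : ‖(0 : C1 T n)‖ < ρ := by rwa [norm_zero]
  obtain ⟨A, hd⟩ : ∃ A : C1 T n →L[ℝ] ℝ, HasFDerivAt (pulledAction T L φ) A 0 :=
    ⟨_, hasFDerivAt_integral_jet hT hG h0⟩
  suffices hA : A = 0 by rwa [hA] at hd
  refine ContinuousLinearMap.ext fun η => ?_
  -- Chosen so that `s η` stays in the ball of radius `ρ` for `|s| < ε`; the `1` covers `η = 0`.
  set ε := ρ / (‖η‖ + 1) with hε
  have hε0 : 0 < ε := by positivity
  have hmem : ∀ s ∈ Metric.ball (0 : ℝ) ε, ∀ t, s • η.1.1 t ∈ Metric.ball (0 : Eu n) ρ := by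
    intro s hs t
    rw [mem_ball_zero_iff] at hs ⊢
    rw [norm_smul]
    have h1 : ‖η.1.1 t‖ ≤ ‖η‖ := (norm_fst_le (jet η t)).trans (norm_jet_le η t)
    calc ‖s‖ * ‖η.1.1 t‖ ≤ ‖s‖ * (‖η‖ + 1) := by gcongr; linarith
      _ < ε * (‖η‖ + 1) := by gcongr
      _ = ρ := div_mul_cancel₀ _ (by positivity)
  have h1 := hγ.2.2 ε (fun t s => φ t (s • η.1.1 t)) hε0 (isFamily_variation hφ.regular η hmem)
    (fun t s hs => by
      have hp : η.1.1 (t + T) = η.1.1 t := η.2.1 t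
      beta_reduce
      rw [hp]
      exact hφ.periodic t _ (hmem s hs t))
    (fun t => by rw [zero_smul]; exact hφ.center t)
  have h2 : (fun s => action T L fun t => φ t (s • η.1.1 t)) =ᶠ[𝓝 0]
      fun s : ℝ => pulledAction T L φ (s • η) := by
    filter_upwards [Metric.ball_mem_nhds (0 : ℝ) hε0] with s hs
    exact action_eq_pulledAction hφ.regular Metric.isOpen_ball (s • η) (hmem s hs)
  have h3 := h1.congr_of_eventuallyEq h2.symm
  have hline : HasDerivAt (fun s : ℝ => s • η) η 0 := by
    simpa using (hasDerivAt_id (0 : ℝ)).smul_const η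
  have h4 : HasDerivAt (fun s : ℝ => pulledAction T L φ (s • η)) (A η) 0 :=
    hd.comp_hasDerivAt_of_eq 0 hline (zero_smul ℝ η).symm
  exact h4.unique h3

end Main

end Loop

end

theorem lemma2p4 {n : ℕ} {M : Type*} [TopologicalSpace M] [T2Space M] [CompactSpace M]
    [ChartedSpace (Loop.Eu n) M] [IsManifold (𝓡 n) 3 M]
    (k : ℕ) (hk : 0 < k) (τ : ℝ) (hτ : 0 < τ)
    (L : ℝ × TangentBundle (𝓡 n) M → ℝ)
    (hL : ContMDiff (𝓘(ℝ, ℝ).prod (𝓡 n).tangent) 𝓘(ℝ, ℝ) 2 L)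
    (hper : ∀ t z, L (t + τ, z) = L (t, z))
    (hconv : Loop.FibrewiseConvex L)
    (γ₀ : ℝ → M) (hγ₀ : Loop.IsCriticalLoop (k * τ) L γ₀)
    (ρ : ℝ) (hρ : 0 < ρ) (φ : ℝ → Loop.Eu n → M) (hφ : Loop.IsLoopChart (k * τ) ρ γ₀ φ) :
    (∃! B : Loop.W12 (k * τ) n →L[ℝ] Loop.W12 (k * τ) n,
      Loop.RepresentsHessian (Loop.pulledAction (k * τ) L φ) B) ∧
    ∀ B : Loop.W12 (k * τ) n →L[ℝ] Loop.W12 (k * τ) n,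
      Loop.RepresentsHessian (Loop.pulledAction (k * τ) L φ) B →
      IsSelfAdjoint B ∧
      HasFDerivAt (Loop.pulledAction (k * τ) L φ) (0 : Loop.C1 (k * τ) n →L[ℝ] ℝ) 0 ∧
      ((0 : ℝ) ∉ spectrum ℝ B ∨ ∃ ε > 0, spectrum ℝ B ∩ Metric.ball 0 ε = {0}) ∧
      (∀ ξ : Loop.W12 (k * τ) n, B ξ ∈ LinearMap.range (Loop.incl (k * τ) n) →
        ξ ∈ LinearMap.range (Loop.incl (k * τ) n)) ∧
      ∃ V : Submodule ℝ (Loop.W12 (k * τ) n),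
        Loop.IsNegativeSpace B V ∧
        (∀ V' : Submodule ℝ (Loop.W12 (k * τ) n), Loop.IsNegativeSpace B V' → V' = V) ∧
        FiniteDimensional ℝ V ∧
        V ≤ LinearMap.range (Loop.incl (k * τ) n) ∧
        ∀ S : Submodule ℝ (Loop.W12 (k * τ) n),
          (∀ v ∈ S, v ≠ 0 → inner ℝ (B v) v < 0) →
          FiniteDimensional ℝ S ∧ Module.finrank ℝ S ≤ Module.finrank ℝ V := by
  have hT : 0 < (k : ℝ) * τ := mul_pos (Nat.cast_pos.mpr hk) hτ
  have hLT : ∀ t z, L (t + k * τ, z) = L (t, z) := fun t z =>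
    Function.Periodic.nat_mul (f := fun t => L (t, z)) (fun t => hper t z) k t
  have hG : ∀ t, ∀ z ∈ Metric.ball 0 ρ, Loop.ContDiffSndAt 2 (Loop.jetPullback L φ) (t, z) :=
    fun t z hz => Loop.contDiffSndAt_pullback hL hφ.regular Metric.isOpen_ball
      (Loop.fst_mem_ball hz) t z.2
  have hG0 : ∀ t, ContDiffAt ℝ 2 (Loop.jetPullback L φ t) 0 := fun t =>
    (hG t 0 (Metric.mem_ball_self hρ)).self_of_nhds.1
  -- The Hessian of `L̃` in `(q, v)` along the zero loop. Its blocks are the coefficients below: `P`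
  -- is the `vv` part, `Q` and `Q'` the mixed parts, `R` the `qq` part.
  let a : C(ℝ, Loop.Eu n × Loop.Eu n →L[ℝ] Loop.Eu n × Loop.Eu n →L[ℝ] ℝ) :=
    ⟨_, Loop.continuous_hessian hρ hG⟩
  have hsymm : ∀ t z w, a t z w = a t w z := fun t z w =>
    ((hG0 t).isSymmSndFDerivAt (by simp)).eq z w
  have hap : Function.Periodic a (k * τ) := Loop.hessian_jetPullback_periodic hLT hρ hφ
  let X := ContinuousLinearMap.inl ℝ (Loop.Eu n) (Loop.Eu n)
  let Y := ContinuousLinearMap.inr ℝ (Loop.Eu n) (Loop.Eu n)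
  let P : C(ℝ, Loop.Eu n →L[ℝ] Loop.Eu n) :=
    ⟨fun t => Loop.blockOp Y Y (a t), (Loop.continuous_blockOp Y Y).comp a.continuous⟩
  let Q : C(ℝ, Loop.Eu n →L[ℝ] Loop.Eu n) :=
    ⟨fun t => Loop.blockOp X Y (a t), (Loop.continuous_blockOp X Y).comp a.continuous⟩
  let Q' : C(ℝ, Loop.Eu n →L[ℝ] Loop.Eu n) :=
    ⟨fun t => Loop.blockOp Y X (a t), (Loop.continuous_blockOp Y X).comp a.continuous⟩
  let R : C(ℝ, Loop.Eu n →L[ℝ] Loop.Eu n) :=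
    ⟨fun t => Loop.blockOp X X (a t), (Loop.continuous_blockOp X X).comp a.continuous⟩
  have hP : ∀ t v w, inner ℝ (P t v) w = a t (0, w) (0, v) := fun t => Loop.inner_blockOp Y Y (a t)
  have hQ : ∀ t v w, inner ℝ (Q t v) w = a t (0, w) (v, 0) := fun t => Loop.inner_blockOp X Y (a t)
  have hQ' : ∀ t v w, inner ℝ (Q' t v) w = a t (w, 0) (0, v) :=
    fun t => Loop.inner_blockOp Y X (a t)
  have hR : ∀ t v w, inner ℝ (R t v) w = a t (w, 0) (v, 0) := fun t => Loop.inner_blockOp X X (a t)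
  have hrep : Loop.RepresentsHessian (Loop.pulledAction (k * τ) L φ)
      (Loop.formOp (k * τ) P Q Q' R) := by
    refine ⟨?_, Loop.secondVariation hT.le a, Loop.hasFDerivAt_fderiv_integral_jet hT hρ hG,
      Loop.secondVariation_eq_inner_formOp hT.le a hsymm hP hQ hQ' hR⟩
    filter_upwards [Metric.ball_mem_nhds (0 : Loop.C1 (k * τ) n) hρ] with ξ hξ
    exact (Loop.hasFDerivAt_integral_jet hT hG (mem_ball_zero_iff.mp hξ)).differentiableAt
  -- By uniqueness any representing `B` equals this `formOp`, so the spectral results for forms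
  -- apply to it.
  refine ⟨⟨_, hrep, fun B hB => hB.eq hT hrep⟩, fun B hB => ?_⟩
  obtain ⟨h1, h2, h3, h4⟩ := Loop.formOp_spectral hT (P := P) (Q := Q) (Q' := Q') (R := R)
    (fun t => congrArg (Loop.blockOp Y Y) (hap t)) (fun t => congrArg (Loop.blockOp X Y) (hap t))
    (fun t v w => by rw [hP, real_inner_comm, hP, hsymm])
    (fun t v w => by rw [hQ, real_inner_comm, hQ', hsymm])
    (fun t v w => by rw [hR, real_inner_comm, hR, hsymm])
    (fun t v hv => by
      rw [hP]; exact Loop.hessian_jetPullback_pos hρ hφ hconv (hG0 t) hv)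
    (hB.eq hT hrep)
  exact ⟨h1, Loop.hasFDerivAt_pulledAction_zero hT hρ hγ₀ hφ hG, h2, h3, h4⟩
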